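/- Let $M$ be a smooth compact $n$-dimensional manifold (Hausdorff, without boundary) and let $L_1,L_2\in C^\infty(TM)$ be two Lagrange functions. Assume that each $L=L_i$ is non-degenerate, i.e. $\det\big(\partial^2L/\partial\dot q^j\partial\dot q^k\big)\neq0$ everywhere on $TM$, and that its Legendre transformation $T_qM\to T_q^*M$, $\dot q\mapsto p=\partial L/\partial\dot q\,(q,\dot q)$, is onto for every $q\in M$, so that the Hamilton function $H_i(q,p)=\big(\langle p,\dot q\rangle-L_i(q,\dot q)\big)\big|_{p=\partial L_i/\partial\dot q(q,\dot q)}$ is defined on all of $T^*M$. For $q,q'\in M$ and $t>0$ let $$S_i(q,q',t)=\min\Big\{\int_0^tL_i(\gamma(s),\dot\gamma(s))\,ds\ \Big|\ \gamma:[0,t]\to M\text{ of class }C^1,\ \gamma(0)=q,\ \gamma(t)=q'\Big\}$$ be the principal action function of $L_i$ (an infimum where the minimum is not attained, and $+\infty$ if there is no such path). Assume that for $i=1,2$ the minimum is attained for all $(q,q')$ in some neighbourhood of the diagonal of $M\times M$ and all sufficiently small $t>0$. Suppose that the principal actions commute: for all $(q_0,q_{12})$ in some neighbourhood of the diagonal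 of $M\times M$ and all sufficiently small $t_1,t_2>0$, $$\min_{q_1\in M}\big(S_1(q_0,q_1,t_1)+S_2(q_1,q_{12},t_2)\big)=\min_{q_2\in M}\big(S_2(q_0,q_2,t_2)+S_1(q_2,q_{12},t_1)\big),$$ where again $\min$ is read as an infimum if it is not attained. Then $H_1,H_2\in C^\infty(T^*M)$, the Hamiltonian flows $F_1^{s}$ and $F_2^{t}$ of $H_1$ and $H_2$ on $T^*M$ commute, $F_1^s\circ F_2^t=F_2^t\circ F_1^s$ for all $s,t\in\mathbb R$, and $H_1,H_2$ Poisson commute: $$\{H_1,H_2\}=\sum_{j=1}^n\Big(\frac{\partial H_1}{\partial p_j}\frac{\partial H_2}{\partial q^j}-\frac{\partial H_1}{\partial q^j}\frac{\partial H_2}{\partial p_j}\Big)=0\quad\text{on }T^*M.$$ -/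

import Mathlib

open Set Topology
open scoped Manifold ContDiff

noncomputable section

namespace CommutingActions

/-- The model space `ℝⁿ`. -/
abbrev Coord (n : ℕ) : Type := EuclideanSpace ℝ (Fin n)

/-- The `j`-th standard basis vector of `ℝⁿ`. -/
def basisVec {n : ℕ} (j : Fin n) : Coord n := EuclideanSpace.single j 1

variable {n : ℕ} {M : Type*} [TopologicalSpace M] [ChartedSpace (Coord n) M]

/-- The tangent bundle `TM` of the `n`-dimensional manifold `M`. -/
abbrev Tan (n : ℕ) (M : Type*) [TopologicalSpace M] [ChartedSpace (Coord n) M] : Type _ :=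
  TangentBundle (𝓡 n) M

/-- The cotangent bundle `T*M`: pairs of a point `q` and a linear form `p` on `T_q M`. -/
abbrev Cotan (n : ℕ) (M : Type*) [TopologicalSpace M] [ChartedSpace (Coord n) M] : Type _ :=
  Bundle.TotalSpace (Coord n →L[ℝ] ℝ) (fun q : M => TangentSpace (𝓡 n) q →L[ℝ] ℝ)

/-! ### Lagrange functions, Legendre transformation, Hamilton functions -/

/-- The Legendre transformation `T_q M → T_q* M`, `v ↦ p = ∂L/∂v (q, v)`. -/
def legendre (L : Tan n M → ℝ) (q : M) (v : TangentSpace (𝓡 n) q) :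
    TangentSpace (𝓡 n) q →L[ℝ] ℝ :=
  fderiv ℝ (fun w : TangentSpace (𝓡 n) q => L ⟨q, w⟩) v

/-- The matrix `∂²L / ∂v^j ∂v^k` at `(q, v)`. The space `T_q M` is identified with `ℝⁿ` through
the preferred chart at `q`, so that the standard basis vectors are the coordinate vectors. -/
def hessian (L : Tan n M → ℝ) (q : M) (v : TangentSpace (𝓡 n) q) : Matrix (Fin n) (Fin n) ℝ :=
  Matrix.of fun j k => fderiv ℝ (legendre L q) v (basisVec j) (basisVec k)

/-- `L` is non-degenerate: the velocity Hessian is invertible everywhere. -/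
def Nondegenerate (L : Tan n M → ℝ) : Prop :=
  ∀ (q : M) (v : TangentSpace (𝓡 n) q), (hessian L q v).det ≠ 0

/-- The Hamilton function `H(q, p) = ⟨p, v⟩ - L(q, v)`, where `v` is the solution of
`p = ∂L/∂v (q, v)`. -/
def hamiltonian (L : Tan n M → ℝ) (z : Cotan n M) : ℝ :=
  z.2 (Function.invFun (legendre L z.1) z.2) - L ⟨z.1, Function.invFun (legendre L z.1) z.2⟩

/-! ### Action functional and principal action function -/

/-- `γ` is a `C¹` path on `[0, t]` from `q` to `q'`. -/
structure IsPath (n : ℕ) {M : Type*} [TopologicalSpace M] [ChartedSpace (Coord n) M]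
    (q q' : M) (t : ℝ) (γ : ℝ → M) : Prop where
  contMDiffOn : ContMDiffOn 𝓘(ℝ, ℝ) (𝓡 n) 1 γ (Icc 0 t)
  source : γ 0 = q
  target : γ t = q'

/-- The velocity at time `s` of a path on `[0, t]`. -/
def velocity (n : ℕ) {M : Type*} [TopologicalSpace M] [ChartedSpace (Coord n) M]
    (γ : ℝ → M) (t s : ℝ) : TangentSpace (𝓡 n) (γ s) :=
  mfderivWithin 𝓘(ℝ, ℝ) (𝓡 n) γ (Icc 0 t) s (1 : ℝ)

/-- The action `∫₀ᵗ L(γ(s), γ'(s)) ds`. -/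
def action (L : Tan n M → ℝ) (t : ℝ) (γ : ℝ → M) : ℝ :=
  ∫ s in (0 : ℝ)..t, L ⟨γ s, velocity n γ t s⟩

/-- `γ` minimizes the action among all paths from `q` to `q'` of duration `t`. -/
def IsMinimizer (L : Tan n M → ℝ) (q q' : M) (t : ℝ) (γ : ℝ → M) : Prop :=
  IsPath n q q' t γ ∧ ∀ γ', IsPath n q q' t γ' → action L t γ ≤ action L t γ'

/-- Minimizers of the action exist for all endpoints in a neighbourhood of the diagonal and all
sufficiently small times. -/
def HasMinimizers (L : Tan n M → ℝ) : Prop :=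
  ∃ U ∈ 𝓝ˢ (diagonal M), ∃ ε > (0 : ℝ), ∀ q q' : M, (q, q') ∈ U → ∀ t ∈ Ioo 0 ε,
    ∃ γ, IsMinimizer L q q' t γ

/-- The principal action function `S(q, q', t)`: the least action of a path from `q` to `q'` of
duration `t`. It is `⊤` if `q` and `q'` lie in different components. -/
def principalAction (L : Tan n M → ℝ) (q q' : M) (t : ℝ) : EReal :=
  ⨅ (γ : ℝ → M) (_ : IsPath n q q' t γ), (action L t γ : EReal)

/-- The composed action
`S₁₂(q₀, q₁₂, t₁, t₂) = min over q₁ of S₁(q₀, q₁, t₁) + S₂(q₁, q₁₂, t₂)`. -/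
def composedAction (L₁ L₂ : Tan n M → ℝ) (q₀ q₁₂ : M) (t₁ t₂ : ℝ) : EReal :=
  ⨅ q₁ : M, (principalAction L₁ q₀ q₁ t₁ + principalAction L₂ q₁ q₁₂ t₂)

/-- The principal actions of `L₁` and `L₂` commute, near the diagonal and for small times. -/
def ActionsCommute (L₁ L₂ : Tan n M → ℝ) : Prop :=
  ∃ U ∈ 𝓝ˢ (diagonal M), ∃ ε > (0 : ℝ), ∀ q₀ q₁₂ : M, (q₀, q₁₂) ∈ U →
    ∀ t₁ ∈ Ioo 0 ε, ∀ t₂ ∈ Ioo 0 ε,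
      composedAction L₁ L₂ q₀ q₁₂ t₁ t₂ = composedAction L₂ L₁ q₀ q₁₂ t₂ t₁

/-! ### Canonical coordinates, Poisson bracket, Hamiltonian flow -/

/-- The canonical coordinates `(q^j, p_j)` on `T*M` induced by a chart `φ` of `M`: here
`p_j = p(∂_j)`, where `∂_j` is the vector of `T_q M` that `dφ` maps to the `j`-th basis vector. -/
def coords (φ : OpenPartialHomeomorph M (Coord n)) (z : Cotan n M) : Coord n × Coord n :=
  (φ z.1, WithLp.toLp 2 fun j => z.2 ((mfderiv (𝓡 n) (𝓡 n) φ z.1).inverse (basisVec j)))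

/-- The point of `T*M` with canonical coordinates `(x, p)`, i.e. the covector `∑ p_j dφ^j` at
`φ⁻¹(x)`. -/
def ofCoords (φ : OpenPartialHomeomorph M (Coord n)) (y : Coord n × Coord n) : Cotan n M :=
  ⟨φ.symm y.1, (innerSL ℝ y.2).comp (mfderiv (𝓡 n) (𝓡 n) φ (φ.symm y.1))⟩

/-- A function on `T*M` is smooth: it is so in all canonical coordinates. -/
def IsSmoothFun (f : Cotan n M → ℝ) : Prop :=
  ∀ φ ∈ IsManifold.maximalAtlas (𝓡 n) ∞ M,
    ContDiffOn ℝ ∞ (f ∘ ofCoords φ) (φ.target ×ˢ (univ : Set (Coord n)))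

/-- `∂f/∂q^j` at `z` in the canonical coordinates of the chart `φ`. -/
def dq (φ : OpenPartialHomeomorph M (Coord n)) (f : Cotan n M → ℝ) (j : Fin n)
    (z : Cotan n M) : ℝ :=
  fderiv ℝ (f ∘ ofCoords φ) (coords φ z) (basisVec j, 0)

/-- `∂f/∂p_j` at `z` in the canonical coordinates of the chart `φ`. -/
def dp (φ : OpenPartialHomeomorph M (Coord n)) (f : Cotan n M → ℝ) (j : Fin n)
    (z : Cotan n M) : ℝ :=
  fderiv ℝ (f ∘ ofCoords φ) (coords φ z) (0, basisVec j)

/-- The canonical Poisson bracket at `z`, computed in the canonical coordinates of the chart `φ`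
(whose domain should contain the base point of `z`); its value does not depend on `φ`. -/
def poissonBracket (φ : OpenPartialHomeomorph M (Coord n)) (f g : Cotan n M → ℝ)
    (z : Cotan n M) : ℝ :=
  ∑ j, (dp φ f j z * dq φ g j z - dq φ f j z * dp φ g j z)

/-- `f` and `g` Poisson commute: `{f, g} = 0` everywhere on `T*M`, in all canonical
coordinates. -/
def PoissonCommute (f g : Cotan n M → ℝ) : Prop :=
  ∀ φ ∈ IsManifold.maximalAtlas (𝓡 n) ∞ M, ∀ z : Cotan n M, z.1 ∈ φ.source →
    poissonBracket φ f g z = 0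

/-- `Γ : ℝ → T*M` solves Hamilton's equations `dq^j/dt = ∂H/∂p_j`, `dp_j/dt = -∂H/∂q^j` in all
canonical coordinates. -/
structure IsHamiltonianCurve (H : Cotan n M → ℝ) (Γ : ℝ → Cotan n M) : Prop where
  continuous_base : Continuous fun t => (Γ t).1
  hasDerivAt_q : ∀ φ ∈ IsManifold.maximalAtlas (𝓡 n) ∞ M, ∀ t : ℝ, (Γ t).1 ∈ φ.source →
    ∀ j, HasDerivAt (fun s => (coords φ (Γ s)).1 j) (dp φ H j (Γ t)) t
  hasDerivAt_p : ∀ φ ∈ IsManifold.maximalAtlas (𝓡 n) ∞ M, ∀ t : ℝ, (Γ t).1 ∈ φ.source →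
    ∀ j, HasDerivAt (fun s => (coords φ (Γ s)).2 j) (-dq φ H j (Γ t)) t

/-- `F` is the Hamiltonian flow of `H`: `t ↦ F t z` is the solution of Hamilton's equations that
starts at `z`. -/
def IsHamiltonianFlow (H : Cotan n M → ℝ) (F : ℝ → Cotan n M → Cotan n M) : Prop :=
  ∀ z, F 0 z = z ∧ IsHamiltonianCurve H fun t => F t z

end CommutingActions

end

/-! Convexity comes first. A minimizer satisfies the Legendre condition at its initial velocity:
adding a fast small oscillation in a chart must not lower the action, so the velocity Hessian of L
is positive semidefinite there (`IsMinimizer.exists_hessian_nonneg`). The Hessian is nondegenerate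
and the fibre is connected, so one semidefinite value forces it to be positive definite on the whole
fibre (`pos_of_nondegenerate_family`). Hence L is strictly convex on fibres, the Legendre
transformation is bijective, the inverse function theorem makes H smooth, and Fenchel's inequality
p(v) ≤ H(q, p) + L(q, v) holds, with equality at the velocity belonging to p (`le_hamiltonian_add`).

The action governs the Hamilton–Jacobi evolution: minimizing u(q) + S(q, x, s) over q formally
solves ∂U/∂s + H(x, dU) = 0 with initial value u. Evolving for time ε by H₁ and then by H₂, or in
the other order, gives expansions that first differ at order ε². The difference of the coefficients
is {H₁, H₂} at (x, du), up to sign; the terms with the second derivatives of u cancel by symmetry.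

No exact solution is needed. The Taylor polynomial `hjTaylor` of order two in time solves the
equation with an error O(s²), which changes actions over time ε only by O(ε³). Integrating it along
paths gives a lower bound for every action by Fenchel's inequality (`eventually_hjEnd_le_action`).
Straight segments with the optimal velocity give a matching upper bound: the defect in Fenchel's
inequality has a minimum 0 at the base point and is therefore quadratically small
(`exists_integral_segment_le`). Both bounds are applied to a peaked u with prescribed differential
at x₀, which makes paths that leave the chart irrelevant. Comparing the lower bound in one order
with the upper bound in the other yields an inequality for the bracket
(`fderiv_chartHamiltonian_le`); exchanging L₁ and L₂ yields the reverse one.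

A vanishing bracket makes the Hamiltonian vector fields commute in canonical coordinates. A Grönwall
estimate then shows that the local flow of one field carries integral curves of the other to
integral curves (`hasDerivAt_flow_of_comm`). Uniqueness of solutions, compactness of a time interval
and connectedness of ℝ extend this to all times (`IsHamiltonianFlow.comm`). -/

namespace CommutingActions

/-! ### Convexity and the Legendre transformation on a vector space -/

section Convexity

variable {E : Type*} [NormedAddCommGroup E] [NormedSpace ℝ E]

/-- A positive semidefinite symmetric form without kernel is positive definite. -/
theorem pos_of_nonneg_of_ker {B : E →L[ℝ] E →L[ℝ] ℝ} (hsymm : ∀ a b, B a b = B b a)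
    (hnd : ∀ a, B a = 0 → a = 0) (h0 : ∀ a, 0 ≤ B a a) {a : E} (ha : a ≠ 0) : 0 < B a a := by
  refine lt_of_le_of_ne (h0 a) fun h => ha (hnd a ?_)
  ext b
  by_contra hb
  have hb' : B a b ≠ 0 := hb
  -- If B(a, a) = 0, the form at ta + b is affine in t with slope 2B(a, b); this t gives it the
  -- value -1.
  have h1 := h0 ((-(B b b + 1) / (2 * B a b)) • a + b)
  simp only [map_add, map_smul, add_apply, smul_apply,
    smul_eq_mul, ← h, hsymm b a] at h1
  have h2 : -(B b b + 1) / (2 * B a b) * B a b = -(B b b + 1) / 2 := by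
    field_simp
  rw [h2] at h1
  linarith

/-- In a continuous family of nondegenerate symmetric forms, one positive semidefinite member
forces all members to be positive definite. -/
theorem pos_of_nondegenerate_family [FiniteDimensional ℝ E] {B : E → E →L[ℝ] E →L[ℝ] ℝ}
    (hB : Continuous B) (hsymm : ∀ v a b, B v a b = B v b a) (hnd : ∀ v a, B v a = 0 → a = 0)
    {v₀ : E} (h0 : ∀ a, 0 ≤ B v₀ a a) (v : E) {a : E} (ha : a ≠ 0) : 0 < B v a a := by
  have key : ∀ v, (∀ a, 0 ≤ B v a a) → ∀ a, a ≠ 0 → 0 < B v a a := fun v h a ha =>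
    pos_of_nonneg_of_ker (hsymm v) (hnd v) h ha
  -- The fibre is connected, so it is enough that the set of semidefinite points is clopen. It is
  -- open because semidefinite points are definite, and definiteness on the compact unit sphere is
  -- stable.
  have hclopen : IsClopen {v | ∀ a, 0 ≤ B v a a} := by
    constructor
    · rw [ofPred_forall]
      exact isClosed_iInter fun a => isClosed_le continuous_const (by fun_prop)
    · rw [isOpen_iff_mem_nhds]
      intro w hw
      have h1 : ∀ᶠ x in 𝓝 w, ∀ y ∈ Metric.sphere (0 : E) 1, 0 < B x y y := by
        refine (isCompact_sphere (0 : E) 1).eventually_forall_of_forall_eventually ?_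
        intro y hy
        have hc : ContinuousAt (fun z : E × E => B z.1 z.2 z.2) (w, y) := by fun_prop
        refine hc.eventually (lt_mem_nhds (key w hw y ?_))
        rintro rfl
        simp at hy
      filter_upwards [h1] with x hx b
      rcases eq_or_ne b 0 with rfl | hb
      · simp
      · have hb' : 0 < ‖b‖ := norm_pos_iff.2 hb
        have h2 := hx (‖b‖⁻¹ • b) (by simp [norm_smul, hb'.ne'])
        simp only [map_smul, smul_apply, smul_eq_mul] at h2
        have h3 : 0 < ‖b‖⁻¹ := inv_pos.2 hb'
        exact (pos_of_mul_pos_right (pos_of_mul_pos_right h2 h3.le) h3.le).le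
  have : v ∈ {v | ∀ a, 0 ≤ B v a a} := by
    rw [hclopen.eq_univ ⟨v₀, h0⟩]
    trivial
  exact key v this a ha

/-- A function with positive definite Hessian lies strictly above its tangent planes. -/
theorem tangent_lt_of_hessian_pos {f : E → ℝ} (hf : ContDiff ℝ 2 f)
    (hpos : ∀ v a, a ≠ 0 → 0 < fderiv ℝ (fderiv ℝ f) v a a) {v w : E} (hvw : v ≠ w) :
    f v + fderiv ℝ f v (w - v) < f w := by
  have hline : ∀ t : ℝ, HasDerivAt (fun t : ℝ => v + t • (w - v)) (w - v) t := fun t => by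
    simpa using ((hasDerivAt_id t).smul_const (w - v)).const_add v
  have hd1 : Differentiable ℝ f := hf.differentiable (by norm_num)
  have hd2 : Differentiable ℝ (fderiv ℝ f) :=
    (hf.fderiv_right (m := 1) (by norm_num)).differentiable (by norm_num)
  have hg : ∀ t : ℝ, HasDerivAt (fun t : ℝ => f (v + t • (w - v)))
      (fderiv ℝ f (v + t • (w - v)) (w - v)) t := fun t =>
    (hd1 _).hasFDerivAt.comp_hasDerivAt t (hline t)
  have hk : ∀ t : ℝ, HasDerivAt (fun t : ℝ => fderiv ℝ f (v + t • (w - v)) (w - v))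
      (fderiv ℝ (fderiv ℝ f) (v + t • (w - v)) (w - v) (w - v)) t := fun t => by
    simpa using ((hd2 _).hasFDerivAt.comp_hasDerivAt t (hline t)).clm_apply
      (hasDerivAt_const t (w - v))
  -- The mean value theorem, for f on the segment from v to w and then for its derivative.
  obtain ⟨c, hc, hc'⟩ := exists_hasDerivAt_eq_slope _ _ (zero_lt_one' ℝ)
    (fun t _ => (hg t).continuousAt.continuousWithinAt) fun t _ => hg t
  obtain ⟨d, hd, hd'⟩ := exists_hasDerivAt_eq_slope _ _ hc.1
    (fun t _ => (hk t).continuousAt.continuousWithinAt) fun t _ => hk t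
  have h3 := hpos (v + d • (w - v)) (w - v) (sub_ne_zero.2 hvw.symm)
  rw [hd', div_pos_iff_of_pos_right (by linarith [hc.1])] at h3
  simp only [zero_smul, add_zero, one_smul, add_sub_cancel, sub_zero, div_one] at h3 hc'
  linarith

/-- Equal differentials at two distinct points would make the two strict tangent plane inequalities
contradict each other. -/
theorem fderiv_injective_of_hessian_pos {f : E → ℝ} (hf : ContDiff ℝ 2 f)
    (hpos : ∀ v a, a ≠ 0 → 0 < fderiv ℝ (fderiv ℝ f) v a a) :
    Function.Injective (fderiv ℝ f) := by
  intro v w h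
  by_contra hvw
  have h1 := tangent_lt_of_hessian_pos hf hpos hvw
  have h2 := tangent_lt_of_hessian_pos hf hpos (Ne.symm hvw)
  rw [h, ← neg_sub v w, map_neg] at h1
  linarith

end Convexity

/-! ### Smoothness of the inverse Legendre transformation. -/

section LegendreInverse

variable {E : Type*} [NormedAddCommGroup E] [NormedSpace ℝ E]

/-- The derivative of a function of two variables in the second variable. -/
noncomputable def fderivSnd {X : Type*} [NormedAddCommGroup X] [NormedSpace ℝ X]
    (f : X × E → ℝ) (z : X × E) : E →L[ℝ] ℝ :=
  (fderiv ℝ f z).comp (ContinuousLinearMap.inr ℝ X E)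

theorem fderivSnd_eq {X : Type*} [NormedAddCommGroup X] [NormedSpace ℝ X] {f : X × E → ℝ} {x : X}
    {v : E} (hf : DifferentiableAt ℝ f (x, v)) :
    fderivSnd f (x, v) = fderiv ℝ (fun w => f (x, w)) v :=
  (hf.hasFDerivAt.comp v (hasFDerivAt_prodMk_right x v)).fderiv.symm

theorem contDiffOn_fderivSnd {X : Type*} [NormedAddCommGroup X] [NormedSpace ℝ X]
    {f : X × E → ℝ} {s : Set (X × E)} (hs : IsOpen s) (hf : ContDiffOn ℝ ∞ f s) :
    ContDiffOn ℝ ∞ (fderivSnd f) s :=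
  (hf.fderiv_of_isOpen hs (m := ∞) (by norm_num)).clm_comp contDiffOn_const

/-- The fibrewise inverse of a fibrewise bijective nondegenerate Legendre transformation is
smooth. -/
theorem contDiffOn_of_fderivSnd_eq [FiniteDimensional ℝ E] {Ω : Set E} (hΩ : IsOpen Ω) {l : E × E → ℝ}
    (hl : ContDiffOn ℝ ∞ l (Ω ×ˢ univ))
    (hinj : ∀ x ∈ Ω, Function.Injective fun v => fderivSnd l (x, v))
    (hnd : ∀ x ∈ Ω, ∀ v a, fderiv ℝ (fun v => fderivSnd l (x, v)) v a = 0 → a = 0)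
    {V : E × (E →L[ℝ] ℝ) → E} (hV : ∀ x ∈ Ω, ∀ α, fderivSnd l (x, V (x, α)) = α) :
    ContDiffOn ℝ ∞ V (Ω ×ˢ univ) := by
  have hopen : IsOpen (Ω ×ˢ (univ : Set E)) := hΩ.prod isOpen_univ
  rintro ⟨x, α⟩ ⟨hx, -⟩
  refine ContDiffAt.contDiffWithinAt ?_
  set v := V (x, α) with hv
  have hxv : (x, v) ∈ Ω ×ˢ (univ : Set E) := ⟨hx, trivial⟩
  -- The base point is kept as a coordinate, so the ordinary inverse function theorem gives joint
  -- smoothness. The derivative of Φ is block triangular and is injective because its fibre block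
  -- is.
  let Φ : E × E → E × (E →L[ℝ] ℝ) := fun z => (z.1, fderivSnd l z)
  have hG : ContDiffAt ℝ ∞ (fderivSnd l) (x, v) :=
    (contDiffOn_fderivSnd hopen hl).contDiffAt (hopen.mem_nhds hxv)
  have hΦ : ContDiffAt ℝ ∞ Φ (x, v) := contDiffAt_fst.prodMk hG
  have hG' : HasFDerivAt (fderivSnd l) (fderiv ℝ (fderivSnd l) (x, v)) (x, v) :=
    (hG.differentiableAt (by norm_num)).hasFDerivAt
  set A : E × E →L[ℝ] E × (E →L[ℝ] ℝ) :=
    (ContinuousLinearMap.fst ℝ E E).prod (fderiv ℝ (fderivSnd l) (x, v)) with hA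
  have hΦ' : HasFDerivAt Φ A (x, v) := hasFDerivAt_fst.prodMk hG'
  have hAinj : Function.Injective A := by
    rw [injective_iff_map_eq_zero]
    rintro ⟨a, b⟩ hab
    have h1 : a = 0 := congrArg Prod.fst hab
    have h2 : fderiv ℝ (fderivSnd l) (x, v) (a, b) = 0 := congrArg Prod.snd hab
    subst h1
    have h3 : fderiv ℝ (fun w => fderivSnd l (x, w)) v
        = (fderiv ℝ (fderivSnd l) (x, v)).comp (ContinuousLinearMap.inr ℝ E E) :=
      (hG'.comp v (hasFDerivAt_prodMk_right x v)).fderiv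
    have h4 := hnd x hx v b (by rw [h3]; simpa using h2)
    rw [h4]
    rfl
  have hfr : Module.finrank ℝ (E × E) = Module.finrank ℝ (E × (E →L[ℝ] ℝ)) := by
    have : Module.finrank ℝ (E →L[ℝ] ℝ) = Module.finrank ℝ E := by
      rw [← (LinearMap.toContinuousLinearMap (𝕜 := ℝ) (E := E) (F' := ℝ)).finrank_eq]
      exact Subspace.dual_finrank_eq
    simp [Module.finrank_prod, this]
  let A' : (E × E) ≃L[ℝ] E × (E →L[ℝ] ℝ) :=
    (LinearEquiv.ofInjectiveOfFinrankEq A.toLinearMap hAinj hfr).toContinuousLinearEquiv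
  have hA' : HasFDerivAt Φ (A' : E × E →L[ℝ] E × (E →L[ℝ] ℝ)) (x, v) := by
    have : (A' : E × E →L[ℝ] E × (E →L[ℝ] ℝ)) = A := by ext <;> rfl
    rwa [this]
  have hΦx : Φ (x, v) = (x, α) := by simp only [Φ, hv, hV x hx]
  let ψ := hΦ.localInverse hA' (by norm_num)
  have hψ : ContDiffAt ℝ ∞ ψ (x, α) := by
    have := hΦ.to_localInverse hA' (by norm_num)
    rwa [hΦx] at this
  have hright : ∀ᶠ y in 𝓝 (x, α), Φ (ψ y) = y := by
    have := (hΦ.hasStrictFDerivAt' hA' (by norm_num)).eventually_right_inverse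
    rwa [hΦx] at this
  -- No continuity of V is known, since it may come from a choice. Global injectivity on fibres
  -- identifies it with the local inverse.
  have hev : V =ᶠ[𝓝 (x, α)] fun y => (ψ y).2 := by
    have hx' : ∀ᶠ y : E × (E →L[ℝ] ℝ) in 𝓝 (x, α), y.1 ∈ Ω :=
      continuousAt_fst.eventually (hΩ.mem_nhds hx)
    filter_upwards [hright, hx'] with y hy hyΩ
    have h1 : (ψ y).1 = y.1 := congrArg Prod.fst hy
    have h2 : fderivSnd l (ψ y) = y.2 := congrArg Prod.snd hy
    apply hinj y.1 hyΩ
    change fderivSnd l (y.1, V (y.1, y.2)) = fderivSnd l (y.1, (ψ y).2)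
    rw [hV y.1 hyΩ, ← h1, ← h2]
  exact (contDiffAt_snd.comp _ hψ).congr_of_eventuallyEq hev

end LegendreInverse

end CommutingActions

namespace CommutingActions

/-! ### Second order estimates -/

section Estimates

/-- A function that vanishes to second order in its first argument is quadratically small in it,
uniformly on compact sets of parameters. -/
theorem exists_abs_le_mul_sq {X : Type*} [NormedAddCommGroup X] [NormedSpace ℝ X]
    {R : ℝ × X → ℝ} {S K : Set X} (hS : IsOpen S) (hK : IsCompact K) (hKS : K ⊆ S)
    (hR : ContDiffOn ℝ ∞ R (univ ×ˢ S)) (h0 : ∀ y ∈ S, R (0, y) = 0)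
    (h1 : ∀ y ∈ S, fderiv ℝ R (0, y) (1, 0) = 0) :
    ∃ C, 0 ≤ C ∧ ∀ s ∈ Icc (0 : ℝ) 1, ∀ y ∈ K, |R (s, y)| ≤ C * s ^ 2 := by
  have hopen : IsOpen ((univ : Set ℝ) ×ˢ S) := isOpen_univ.prod hS
  set D : ℝ × X → ℝ := fun z => fderiv ℝ R z (1, 0) with hD
  have hDs : ContDiffOn ℝ ∞ D (univ ×ˢ S) :=
    (hR.fderiv_of_isOpen hopen (m := ∞) (by norm_num)).clm_apply contDiffOn_const
  set D2 : ℝ × X → ℝ := fun z => fderiv ℝ D z (1, 0) with hD2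
  have hD2s : ContDiffOn ℝ ∞ D2 (univ ×ˢ S) :=
    (hDs.fderiv_of_isOpen hopen (m := ∞) (by norm_num)).clm_apply contDiffOn_const
  have hderiv : ∀ {f : ℝ × X → ℝ}, ContDiffOn ℝ ∞ f (univ ×ˢ S) → ∀ y ∈ S, ∀ s : ℝ,
      HasDerivAt (fun s => f (s, y)) (fderiv ℝ f (s, y) (1, 0)) s := by
    intro f hf y hy s
    have h := ((hf.contDiffAt (hopen.mem_nhds (x := (s, y)) ⟨trivial, hy⟩)).differentiableAt
      (by norm_num)).hasFDerivAt
    exact h.comp_hasDerivAt s ((hasDerivAt_id s).prodMk (hasDerivAt_const s y))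
  obtain ⟨C, hC⟩ := ((isCompact_Icc (a := (0 : ℝ)) (b := 1)).prod hK).exists_bound_of_continuousOn
    (hD2s.continuousOn.mono (prod_mono (subset_univ _) hKS))
  refine ⟨max C 0, le_max_right _ _, fun s hs y hy => ?_⟩
  have hC' : ∀ s ∈ Icc (0 : ℝ) 1, ‖D2 (s, y)‖ ≤ max C 0 := fun s hs =>
    (hC (s, y) ⟨hs, hy⟩).trans (le_max_left _ _)
  -- The mean value inequality is used twice: a bounded second derivative gives a linear bound on
  -- the first, and that gives a quadratic bound on R.
  have hDle : ∀ s ∈ Icc (0 : ℝ) 1, ‖D (s, y)‖ ≤ max C 0 * s := by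
    intro s hs
    have := norm_image_sub_le_of_norm_deriv_le_segment' (a := 0) (b := 1)
      (fun s _ => (hderiv hDs y (hKS hy) s).hasDerivWithinAt)
      (fun s hs => hC' s (Ico_subset_Icc_self hs)) s hs
    simpa [hD, h1 y (hKS hy)] using this
  have := norm_image_sub_le_of_norm_deriv_le_segment' (a := 0) (b := s) (C := max C 0 * s)
      (fun s _ => (hderiv hR y (hKS hy) s).hasDerivWithinAt)
      (fun r hr => (hDle r ⟨hr.1, hr.2.le.trans hs.2⟩).trans
        (mul_le_mul_of_nonneg_left hr.2.le (le_max_right _ _))) s ⟨hs.1, le_rfl⟩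
  simpa [h0 y (hKS hy), sq, mul_assoc] using this

/-- A smooth function is bounded by a multiple of the squared distance to a zero at which it has a
local minimum. -/
theorem exists_le_mul_sq_of_isLocalMin {Z : Type*} [NormedAddCommGroup Z] [NormedSpace ℝ Z]
    {g : Z → ℝ} {z₀ : Z} (hg : ContDiffAt ℝ 2 g z₀) (h0 : g z₀ = 0) (hmin : IsLocalMin g z₀) :
    ∃ C, 0 ≤ C ∧ ∀ᶠ z in 𝓝 z₀, g z ≤ C * ‖z - z₀‖ ^ 2 := by
  -- The differential vanishes at z₀ and is differentiable there, hence O(‖z - z₀‖); the mean value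
  -- inequality on the ball of radius ‖z - z₀‖ supplies the second factor.
  have hd : fderiv ℝ g z₀ = 0 := hmin.fderiv_eq_zero
  have hg1 : ContDiffAt ℝ 1 (fderiv ℝ g) z₀ := hg.fderiv_right (by norm_num)
  have hO := (hg1.differentiableAt (by norm_num)).isBigO_sub
  obtain ⟨C, hC0, hC⟩ := hO.exists_nonneg
  have hdiff : ∀ᶠ z in 𝓝 z₀, DifferentiableAt ℝ g z :=
    (hg.eventually (by simp)).mono fun z hz => hz.differentiableAt (by norm_num)
  obtain ⟨δ, hδ, hball⟩ := Metric.eventually_nhds_iff_ball.1 (hC.bound.and hdiff)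
  refine ⟨C, hC0, Metric.eventually_nhds_iff_ball.2 ⟨δ, hδ, fun z hz => ?_⟩⟩
  have hsub : Metric.closedBall z₀ ‖z - z₀‖ ⊆ Metric.ball z₀ δ :=
    Metric.closedBall_subset_ball (by simpa [dist_eq_norm] using hz)
  have := (convex_closedBall z₀ ‖z - z₀‖).norm_image_sub_le_of_norm_fderiv_le (𝕜 := ℝ)
    (f := g) (C := C * ‖z - z₀‖) (x := z₀) (y := z) (fun w hw => (hball w (hsub hw)).2)
    (fun w hw => by
      have h1 := (hball w (hsub hw)).1
      rw [hd, sub_zero] at h1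
      exact h1.trans (mul_le_mul_of_nonneg_left (by simpa [dist_eq_norm] using hw) hC0))
    (by simp) (by simp [dist_eq_norm])
  rw [h0, sub_zero] at this
  calc g z ≤ ‖g z‖ := le_abs_self _
    _ ≤ _ := by rw [sq, ← mul_assoc]; exact this

end Estimates

/-! ### Approximate solutions of the Hamilton–Jacobi equation -/

section HamiltonJacobi

variable {E : Type*} [NormedAddCommGroup E] [NormedSpace ℝ E]

/-- The Hamilton function along the differential of a family `G(ε, x)`. -/
noncomputable def hjFirst (h : E × (E →L[ℝ] ℝ) → ℝ) (G : ℝ × E → ℝ) (z : ℝ × E) : ℝ :=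
  h (z.2, fderivSnd G z)

/-- The second time derivative at time `0` of the solution of the Hamilton–Jacobi equation with
initial values `G(ε, ·)`. -/
noncomputable def hjSecond (h : E × (E →L[ℝ] ℝ) → ℝ) (G : ℝ × E → ℝ) (z : ℝ × E) : ℝ :=
  fderiv ℝ h (z.2, fderivSnd G z) (0, fderivSnd (hjFirst h G) z)

/-- The second order Taylor polynomial in time `s` of the solution of the Hamilton–Jacobi equation
with initial values `G(ε, ·)`. -/
noncomputable def hjTaylor (h : E × (E →L[ℝ] ℝ) → ℝ) (G : ℝ × E → ℝ) (w : ℝ × ℝ × E) : ℝ :=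
  G w.2 - w.1 * hjFirst h G w.2 + w.1 ^ 2 / 2 * hjSecond h G w.2

/-- The differential in `x` of `hjTaylor`. -/
noncomputable def hjTaylorDeriv (h : E × (E →L[ℝ] ℝ) → ℝ) (G : ℝ × E → ℝ) (w : ℝ × ℝ × E) :
    E →L[ℝ] ℝ :=
  fderivSnd G w.2 - w.1 • fderivSnd (hjFirst h G) w.2 + (w.1 ^ 2 / 2) • fderivSnd (hjSecond h G) w.2

/-- The error of `hjTaylor` in the Hamilton–Jacobi equation. -/
noncomputable def hjResidual (h : E × (E →L[ℝ] ℝ) → ℝ) (G : ℝ × E → ℝ) (w : ℝ × ℝ × E) : ℝ :=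
  -hjFirst h G w.2 + w.1 * hjSecond h G w.2 + h (w.2.2, hjTaylorDeriv h G w)

/-- The values at time `ε` of `hjTaylor`. -/
noncomputable def hjEnd (h : E × (E →L[ℝ] ℝ) → ℝ) (G : ℝ × E → ℝ) (z : ℝ × E) : ℝ :=
  hjTaylor h G (z.1, z)

variable {Ω : Set E} {h : E × (E →L[ℝ] ℝ) → ℝ} {G : ℝ × E → ℝ}

theorem contDiffOn_hjFirst (hΩ : IsOpen Ω) (hh : ContDiffOn ℝ ∞ h (Ω ×ˢ univ))
    (hG : ContDiffOn ℝ ∞ G (univ ×ˢ Ω)) : ContDiffOn ℝ ∞ (hjFirst h G) (univ ×ˢ Ω) :=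
  hh.comp (contDiffOn_snd.prodMk (contDiffOn_fderivSnd (isOpen_univ.prod hΩ) hG))
    fun _ hz => ⟨hz.2, trivial⟩

theorem contDiffOn_hjSecond (hΩ : IsOpen Ω) (hh : ContDiffOn ℝ ∞ h (Ω ×ˢ univ))
    (hG : ContDiffOn ℝ ∞ G (univ ×ˢ Ω)) : ContDiffOn ℝ ∞ (hjSecond h G) (univ ×ˢ Ω) := by
  have hU : IsOpen ((univ : Set ℝ) ×ˢ Ω) := isOpen_univ.prod hΩ
  have h1 : ContDiffOn ℝ ∞ (fderiv ℝ h) (Ω ×ˢ univ) :=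
    hh.fderiv_of_isOpen (hΩ.prod isOpen_univ) (m := ∞) (by norm_num)
  refine (h1.comp (contDiffOn_snd.prodMk (contDiffOn_fderivSnd hU hG))
    fun _ hz => ⟨hz.2, trivial⟩).clm_apply ?_
  exact contDiffOn_const.prodMk (contDiffOn_fderivSnd hU (contDiffOn_hjFirst hΩ hh hG))

theorem contDiffOn_hjTaylorDeriv (hΩ : IsOpen Ω) (hh : ContDiffOn ℝ ∞ h (Ω ×ˢ univ))
    (hG : ContDiffOn ℝ ∞ G (univ ×ˢ Ω)) :
    ContDiffOn ℝ ∞ (hjTaylorDeriv h G) (univ ×ˢ univ ×ˢ Ω) := by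
  have hU : IsOpen ((univ : Set ℝ) ×ˢ Ω) := isOpen_univ.prod hΩ
  have hm : MapsTo (Prod.snd : ℝ × ℝ × E → ℝ × E) (univ ×ˢ univ ×ˢ Ω) (univ ×ˢ Ω) :=
    fun _ hz => hz.2
  have h0 := (contDiffOn_fderivSnd hU hG).comp contDiffOn_snd hm
  have h1 := (contDiffOn_fderivSnd hU (contDiffOn_hjFirst hΩ hh hG)).comp contDiffOn_snd hm
  have h2 := (contDiffOn_fderivSnd hU (contDiffOn_hjSecond hΩ hh hG)).comp contDiffOn_snd hm
  have hs : ContDiffOn ℝ ∞ (fun w : ℝ × ℝ × E => w.1) (univ ×ˢ univ ×ˢ Ω) := contDiffOn_fst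
  exact (h0.sub (hs.smul h1)).add (((hs.pow 2).div_const 2).smul h2)

theorem contDiffOn_hjResidual (hΩ : IsOpen Ω) (hh : ContDiffOn ℝ ∞ h (Ω ×ˢ univ))
    (hG : ContDiffOn ℝ ∞ G (univ ×ˢ Ω)) :
    ContDiffOn ℝ ∞ (hjResidual h G) (univ ×ˢ univ ×ˢ Ω) := by
  have hm : MapsTo (Prod.snd : ℝ × ℝ × E → ℝ × E) (univ ×ˢ univ ×ˢ Ω) (univ ×ˢ Ω) :=
    fun _ hz => hz.2
  have h1 := (contDiffOn_hjFirst hΩ hh hG).comp contDiffOn_snd hm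
  have h2 := (contDiffOn_hjSecond hΩ hh hG).comp contDiffOn_snd hm
  have hs : ContDiffOn ℝ ∞ (fun w : ℝ × ℝ × E => w.1) (univ ×ˢ univ ×ˢ Ω) := contDiffOn_fst
  have hx : ContDiffOn ℝ ∞ (fun w : ℝ × ℝ × E => w.2.2) (univ ×ˢ univ ×ˢ Ω) :=
    contDiff_snd.snd.contDiffOn
  exact (h1.neg.add (hs.mul h2)).add
    (hh.comp (hx.prodMk (contDiffOn_hjTaylorDeriv hΩ hh hG)) fun _ hz => ⟨hz.2.2, trivial⟩)

theorem contDiffOn_hjEnd (hΩ : IsOpen Ω) (hh : ContDiffOn ℝ ∞ h (Ω ×ˢ univ))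
    (hG : ContDiffOn ℝ ∞ G (univ ×ˢ Ω)) : ContDiffOn ℝ ∞ (hjEnd h G) (univ ×ˢ Ω) := by
  have hs : ContDiffOn ℝ ∞ (fun w : ℝ × E => w.1) (univ ×ˢ Ω) := contDiffOn_fst
  exact (hG.sub (hs.mul (contDiffOn_hjFirst hΩ hh hG))).add
    (((hs.pow 2).div_const 2).mul (contDiffOn_hjSecond hΩ hh hG))

theorem hasFDerivAt_snd_of_contDiffOn {f : ℝ × E → ℝ} (hΩ : IsOpen Ω)
    (hf : ContDiffOn ℝ ∞ f (univ ×ˢ Ω)) {ε : ℝ} {x : E} (hx : x ∈ Ω) :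
    HasFDerivAt (fun x => f (ε, x)) (fderivSnd f (ε, x)) x := by
  have h := ((hf.contDiffAt ((isOpen_univ.prod hΩ).mem_nhds (x := (ε, x))
    ⟨trivial, hx⟩)).differentiableAt (by norm_num)).hasFDerivAt
  exact h.comp x (hasFDerivAt_prodMk_right ε x)

theorem hasFDerivAt_hjTaylor (hΩ : IsOpen Ω) (hh : ContDiffOn ℝ ∞ h (Ω ×ˢ univ))
    (hG : ContDiffOn ℝ ∞ G (univ ×ˢ Ω)) (s ε : ℝ) {x : E} (hx : x ∈ Ω) :
    HasFDerivAt (fun x => hjTaylor h G (s, ε, x)) (hjTaylorDeriv h G (s, ε, x)) x :=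
  ((hasFDerivAt_snd_of_contDiffOn hΩ hG hx).sub
    ((hasFDerivAt_snd_of_contDiffOn hΩ (contDiffOn_hjFirst hΩ hh hG) hx).const_mul s)).add
    ((hasFDerivAt_snd_of_contDiffOn hΩ (contDiffOn_hjSecond hΩ hh hG) hx).const_mul (s ^ 2 / 2))

theorem fderivSnd_hjEnd (hΩ : IsOpen Ω) (hh : ContDiffOn ℝ ∞ h (Ω ×ˢ univ))
    (hG : ContDiffOn ℝ ∞ G (univ ×ˢ Ω)) (ε : ℝ) {x : E} (hx : x ∈ Ω) :
    fderivSnd (hjEnd h G) (ε, x) = hjTaylorDeriv h G (ε, ε, x) :=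
  (hasFDerivAt_snd_of_contDiffOn hΩ (contDiffOn_hjEnd hΩ hh hG) hx).unique
    (hasFDerivAt_hjTaylor hΩ hh hG ε ε hx)

/-- The derivative of `hjTaylor` along a curve. -/
theorem hasDerivAt_hjTaylor_curve (hΩ : IsOpen Ω) (hh : ContDiffOn ℝ ∞ h (Ω ×ˢ univ))
    (hG : ContDiffOn ℝ ∞ G (univ ×ˢ Ω)) (ε : ℝ) {y : ℝ → E} {y' : E} {s : ℝ}
    (hy : HasDerivAt y y' s) (hx : y s ∈ Ω) :
    HasDerivAt (fun s => hjTaylor h G (s, ε, y s))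
      (hjResidual h G (s, ε, y s) + (hjTaylorDeriv h G (s, ε, y s) y' -
        h (y s, hjTaylorDeriv h G (s, ε, y s)))) s := by
  have h0 := (hasFDerivAt_snd_of_contDiffOn hΩ hG (ε := ε) hx).comp_hasDerivAt s hy
  have h1 := (hasFDerivAt_snd_of_contDiffOn hΩ (contDiffOn_hjFirst hΩ hh hG)
    (ε := ε) hx).comp_hasDerivAt s hy
  have h2 := (hasFDerivAt_snd_of_contDiffOn hΩ (contDiffOn_hjSecond hΩ hh hG)
    (ε := ε) hx).comp_hasDerivAt s hy
  have h3 := (h0.sub ((hasDerivAt_id s).mul h1)).add ((((hasDerivAt_id s).pow 2).div_const 2).mul h2)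
  refine h3.congr_deriv ?_
  simp only [hjResidual, hjTaylorDeriv, add_apply, sub_apply, smul_apply, smul_eq_mul,
    Function.comp, id, Pi.pow_apply]
  ring

/-- At s = 0 the residual vanishes by the choice of `hjFirst`, and its s-derivative vanishes by the
choice of `hjSecond`. Uniformity in ε is needed because the second of two successive evolutions has
ε-dependent initial values. -/
theorem exists_hjResidual_le (hΩ : IsOpen Ω) (hh : ContDiffOn ℝ ∞ h (Ω ×ˢ univ))
    (hG : ContDiffOn ℝ ∞ G (univ ×ˢ Ω)) {B : Set E} (hB : IsCompact B) (hBΩ : B ⊆ Ω) :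
    ∃ C, 0 ≤ C ∧ ∀ s ∈ Icc (0 : ℝ) 1, ∀ ε ∈ Icc (0 : ℝ) 1, ∀ x ∈ B,
      |hjResidual h G (s, ε, x)| ≤ C * s ^ 2 := by
  have hU : IsOpen ((univ : Set ℝ) ×ˢ Ω) := isOpen_univ.prod hΩ
  have hUU : IsOpen ((univ : Set ℝ) ×ˢ (univ : Set ℝ) ×ˢ Ω) := isOpen_univ.prod hU
  obtain ⟨C, hC0, hC⟩ := exists_abs_le_mul_sq hU ((isCompact_Icc (a := (0 : ℝ)) (b := 1)).prod hB)
    (prod_mono (subset_univ _) hBΩ) (contDiffOn_hjResidual hΩ hh hG)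
    (by rintro ⟨ε, x⟩ -; simp [hjResidual, hjTaylorDeriv, hjFirst])
    (by
      rintro ⟨ε, x⟩ ⟨-, hx⟩
      have hR := ((contDiffOn_hjResidual hΩ hh hG).contDiffAt
        (hUU.mem_nhds (x := (0, ε, x)) ⟨trivial, trivial, hx⟩)).differentiableAt (by norm_num)
      have h1 := hR.hasFDerivAt.comp_hasDerivAt (0 : ℝ)
        ((hasDerivAt_id (0 : ℝ)).prodMk (hasDerivAt_const (0 : ℝ) (ε, x)))
      have hP : HasDerivAt (fun s : ℝ => hjTaylorDeriv h G (s, ε, x))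
          (-fderivSnd (hjFirst h G) (ε, x)) 0 := by
        have := (((hasDerivAt_id (0 : ℝ)).smul_const (fderivSnd (hjFirst h G) (ε, x))).const_sub
          (fderivSnd G (ε, x))).add ((((hasDerivAt_id (0 : ℝ)).pow 2).div_const 2).smul_const
            (fderivSnd (hjSecond h G) (ε, x)))
        refine this.congr_deriv ?_
        simp
      have hP0 : hjTaylorDeriv h G (0, ε, x) = fderivSnd G (ε, x) := by simp [hjTaylorDeriv]
      have hhd : HasFDerivAt h (fderiv ℝ h (x, fderivSnd G (ε, x)))
          (x, hjTaylorDeriv h G (0, ε, x)) := by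
        rw [hP0]
        exact ((hh.contDiffAt ((hΩ.prod isOpen_univ).mem_nhds ⟨hx, trivial⟩)).differentiableAt
          (by norm_num)).hasFDerivAt
      have h2 := (((hasDerivAt_id (0 : ℝ)).mul_const (hjSecond h G (ε, x))).const_add
        (-hjFirst h G (ε, x))).add (hhd.comp_hasDerivAt (0 : ℝ) ((hasDerivAt_const (0 : ℝ) x).prodMk hP))
      have h3 := h1.unique h2
      rw [show ((0 : E), -fderivSnd (hjFirst h G) (ε, x))
        = -(0, fderivSnd (hjFirst h G) (ε, x)) by simp, map_neg] at h3
      simpa [hjSecond] using h3)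
  exact ⟨C, hC0, fun s hs ε hε x hx => hC s hs (ε, x) ⟨hε, hx⟩⟩

/-- Approximate solutions of the Hamilton–Jacobi equation bound the action from below. -/
theorem hjTaylor_sub_le_integral (hΩ : IsOpen Ω) (hh : ContDiffOn ℝ ∞ h (Ω ×ˢ univ))
    (hG : ContDiffOn ℝ ∞ G (univ ×ˢ Ω)) {C ε a t : ℝ} {y y' : ℝ → E} {φ : ℝ → ℝ} (hat : a ≤ t)
    (hC : ∀ s ∈ Ioo a t, |hjResidual h G (s, ε, y s)| ≤ C)
    (hy : ContinuousOn y (Icc a t)) (hy' : ∀ s ∈ Ioo a t, HasDerivAt y (y' s) s)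
    (hyΩ : ∀ s ∈ Icc a t, y s ∈ Ω) (hφ : ContinuousOn φ (Icc a t))
    (hfen : ∀ s ∈ Ioo a t, ∀ α : E →L[ℝ] ℝ, α (y' s) ≤ h (y s, α) + φ s) :
    hjTaylor h G (t, ε, y t) - hjTaylor h G (a, ε, y a) ≤ (∫ s in a..t, φ s) + C * (t - a) := by
  have hcont : ContinuousOn (fun s => hjTaylor h G (s, ε, y s)) (Icc a t) := by
    have hm : MapsTo (fun s => (ε, y s)) (Icc a t) (univ ×ˢ Ω) := fun s hs => ⟨trivial, hyΩ s hs⟩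
    have hy2 : ContinuousOn (fun s => (ε, y s)) (Icc a t) := continuousOn_const.prodMk hy
    have h0 := hG.continuousOn.comp hy2 hm
    have h1 := (contDiffOn_hjFirst hΩ hh hG).continuousOn.comp hy2 hm
    have h2 := (contDiffOn_hjSecond hΩ hh hG).continuousOn.comp hy2 hm
    exact (h0.sub (continuousOn_id.mul h1)).add (((continuousOn_id.pow 2).div_const 2).mul h2)
  have hint : IntervalIntegrable φ MeasureTheory.volume a t := hφ.intervalIntegrable_of_Icc hat
  have hle := intervalIntegral.sub_le_integral_of_hasDeriv_right_of_le (φ := fun s => φ s + C) hat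
    hcont (fun s hs => (hasDerivAt_hjTaylor_curve hΩ hh hG ε (hy' s hs)
      (hyΩ s (Ioo_subset_Icc_self hs))).hasDerivWithinAt)
    (hφ.add continuousOn_const).integrableOn_Icc (fun s hs => by
      -- Fenchel's inequality with the differential of the approximate solution as the covector.
      have h1 := hfen s hs (hjTaylorDeriv h G (s, ε, y s))
      have h2 := (abs_le.1 (hC s hs)).2
      linarith)
  rw [intervalIntegral.integral_add hint (by simp), intervalIntegral.integral_const, smul_eq_mul,
    mul_comm (t - a)] at hle
  exact hle

/-- Approximate solutions of the Hamilton–Jacobi equation bound from above the action of curves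
that are almost optimal for them. -/
theorem integral_le_hjTaylor_sub (hΩ : IsOpen Ω) (hh : ContDiffOn ℝ ∞ h (Ω ×ˢ univ))
    (hG : ContDiffOn ℝ ∞ G (univ ×ˢ Ω)) {C δ ε a t : ℝ} {y y' : ℝ → E} {φ : ℝ → ℝ} (hat : a ≤ t)
    (hC : ∀ s ∈ Ioo a t, |hjResidual h G (s, ε, y s)| ≤ C)
    (hy : ContinuousOn y (Icc a t)) (hy' : ∀ s ∈ Ioo a t, HasDerivAt y (y' s) s)
    (hyΩ : ∀ s ∈ Icc a t, y s ∈ Ω) (hφ : ContinuousOn φ (Icc a t))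
    (hopt : ∀ s ∈ Ioo a t, φ s ≤ hjTaylorDeriv h G (s, ε, y s) (y' s) -
      h (y s, hjTaylorDeriv h G (s, ε, y s)) + δ) :
    (∫ s in a..t, φ s) ≤
      hjTaylor h G (t, ε, y t) - hjTaylor h G (a, ε, y a) + (C + δ) * (t - a) := by
  have hcont : ContinuousOn (fun s => hjTaylor h G (s, ε, y s)) (Icc a t) := by
    have hm : MapsTo (fun s => (ε, y s)) (Icc a t) (univ ×ˢ Ω) := fun s hs => ⟨trivial, hyΩ s hs⟩
    have hy2 : ContinuousOn (fun s => (ε, y s)) (Icc a t) := continuousOn_const.prodMk hy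
    have h0 := hG.continuousOn.comp hy2 hm
    have h1 := (contDiffOn_hjFirst hΩ hh hG).continuousOn.comp hy2 hm
    have h2 := (contDiffOn_hjSecond hΩ hh hG).continuousOn.comp hy2 hm
    exact (h0.sub (continuousOn_id.mul h1)).add (((continuousOn_id.pow 2).div_const 2).mul h2)
  have hint : IntervalIntegrable φ MeasureTheory.volume a t := hφ.intervalIntegrable_of_Icc hat
  have hle := intervalIntegral.integral_le_sub_of_hasDeriv_right_of_le
    (φ := fun s => φ s - (C + δ)) hat
    hcont (fun s hs => (hasDerivAt_hjTaylor_curve hΩ hh hG ε (hy' s hs)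
      (hyΩ s (Ioo_subset_Icc_self hs))).hasDerivWithinAt)
    (hφ.sub continuousOn_const).integrableOn_Icc (fun s hs => by
      have h1 := hopt s hs
      have h2 := (abs_le.1 (hC s hs)).1
      linarith)
  rw [intervalIntegral.integral_sub hint (by simp), intervalIntegral.integral_const, smul_eq_mul,
    mul_comm (t - a)] at hle
  linarith

end HamiltonJacobi

end CommutingActions

namespace CommutingActions

/-! ### Optimal segments, and the composition of two evolutions. -/

section HamiltonJacobiPairs

theorem two_le_infty : (2 : WithTop ℕ∞) ≤ ∞ := WithTop.coe_le_coe.2 (le_top (a := (2 : ℕ∞)))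

variable {E : Type*} [NormedAddCommGroup E] [NormedSpace ℝ E]
  {Ω : Set E} {h h₁ h₂ : E × (E →L[ℝ] ℝ) → ℝ} {G : ℝ × E → ℝ} {u : E → ℝ}

/-- Straight segments with the optimal velocity realize the approximate solution of the
Hamilton–Jacobi equation up to third order. -/
theorem exists_integral_segment_le [FiniteDimensional ℝ E] (hΩ : IsOpen Ω)
    (hh : ContDiffOn ℝ ∞ h (Ω ×ˢ univ)) (hG : ContDiffOn ℝ ∞ G (univ ×ˢ Ω)) {l : E × E → ℝ}
    (hl : ContDiffOn ℝ ∞ l (Ω ×ˢ univ))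
    (hfen : ∀ x ∈ Ω, ∀ v, ∀ α : E →L[ℝ] ℝ, α v ≤ h (x, α) + l (x, v)) {x₀ v : E} (hx₀ : x₀ ∈ Ω)
    (hv : fderivSnd G (0, x₀) v = h (x₀, fderivSnd G (0, x₀)) + l (x₀, v)) {M : ℝ} (hM : 0 ≤ M) :
    ∃ C, 0 ≤ C ∧ ∀ᶠ ε in 𝓝[>] (0 : ℝ), ∀ c : E, ‖c - x₀‖ ≤ M * ε →
      (∫ s in (0 : ℝ)..ε, l (c + s • v, v)) ≤ hjEnd h G (ε, c + ε • v) - G (ε, c) + C * ε ^ 3 := by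
  have hUU : IsOpen ((univ : Set ℝ) ×ˢ (univ : Set ℝ) ×ˢ Ω) :=
    isOpen_univ.prod (isOpen_univ.prod hΩ)
  have hP := contDiffOn_hjTaylorDeriv hΩ hh hG
  have hx : ContDiffOn ℝ ∞ (fun w : ℝ × ℝ × E => w.2.2) (univ ×ˢ univ ×ˢ Ω) :=
    contDiff_snd.snd.contDiffOn
  -- The Fenchel defect of the fixed velocity v. It is nonnegative and vanishes at (0, 0, x₀), so it
  -- is O(ε²) at distance O(ε). This is why a straight segment is good enough: after integration its
  -- loss is O(ε³).
  set g : ℝ × ℝ × E → ℝ := fun w =>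
    h (w.2.2, hjTaylorDeriv h G w) + l (w.2.2, v) - hjTaylorDeriv h G w v with hg
  have hgs : ContDiffOn ℝ ∞ g (univ ×ˢ univ ×ˢ Ω) :=
    ((hh.comp (hx.prodMk hP) fun _ hz => ⟨hz.2.2, trivial⟩).add
      (hl.comp (hx.prodMk contDiffOn_const) fun _ hz => ⟨hz.2.2, trivial⟩)).sub
      (hP.clm_apply contDiffOn_const)
  have hmem : ((0 : ℝ), (0 : ℝ), x₀) ∈ (univ : Set ℝ) ×ˢ (univ : Set ℝ) ×ˢ Ω :=
    ⟨trivial, trivial, hx₀⟩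
  have hg0 : g (0, 0, x₀) = 0 := by
    simp [hg, hjTaylorDeriv, hv]
  have hmin : IsLocalMin g (0, 0, x₀) := by
    filter_upwards [hUU.mem_nhds hmem] with w hw
    rw [hg0]
    exact sub_nonneg.2 (hfen w.2.2 hw.2.2 v _)
  obtain ⟨C', hC'0, hC'⟩ := exists_le_mul_sq_of_isLocalMin
    ((hgs.contDiffAt (hUU.mem_nhds hmem)).of_le two_le_infty) hg0 hmin
  obtain ⟨δ, hδ, hball⟩ := Metric.eventually_nhds_iff_ball.1 hC'
  obtain ⟨ρ, hρ, hρΩ⟩ := Metric.nhds_basis_closedBall.mem_iff.1 (hΩ.mem_nhds hx₀)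
  obtain ⟨C, hC0, hC⟩ := exists_hjResidual_le hΩ hh hG (isCompact_closedBall x₀ ρ) hρΩ
  set M' : ℝ := 1 + M + ‖v‖ with hM'
  have hM'1 : 1 ≤ M' := by have := norm_nonneg v; linarith
  refine ⟨C + C' * M' ^ 2, by positivity, ?_⟩
  have hsmall : ∀ᶠ ε in 𝓝[>] (0 : ℝ), M' * ε < min (min δ ρ) 1 := by
    have : Filter.Tendsto (fun ε : ℝ => M' * ε) (𝓝[>] 0) (𝓝 0) := by
      have h : ContinuousAt (fun ε : ℝ => M' * ε) 0 := by fun_prop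
      simpa using h.tendsto.mono_left nhdsWithin_le_nhds
    exact this.eventually (gt_mem_nhds (by positivity))
  filter_upwards [hsmall, self_mem_nhdsWithin] with ε hε hε0 c hc
  have hε0' : 0 < ε := hε0
  have hεδ : M' * ε < δ := hε.trans_le ((min_le_left _ _).trans (min_le_left _ _))
  have hερ : M' * ε < ρ := hε.trans_le ((min_le_left _ _).trans (min_le_right _ _))
  have hε1 : ε ≤ 1 := by
    have : M' * ε < 1 := hε.trans_le (min_le_right _ _)
    nlinarith
  have hdist : ∀ s ∈ Icc (0 : ℝ) ε, ‖c + s • v - x₀‖ ≤ (M + ‖v‖) * ε := by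
    intro s hs
    calc ‖c + s • v - x₀‖ = ‖(c - x₀) + s • v‖ := by congr 1; abel
      _ ≤ ‖c - x₀‖ + ‖s • v‖ := norm_add_le _ _
      _ ≤ M * ε + ε * ‖v‖ := by
        refine add_le_add hc ?_
        rw [norm_smul, Real.norm_of_nonneg hs.1]
        exact mul_le_mul_of_nonneg_right hs.2 (norm_nonneg v)
      _ = _ := by ring
  have hball' : ∀ s ∈ Icc (0 : ℝ) ε, c + s • v ∈ Metric.closedBall x₀ ρ := by
    intro s hs
    rw [mem_closedBall_iff_norm]
    refine (hdist s hs).trans (le_trans ?_ hερ.le)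
    exact mul_le_mul_of_nonneg_right (by linarith) hε0'.le
  have hline : ∀ s : ℝ, HasDerivAt (fun s : ℝ => c + s • v) v s := fun s => by
    simpa using ((hasDerivAt_id s).smul_const v).const_add c
  have hyc : Continuous fun s : ℝ => c + s • v := by fun_prop
  have := integral_le_hjTaylor_sub hΩ hh hG (C := C * ε ^ 2) (δ := C' * (M' * ε) ^ 2) (ε := ε)
    (y := fun s => c + s • v) (y' := fun _ => v) (φ := fun s => l (c + s • v, v)) hε0'.le
    (fun s hs => (hC s ⟨hs.1.le, hs.2.le.trans hε1⟩ ε ⟨hε0'.le, hε1⟩ _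
      (hball' s (Ioo_subset_Icc_self hs))).trans (mul_le_mul_of_nonneg_left
        (pow_le_pow_left₀ hs.1.le hs.2.le 2) hC0))
    hyc.continuousOn (fun s _ => hline s) (fun s hs => hρΩ (hball' s hs))
    (hl.continuousOn.comp (hyc.prodMk continuous_const).continuousOn
      fun s hs => ⟨hρΩ (hball' s hs), trivial⟩)
    (fun s hs => by
      have hs' := Ioo_subset_Icc_self hs
      have hn : ‖((s, ε, c + s • v) : ℝ × ℝ × E) - (0, 0, x₀)‖ ≤ M' * ε := by
        have hMv : 0 ≤ M + ‖v‖ := by positivity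
        have hle : ε ≤ M' * ε := le_mul_of_one_le_left hε0'.le hM'1
        simp only [Prod.mk_sub_mk, sub_zero, Prod.norm_def, sup_le_iff]
        refine ⟨?_, ?_, ?_⟩
        · rw [Real.norm_of_nonneg hs'.1]; linarith [hs'.2]
        · rw [Real.norm_of_nonneg hε0'.le]; exact hle
        · exact (hdist s hs').trans (mul_le_mul_of_nonneg_right (by linarith) hε0'.le)
      have h1 := hball (s, ε, c + s • v) (by
        rw [mem_ball_iff_norm]
        exact hn.trans_lt hεδ)
      have h2 : C' * ‖((s, ε, c + s • v) : ℝ × ℝ × E) - (0, 0, x₀)‖ ^ 2 ≤ C' * (M' * ε) ^ 2 :=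
        mul_le_mul_of_nonneg_left (pow_le_pow_left₀ (norm_nonneg _) hn 2) hC'0
      simp only [hg] at h1
      linarith)
  refine this.trans (le_of_eq ?_)
  simp only [hjEnd, hjTaylor, zero_smul, add_zero]
  ring

theorem fderivSnd_hjEnd_zero (hΩ : IsOpen Ω) (hh : ContDiffOn ℝ ∞ h (Ω ×ˢ univ))
    (hG : ContDiffOn ℝ ∞ G (univ ×ˢ Ω)) {x : E} (hx : x ∈ Ω) :
    fderivSnd (hjEnd h G) (0, x) = fderivSnd G (0, x) := by
  rw [fderivSnd_hjEnd hΩ hh hG 0 hx]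
  simp [hjTaylorDeriv]

/-- The evolution for time 0 is the identity. So in a composition the first evolution affects the
second order term of the second one only in higher order. -/
theorem hjSecond_hjEnd_zero (hΩ : IsOpen Ω) (hh₁ : ContDiffOn ℝ ∞ h₁ (Ω ×ˢ univ))
    (hh₂ : ContDiffOn ℝ ∞ h₂ (Ω ×ˢ univ)) (hG : ContDiffOn ℝ ∞ G (univ ×ˢ Ω)) {x : E}
    (hx : x ∈ Ω) : hjSecond h₂ (hjEnd h₁ G) (0, x) = hjSecond h₂ G (0, x) := by
  have h1 := fderivSnd_hjEnd_zero hΩ hh₁ hG hx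
  have h2 : fderivSnd (hjFirst h₂ (hjEnd h₁ G)) (0, x) = fderivSnd (hjFirst h₂ G) (0, x) := by
    refine (hasFDerivAt_snd_of_contDiffOn hΩ
      (contDiffOn_hjFirst hΩ hh₂ (contDiffOn_hjEnd hΩ hh₁ hG)) hx).unique ?_
    refine (hasFDerivAt_snd_of_contDiffOn hΩ
      (contDiffOn_hjFirst hΩ hh₂ hG) hx).congr_of_eventuallyEq ?_
    filter_upwards [hΩ.mem_nhds hx] with y hy
    simp only [hjFirst, fderivSnd_hjEnd_zero hΩ hh₁ hG hy]
  simp only [hjSecond, h1, h2]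

theorem contDiffOn_comp_snd (hu : ContDiffOn ℝ ∞ u Ω) :
    ContDiffOn ℝ ∞ (fun z : ℝ × E => u z.2) (univ ×ˢ Ω) :=
  hu.comp contDiffOn_snd fun _ hz => hz.2

theorem fderivSnd_comp_snd (hΩ : IsOpen Ω) (hu : ContDiffOn ℝ ∞ u Ω) (ε : ℝ) {x : E}
    (hx : x ∈ Ω) : fderivSnd (fun z : ℝ × E => u z.2) (ε, x) = fderiv ℝ u x :=
  (hasFDerivAt_snd_of_contDiffOn hΩ (contDiffOn_comp_snd hu) hx).fderiv.symm

theorem fderivSnd_congr_left {f : ℝ × E → ℝ} (hΩ : IsOpen Ω) (hf : ContDiffOn ℝ ∞ f (univ ×ˢ Ω))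
    {ε : ℝ} (hε : ∀ x ∈ Ω, f (ε, x) = f (0, x)) {x : E} (hx : x ∈ Ω) :
    fderivSnd f (ε, x) = fderivSnd f (0, x) := by
  refine (hasFDerivAt_snd_of_contDiffOn hΩ hf hx).unique ?_
  refine (hasFDerivAt_snd_of_contDiffOn hΩ hf hx).congr_of_eventuallyEq ?_
  filter_upwards [hΩ.mem_nhds hx] with y hy using hε y hy

/-- Second order expansion of the composition of two approximate Hamilton–Jacobi evolutions. -/
theorem tendsto_hjEnd_hjEnd (hΩ : IsOpen Ω) (hh₁ : ContDiffOn ℝ ∞ h₁ (Ω ×ˢ univ))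
    (hh₂ : ContDiffOn ℝ ∞ h₂ (Ω ×ˢ univ)) (hu : ContDiffOn ℝ ∞ u Ω) {x : E} (hx : x ∈ Ω) :
    Filter.Tendsto (fun ε => (hjEnd h₂ (hjEnd h₁ fun z => u z.2) (ε, x) - u x +
        ε * (h₁ (x, fderiv ℝ u x) + h₂ (x, fderiv ℝ u x))) / ε ^ 2) (𝓝[>] 0)
      (𝓝 ((hjSecond h₁ (fun z => u z.2) (0, x) + hjSecond h₂ (fun z => u z.2) (0, x)) / 2 +
        fderiv ℝ h₂ (x, fderiv ℝ u x) (0, fderivSnd (hjFirst h₁ fun z => u z.2) (0, x)))) := by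
  set G₀ : ℝ × E → ℝ := fun z => u z.2 with hG₀
  have hG : ContDiffOn ℝ ∞ G₀ (univ ×ˢ Ω) := contDiffOn_comp_snd hu
  have hU : IsOpen ((univ : Set ℝ) ×ˢ Ω) := isOpen_univ.prod hΩ
  have hd : ∀ (ε : ℝ), ∀ y ∈ Ω, fderivSnd G₀ (ε, y) = fderiv ℝ u y := fun ε y hy =>
    fderivSnd_comp_snd hΩ hu ε hy
  -- The initial function u does not depend on ε, so all coefficients of the first evolution can be
  -- evaluated at ε = 0.
  have hF : ∀ (ε : ℝ), ∀ y ∈ Ω, hjFirst h₁ G₀ (ε, y) = hjFirst h₁ G₀ (0, y) := fun ε y hy => by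
    simp only [hjFirst, hd _ y hy]
  have hF' : ∀ (ε : ℝ), ∀ y ∈ Ω, fderivSnd (hjFirst h₁ G₀) (ε, y)
      = fderivSnd (hjFirst h₁ G₀) (0, y) := fun ε y hy =>
    fderivSnd_congr_left hΩ (contDiffOn_hjFirst hΩ hh₁ hG) (hF ε) hy
  have hS : ∀ (ε : ℝ), ∀ y ∈ Ω, hjSecond h₁ G₀ (ε, y) = hjSecond h₁ G₀ (0, y) := fun ε y hy => by
    simp only [hjSecond, hd _ y hy, hF' ε y hy]
  have hS' : ∀ (ε : ℝ), ∀ y ∈ Ω, fderivSnd (hjSecond h₁ G₀) (ε, y)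
      = fderivSnd (hjSecond h₁ G₀) (0, y) := fun ε y hy =>
    fderivSnd_congr_left hΩ (contDiffOn_hjSecond hΩ hh₁ hG) (hS ε) hy
  have hG1 := contDiffOn_hjEnd hΩ hh₁ hG
  have hD : ∀ ε : ℝ, fderivSnd (hjEnd h₁ G₀) (ε, x) = fderiv ℝ u x -
      ε • fderivSnd (hjFirst h₁ G₀) (0, x) + (ε ^ 2 / 2) • fderivSnd (hjSecond h₁ G₀) (0, x) := by
    intro ε
    rw [fderivSnd_hjEnd hΩ hh₁ hG ε hx]
    simp only [hjTaylorDeriv, hd _ x hx, hF' ε x hx, hS' ε x hx]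
  have hP : HasDerivAt (fun ε : ℝ => fderivSnd (hjEnd h₁ G₀) (ε, x))
      (-fderivSnd (hjFirst h₁ G₀) (0, x)) 0 := by
    simp only [hD]
    have := (((hasDerivAt_id (0 : ℝ)).smul_const (fderivSnd (hjFirst h₁ G₀) (0, x))).const_sub
      (fderiv ℝ u x)).add ((((hasDerivAt_id (0 : ℝ)).pow 2).div_const 2).smul_const
        (fderivSnd (hjSecond h₁ G₀) (0, x)))
    refine this.congr_deriv ?_
    simp
  have hD0 : fderivSnd (hjEnd h₁ G₀) (0, x) = fderiv ℝ u x := by simp [hD]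
  have hK : HasDerivAt (fun ε : ℝ => hjFirst h₂ (hjEnd h₁ G₀) (ε, x))
      (fderiv ℝ h₂ (x, fderiv ℝ u x) (0, -fderivSnd (hjFirst h₁ G₀) (0, x))) 0 := by
    have hhd : HasFDerivAt h₂ (fderiv ℝ h₂ (x, fderiv ℝ u x))
        (x, fderivSnd (hjEnd h₁ G₀) (0, x)) := by
      rw [hD0]
      exact ((hh₂.contDiffAt ((hΩ.prod isOpen_univ).mem_nhds ⟨hx, trivial⟩)).differentiableAt
        (by norm_num)).hasFDerivAt
    exact hhd.comp_hasDerivAt (0 : ℝ) ((hasDerivAt_const (0 : ℝ) x).prodMk hP)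
  have hA : ContinuousAt (fun ε : ℝ => hjSecond h₂ (hjEnd h₁ G₀) (ε, x)) 0 := by
    have h1 := (contDiffOn_hjSecond hΩ hh₂ hG1).continuousOn.continuousAt
      (hU.mem_nhds (x := ((0 : ℝ), x)) ⟨trivial, hx⟩)
    exact h1.comp (f := fun ε : ℝ => (ε, x)) (by fun_prop)
  have hle : 𝓝[>] (0 : ℝ) ≤ 𝓝[≠] 0 := nhdsWithin_mono _ fun y hy => ne_of_gt hy
  have h1 := (hasDerivAt_iff_tendsto_slope.1 hK).mono_left hle
  have h2 := hA.tendsto.mono_left (nhdsWithin_le_nhds (s := Ioi (0 : ℝ)))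
  -- The ε² coefficient has three sources: the second order terms of the two evolutions, and the
  -- first order change of H₂(x, d·) caused by the first evolution. Only the last one depends on the
  -- order of the evolutions.
  have h3 := ((h2.add_const (hjSecond h₁ G₀ (0, x))).div_const 2).sub h1
  rw [hjSecond_hjEnd_zero hΩ hh₁ hh₂ hG hx] at h3
  have hneg : ((0 : E), -fderivSnd (hjFirst h₁ G₀) (0, x))
      = -(0, fderivSnd (hjFirst h₁ G₀) (0, x)) := by simp
  rw [hneg, map_neg, sub_neg_eq_add, add_comm (hjSecond h₂ G₀ (0, x))] at h3
  refine h3.congr' ?_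
  filter_upwards [self_mem_nhdsWithin] with ε hε
  have hε' : ε ≠ 0 := ne_of_gt hε
  have e1 : hjFirst h₂ (hjEnd h₁ G₀) (0, x) = h₂ (x, fderiv ℝ u x) := by
    simp only [hjFirst, hD0]
  have e2 : hjFirst h₁ G₀ (ε, x) = h₁ (x, fderiv ℝ u x) := by
    simp only [hjFirst, hd _ x hx]
  have e3 : hjEnd h₁ G₀ (ε, x) = u x - ε * h₁ (x, fderiv ℝ u x)
      + ε ^ 2 / 2 * hjSecond h₁ G₀ (0, x) := by
    simp only [hjEnd, hjTaylor, e2, hS ε x hx]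
    rfl
  rw [slope_def_field, e1]
  conv_rhs => rw [hjEnd, hjTaylor]
  simp only [e3]
  field_simp
  ring

/-- If two approximate Hamilton–Jacobi evolutions are ordered up to third order, then the Poisson
bracket has a sign. -/
theorem fderiv_le_fderiv_of_hjEnd_le (hΩ : IsOpen Ω) (hh₁ : ContDiffOn ℝ ∞ h₁ (Ω ×ˢ univ))
    (hh₂ : ContDiffOn ℝ ∞ h₂ (Ω ×ˢ univ)) (hu : ContDiffOn ℝ ∞ u Ω) {x v₁ v₂ : E} (hx : x ∈ Ω)
    (hv₁ : ∀ β, fderiv ℝ h₁ (x, fderiv ℝ u x) (0, β) = β v₁)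
    (hv₂ : ∀ β, fderiv ℝ h₂ (x, fderiv ℝ u x) (0, β) = β v₂) {C : ℝ}
    (hle : ∀ᶠ ε in 𝓝[>] (0 : ℝ), hjEnd h₁ (hjEnd h₂ fun z => u z.2) (ε, x) ≤
      hjEnd h₂ (hjEnd h₁ fun z => u z.2) (ε, x) + C * ε ^ 3) :
    fderiv ℝ h₂ (x, fderiv ℝ u x) (v₁, 0) ≤ fderiv ℝ h₁ (x, fderiv ℝ u x) (v₂, 0) := by
  have hG : ContDiffOn ℝ ∞ (fun z : ℝ × E => u z.2) (univ ×ˢ Ω) := contDiffOn_comp_snd hu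
  have hk : ∀ {h : E × (E →L[ℝ] ℝ) → ℝ} {w : E}, ContDiffOn ℝ ∞ h (Ω ×ˢ univ) →
      (∀ β, fderiv ℝ h (x, fderiv ℝ u x) (0, β) = β w) → ∀ v,
      fderivSnd (hjFirst h fun z => u z.2) (0, x) v =
        fderiv ℝ h (x, fderiv ℝ u x) (v, 0) + fderiv ℝ (fderiv ℝ u) x v w := by
    intro h w hh hw v
    have h1 := hasFDerivAt_snd_of_contDiffOn hΩ (contDiffOn_hjFirst hΩ hh hG) (ε := 0) hx
    have hu2 : HasFDerivAt (fderiv ℝ u) (fderiv ℝ (fderiv ℝ u) x) x :=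
      (((hu.fderiv_of_isOpen hΩ (m := ∞) (by norm_num)).contDiffAt
        (hΩ.mem_nhds hx)).differentiableAt (by norm_num)).hasFDerivAt
    have hhd := ((hh.contDiffAt ((hΩ.prod isOpen_univ).mem_nhds
      (x := (x, fderiv ℝ u x)) ⟨hx, trivial⟩)).differentiableAt (by norm_num)).hasFDerivAt
    have h2 := hhd.comp x ((hasFDerivAt_id x).prodMk hu2)
    have h3 := h1.unique (h2.congr_of_eventuallyEq (by
      filter_upwards [hΩ.mem_nhds hx] with y hy
      simp only [hjFirst, fderivSnd_comp_snd hΩ hu 0 hy, Function.comp, id]))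
    rw [h3, ← hw, ← map_add]
    simp
  have t12 := tendsto_hjEnd_hjEnd hΩ hh₁ hh₂ hu hx
  have t21 := tendsto_hjEnd_hjEnd hΩ hh₂ hh₁ hu hx
  have tC : Filter.Tendsto (fun ε : ℝ => C * ε) (𝓝[>] 0) (𝓝 0) := by
    have h : ContinuousAt (fun ε : ℝ => C * ε) 0 := by fun_prop
    simpa using h.tendsto.mono_left nhdsWithin_le_nhds
  have hlim := le_of_tendsto_of_tendsto t21 (t12.add tC) (by
    filter_upwards [hle, self_mem_nhdsWithin] with ε h hε
    have hε' : 0 < ε := hε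
    rw [div_add' _ _ _ (by positivity), div_le_div_iff_of_pos_right (by positivity)]
    nlinarith)
  -- The mixed terms become x-derivatives of the Hamilton functions plus D²u evaluated on the two
  -- velocities; the D²u terms cancel by symmetry.
  rw [hv₂, hv₁, hk hh₁ hv₁, hk hh₂ hv₂] at hlim
  have hsymm : fderiv ℝ (fderiv ℝ u) x v₁ v₂ = fderiv ℝ (fderiv ℝ u) x v₂ v₁ :=
    ((hu.contDiffAt (hΩ.mem_nhds hx)).isSymmSndFDerivAt (by simpa using two_le_infty)) v₁ v₂
  linarith

end HamiltonJacobiPairs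

end CommutingActions

namespace CommutingActions

variable {n : ℕ} {M : Type*} [TopologicalSpace M] [ChartedSpace (Coord n) M]

/-! ### The Lagrange function in a chart -/

/-- A Lagrange function in the coordinates of a chart. -/
noncomputable def chartLagrangian (L : Tan n M → ℝ) (φ : OpenPartialHomeomorph M (Coord n))
    (z : Coord n × Coord n) : ℝ :=
  L ⟨φ.symm z.1, mfderiv (𝓡 n) (𝓡 n) φ.symm z.1 z.2⟩

/-- The Hamilton function in the coordinates of a chart. -/
noncomputable def chartHamiltonian (L : Tan n M → ℝ) (φ : OpenPartialHomeomorph M (Coord n))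
    (z : Coord n × (Coord n →L[ℝ] ℝ)) : ℝ :=
  hamiltonian L ⟨φ.symm z.1, z.2.comp (mfderiv (𝓡 n) (𝓡 n) φ (φ.symm z.1))⟩

theorem hamiltonian_comp_ofCoords (L : Tan n M → ℝ) (φ : OpenPartialHomeomorph M (Coord n)) :
    hamiltonian L ∘ ofCoords φ = fun y => chartHamiltonian L φ (y.1, innerSL ℝ y.2) := rfl

theorem mdifferentiable_of_mem_maximalAtlas [IsManifold (𝓡 n) ∞ M]
    {φ : OpenPartialHomeomorph M (Coord n)} (hφ : φ ∈ IsManifold.maximalAtlas (𝓡 n) ∞ M) :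
    φ.MDifferentiable (𝓡 n) (𝓡 n) :=
  ⟨(contMDiffOn_of_mem_maximalAtlas hφ).mdifferentiableOn (by simp),
    (contMDiffOn_symm_of_mem_maximalAtlas hφ).mdifferentiableOn (by simp)⟩

theorem contMDiff_tangentBundle_mk :
    ContMDiff 𝓘(ℝ, Coord n × Coord n) (𝓡 n).tangent ∞
      (fun z : Coord n × Coord n => (⟨z.1, z.2⟩ : TangentBundle (𝓡 n) (Coord n))) := by
  intro z
  rw [Bundle.contMDiffAt_totalSpace]
  refine ⟨contDiff_fst.contMDiff.contMDiffAt, ?_⟩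
  simpa using contDiff_snd.contMDiff.contMDiffAt

/-- In a chart, L is its composition with the tangent map of the inverse chart. -/
theorem contDiffOn_chartLagrangian [IsManifold (𝓡 n) ∞ M] {L : Tan n M → ℝ}
    (hL : ContMDiff (𝓡 n).tangent 𝓘(ℝ, ℝ) ∞ L)
    {φ : OpenPartialHomeomorph M (Coord n)} (hφ : φ ∈ IsManifold.maximalAtlas (𝓡 n) ∞ M) :
    ContDiffOn ℝ ∞ (chartLagrangian L φ) (φ.target ×ˢ univ) := by
  have : IsManifold (𝓡 n) 1 M := IsManifold.of_le (n := ∞) (by simp)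
  have h1 := (contMDiffOn_symm_of_mem_maximalAtlas hφ).contMDiffOn_tangentMapWithin (m := ∞)
    (by norm_num) φ.open_target.uniqueMDiffOn
  have h2 := (hL.comp_contMDiffOn h1).comp
    (contMDiff_tangentBundle_mk (n := n)).contMDiffOn (s := φ.target ×ˢ univ) fun z hz => hz.1
  rw [← contMDiffOn_iff_contDiffOn]
  refine h2.congr fun z hz => ?_
  simp only [chartLagrangian, Function.comp, tangentMapWithin]
  rw [mfderivWithin_of_isOpen φ.open_target hz.1]

/-! ### Fibrewise convexity -/

/-- A Lagrange function on a fibre of the tangent bundle. -/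
noncomputable def fibreLagrangian (L : Tan n M → ℝ) (q : M) (w : Coord n) : ℝ := L ⟨q, w⟩

/-- The derivative of a chart as an equivalence of the tangent space with `ℝⁿ`. -/
theorem exists_equiv_mfderiv [IsManifold (𝓡 n) ∞ M] {φ : OpenPartialHomeomorph M (Coord n)}
    (hφ : φ ∈ IsManifold.maximalAtlas (𝓡 n) ∞ M) {q : M} (hq : q ∈ φ.source) :
    ∃ A : Coord n ≃L[ℝ] Coord n, (A : Coord n →L[ℝ] Coord n) = mfderiv (𝓡 n) (𝓡 n) φ q ∧
      (A.symm : Coord n →L[ℝ] Coord n) = mfderiv (𝓡 n) (𝓡 n) φ.symm (φ q) :=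
  ⟨(mdifferentiable_of_mem_maximalAtlas hφ).mfderiv hq, rfl, rfl⟩

theorem chartLagrangian_eq (L : Tan n M → ℝ) {φ : OpenPartialHomeomorph M (Coord n)} {q : M}
    (hq : q ∈ φ.source) (w : Coord n) :
    chartLagrangian L φ (φ q, w) = L ⟨q, mfderiv (𝓡 n) (𝓡 n) φ.symm (φ q) w⟩ := by
  -- All tangent spaces unfold to ℝⁿ; through `fibreLagrangian` the base point can be replaced while
  -- the velocity stays the same vector of ℝⁿ.
  exact congrArg (fun q' => fibreLagrangian L q' (mfderiv (𝓡 n) (𝓡 n) φ.symm (φ q) w))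
    (φ.left_inv hq)

theorem chartHamiltonian_eq (L : Tan n M → ℝ) {φ : OpenPartialHomeomorph M (Coord n)} {q : M}
    (hq : q ∈ φ.source) (α : Coord n →L[ℝ] ℝ) :
    chartHamiltonian L φ (φ q, α) = hamiltonian L ⟨q, α.comp (mfderiv (𝓡 n) (𝓡 n) φ q)⟩ := by
  unfold chartHamiltonian
  have h := φ.left_inv hq
  dsimp only
  rw [h]

theorem contDiff_fibreLagrangian [IsManifold (𝓡 n) ∞ M] {L : Tan n M → ℝ} (hL : ContMDiff (𝓡 n).tangent 𝓘(ℝ, ℝ) ∞ L)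
    (q : M) : ContDiff ℝ ∞ (fibreLagrangian L q) := by
  have hφ := IsManifold.chart_mem_maximalAtlas (I := 𝓡 n) (n := ∞) q
  have hq := mem_chart_source (Coord n) q
  obtain ⟨A, hA, hA'⟩ := exists_equiv_mfderiv hφ hq
  have h1 : fibreLagrangian L q = fun w =>
      chartLagrangian L (chartAt (Coord n) q) (chartAt (Coord n) q q, (A : Coord n →L[ℝ] Coord n) w) := by
    ext w
    rw [chartLagrangian_eq L hq]
    refine congrArg (fibreLagrangian L q) ?_
    exact (A.symm_apply_apply w).symm.trans (DFunLike.congr_fun hA' _)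
  rw [h1, ← contDiffOn_univ]
  refine (contDiffOn_chartLagrangian hL hφ).comp (t := _ ×ˢ univ) ?_ fun w _ =>
    ⟨(chartAt (Coord n) q).map_source hq, trivial⟩
  exact contDiffOn_const.prodMk (ContinuousLinearMap.contDiff _).contDiffOn

/-- The coordinates of a kernel vector form a left null vector of `hessian L q v`. -/
theorem fderiv_fibreLagrangian_ker {L : Tan n M → ℝ} (hnd : Nondegenerate L) (q : M) (v a : Coord n)
    (ha : fderiv ℝ (fderiv ℝ (fibreLagrangian L q)) v a = 0) : a = 0 := by
  have h1 : Matrix.vecMul a (hessian L q v) = 0 := by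
    ext k
    have h2 : fderiv ℝ (fderiv ℝ (fibreLagrangian L q)) v a (basisVec k) = 0 := by rw [ha]; rfl
    have h3 : a = ∑ j, a j • (basisVec j : Coord n) := by
      ext k
      simp [basisVec, Finset.sum_apply, Pi.single_apply]
    rw [h3, map_sum, sum_apply] at h2
    simp only [map_smul, smul_apply, smul_eq_mul] at h2
    exact h2
  have := Matrix.eq_zero_of_vecMul_eq_zero (hnd q v) h1
  ext k
  exact congrFun this k

end CommutingActions

namespace CommutingActions

variable {n : ℕ} {M : Type*} [TopologicalSpace M] [ChartedSpace (Coord n) M]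

/-- The Hessian of the Lagrange function is positive definite on the fibres. -/
def FibreConvex (L : Tan n M → ℝ) : Prop :=
  ∀ (q : M) (v a : Coord n), a ≠ 0 → 0 < fderiv ℝ (fderiv ℝ (fibreLagrangian L q)) v a a

/-- One semidefinite velocity in each fibre suffices, since nondegeneracy spreads definiteness over
the fibre. -/
theorem fibreConvex_of_exists [IsManifold (𝓡 n) ∞ M] {L : Tan n M → ℝ}
    (hL : ContMDiff (𝓡 n).tangent 𝓘(ℝ, ℝ) ∞ L) (hnd : Nondegenerate L)
    (h : ∀ q, ∃ v, ∀ a, 0 ≤ fderiv ℝ (fderiv ℝ (fibreLagrangian L q)) v a a) : FibreConvex L := by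
  intro q v a ha
  obtain ⟨v₀, h0⟩ := h q
  have hf := contDiff_fibreLagrangian hL q
  refine pos_of_nondegenerate_family (B := fderiv ℝ (fderiv ℝ (fibreLagrangian L q))) ?_ ?_
    (fderiv_fibreLagrangian_ker hnd q) h0 v ha
  · exact ((hf.fderiv_right (m := ∞) (by norm_num)).fderiv_right (m := 0) (by norm_num)).continuous
  · exact fun w => (hf.contDiffAt (x := w)).isSymmSndFDerivAt (by simpa using two_le_infty)

/-! ### Fenchel's inequality and the Hamilton function in a chart. -/

section Fenchel

variable [IsManifold (𝓡 n) ∞ M] {L : Tan n M → ℝ}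

theorem legendre_injective (hL : ContMDiff (𝓡 n).tangent 𝓘(ℝ, ℝ) ∞ L) (hc : FibreConvex L) (q : M) :
    Function.Injective (legendre L q) :=
  fderiv_injective_of_hessian_pos ((contDiff_fibreLagrangian hL q).of_le two_le_infty) (hc q)

/-- This is Fenchel's inequality: L on the fibre lies above its tangent plane at the velocity
belonging to p, and that plane is w ↦ p(w) - H(q, p). -/
theorem le_hamiltonian_add (hL : ContMDiff (𝓡 n).tangent 𝓘(ℝ, ℝ) ∞ L) (hc : FibreConvex L)
    (hleg : ∀ q, Function.Surjective (legendre L q)) (q : M) (p : Coord n →L[ℝ] ℝ) (w : Coord n) :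
    p w ≤ hamiltonian L ⟨q, p⟩ + L ⟨q, w⟩ := by
  set v : Coord n := Function.invFun (legendre L q) p with hv
  have hp : fderiv ℝ (fibreLagrangian L q) v = p := Function.invFun_eq (hleg q p)
  change p w ≤ p v - fibreLagrangian L q v + fibreLagrangian L q w
  rcases eq_or_ne v w with h | h
  · rw [h]; linarith
  · have := tangent_lt_of_hessian_pos ((contDiff_fibreLagrangian hL q).of_le two_le_infty) (hc q) h
    rw [hp, map_sub] at this
    linarith

theorem chart_le_hamiltonian_add (hL : ContMDiff (𝓡 n).tangent 𝓘(ℝ, ℝ) ∞ L) (hc : FibreConvex L)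
    (hleg : ∀ q, Function.Surjective (legendre L q)) {φ : OpenPartialHomeomorph M (Coord n)}
    {q : M} (hq : q ∈ φ.source) (α : Coord n →L[ℝ] ℝ) (w : TangentSpace (𝓡 n) q) :
    α (mfderiv (𝓡 n) (𝓡 n) φ q w) ≤ chartHamiltonian L φ (φ q, α) + L ⟨q, w⟩ := by
  rw [chartHamiltonian_eq L hq]
  exact le_hamiltonian_add hL hc hleg q (α.comp (mfderiv (𝓡 n) (𝓡 n) φ q)) w

theorem le_chartHamiltonian_add (hL : ContMDiff (𝓡 n).tangent 𝓘(ℝ, ℝ) ∞ L) (hc : FibreConvex L)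
    (hleg : ∀ q, Function.Surjective (legendre L q)) {φ : OpenPartialHomeomorph M (Coord n)}
    (hφ : φ ∈ IsManifold.maximalAtlas (𝓡 n) ∞ M) {x : Coord n} (hx : x ∈ φ.target) (v : Coord n)
    (α : Coord n →L[ℝ] ℝ) : α v ≤ chartHamiltonian L φ (x, α) + chartLagrangian L φ (x, v) := by
  obtain ⟨q, hq, rfl⟩ : ∃ q ∈ φ.source, φ q = x := ⟨φ.symm x, φ.map_target hx, φ.right_inv hx⟩
  obtain ⟨A, hA, hA'⟩ := exists_equiv_mfderiv hφ hq
  have h := chart_le_hamiltonian_add hL hc hleg hq α (mfderiv (𝓡 n) (𝓡 n) φ.symm (φ q) v)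
  rw [chartLagrangian_eq L hq]
  refine le_of_eq_of_le (congrArg α ?_) h
  exact (A.apply_symm_apply v).symm.trans
    ((congrArg A (DFunLike.congr_fun hA' v)).trans (DFunLike.congr_fun hA _))

/-- The velocity in chart coordinates that belongs to a momentum. -/
noncomputable def chartVelocity (L : Tan n M → ℝ) (φ : OpenPartialHomeomorph M (Coord n))
    (z : Coord n × (Coord n →L[ℝ] ℝ)) : Coord n :=
  mfderiv (𝓡 n) (𝓡 n) φ (φ.symm z.1) (Function.invFun (legendre L (φ.symm z.1))
    (z.2.comp (mfderiv (𝓡 n) (𝓡 n) φ (φ.symm z.1))))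

theorem fderivSnd_chartLagrangian (hL : ContMDiff (𝓡 n).tangent 𝓘(ℝ, ℝ) ∞ L)
    {φ : OpenPartialHomeomorph M (Coord n)} (hφ : φ ∈ IsManifold.maximalAtlas (𝓡 n) ∞ M) {q : M}
    (hq : q ∈ φ.source) {A : Coord n ≃L[ℝ] Coord n}
    (hA : (A.symm : Coord n →L[ℝ] Coord n) = mfderiv (𝓡 n) (𝓡 n) φ.symm (φ q)) (v : Coord n) :
    fderivSnd (chartLagrangian L φ) (φ q, v) =
      (fderiv ℝ (fibreLagrangian L q) (A.symm v)).comp (A.symm : Coord n →L[ℝ] Coord n) := by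
  have h1 : DifferentiableAt ℝ (chartLagrangian L φ) (φ q, v) :=
    ((contDiffOn_chartLagrangian hL hφ).contDiffAt ((φ.open_target.prod isOpen_univ).mem_nhds
      ⟨φ.map_source hq, trivial⟩)).differentiableAt (by norm_num)
  have h2 : (fun w => chartLagrangian L φ (φ q, w)) = fibreLagrangian L q ∘ A.symm := by
    ext w
    rw [chartLagrangian_eq L hq]
    exact congrArg (fibreLagrangian L q) (DFunLike.congr_fun hA w).symm
  rw [fderivSnd_eq h1, h2]
  exact (((contDiff_fibreLagrangian hL q).differentiable (by norm_num) _).hasFDerivAt.comp v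
    A.symm.hasFDerivAt).fderiv

theorem fderivSnd_chartVelocity (hL : ContMDiff (𝓡 n).tangent 𝓘(ℝ, ℝ) ∞ L)
    (hleg : ∀ q, Function.Surjective (legendre L q)) {φ : OpenPartialHomeomorph M (Coord n)}
    (hφ : φ ∈ IsManifold.maximalAtlas (𝓡 n) ∞ M) {x : Coord n} (hx : x ∈ φ.target)
    (α : Coord n →L[ℝ] ℝ) :
    fderivSnd (chartLagrangian L φ) (x, chartVelocity L φ (x, α)) = α := by
  have hq : φ.symm x ∈ φ.source := φ.map_target hx
  obtain ⟨A, hA, hA'⟩ := exists_equiv_mfderiv hφ hq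
  have h := fderivSnd_chartLagrangian hL hφ hq hA' (chartVelocity L φ (x, α))
  rw [φ.right_inv hx] at h
  set w : Coord n := Function.invFun (legendre L (φ.symm x))
    (α.comp (mfderiv (𝓡 n) (𝓡 n) φ (φ.symm x))) with hw
  have hv : A.symm (chartVelocity L φ (x, α)) = w := by
    rw [A.symm_apply_eq]
    exact (DFunLike.congr_fun hA w).symm
  have h3 : fderiv ℝ (fibreLagrangian L (φ.symm x)) w
      = α.comp (mfderiv (𝓡 n) (𝓡 n) φ (φ.symm x)) :=
    Function.invFun_eq (hleg _ _)
  rw [h, hv, h3]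
  ext v
  have : mfderiv (𝓡 n) (𝓡 n) φ (φ.symm x) (A.symm v) = v :=
    (DFunLike.congr_fun hA (A.symm v)).symm.trans (A.apply_symm_apply v)
  exact congrArg α this

theorem chartHamiltonian_eq_sub {φ : OpenPartialHomeomorph M (Coord n)}
    (hφ : φ ∈ IsManifold.maximalAtlas (𝓡 n) ∞ M) {x : Coord n} (hx : x ∈ φ.target)
    (α : Coord n →L[ℝ] ℝ) : chartHamiltonian L φ (x, α) =
      α (chartVelocity L φ (x, α)) - chartLagrangian L φ (x, chartVelocity L φ (x, α)) := by
  have hq : φ.symm x ∈ φ.source := φ.map_target hx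
  obtain ⟨A, hA, hA'⟩ := exists_equiv_mfderiv hφ hq
  rw [φ.right_inv hx] at hA'
  set w : Coord n := Function.invFun (legendre L (φ.symm x))
    (α.comp (mfderiv (𝓡 n) (𝓡 n) φ (φ.symm x))) with hw
  have hv : mfderiv (𝓡 n) (𝓡 n) φ.symm x (chartVelocity L φ (x, α)) = w := by
    refine (DFunLike.congr_fun hA' _).symm.trans ?_
    change A.symm _ = w
    rw [A.symm_apply_eq]
    exact (DFunLike.congr_fun hA w).symm
  exact congrArg (fun v => α (chartVelocity L φ (x, α)) - fibreLagrangian L (φ.symm x) v) hv.symm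

/-- The velocity is a smooth function of position and momentum by `contDiffOn_of_fderivSnd_eq`, and
the Hamilton function is its Legendre expression. -/
theorem contDiffOn_chartHamiltonian (hL : ContMDiff (𝓡 n).tangent 𝓘(ℝ, ℝ) ∞ L)
    (hc : FibreConvex L) (hleg : ∀ q, Function.Surjective (legendre L q))
    {φ : OpenPartialHomeomorph M (Coord n)} (hφ : φ ∈ IsManifold.maximalAtlas (𝓡 n) ∞ M) :
    ContDiffOn ℝ ∞ (chartHamiltonian L φ) (φ.target ×ˢ univ) := by
  have hl := contDiffOn_chartLagrangian hL hφ
  have hV : ContDiffOn ℝ ∞ (chartVelocity L φ) (φ.target ×ˢ univ) := by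
    refine contDiffOn_of_fderivSnd_eq φ.open_target hl ?_ ?_
      fun x hx α => fderivSnd_chartVelocity hL hleg hφ hx α
    · intro x hx v w hvw
      obtain ⟨q, hq, rfl⟩ : ∃ q ∈ φ.source, φ q = x := ⟨φ.symm x, φ.map_target hx, φ.right_inv hx⟩
      obtain ⟨A, hA, hA'⟩ := exists_equiv_mfderiv hφ hq
      simp only [fderivSnd_chartLagrangian hL hφ hq hA'] at hvw
      apply A.symm.injective
      apply legendre_injective hL hc q
      refine ContinuousLinearMap.ext fun (a : Coord n) => ?_
      have h1 := DFunLike.congr_fun hvw (A a)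
      change fderiv ℝ (fibreLagrangian L q) (A.symm v) (A.symm (A a)) =
        fderiv ℝ (fibreLagrangian L q) (A.symm w) (A.symm (A a)) at h1
      rw [A.symm_apply_apply] at h1
      exact h1
    · intro x hx v a ha
      obtain ⟨q, hq, rfl⟩ : ∃ q ∈ φ.source, φ q = x := ⟨φ.symm x, φ.map_target hx, φ.right_inv hx⟩
      obtain ⟨A, hA, hA'⟩ := exists_equiv_mfderiv hφ hq
      simp only [fderivSnd_chartLagrangian hL hφ hq hA'] at ha
      have hd : HasFDerivAt (fderiv ℝ (fibreLagrangian L q))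
          (fderiv ℝ (fderiv ℝ (fibreLagrangian L q)) (A.symm v)) (A.symm v) :=
        (((contDiff_fibreLagrangian hL q).fderiv_right (m := ∞) (by norm_num)).differentiable
          (by norm_num) _).hasFDerivAt
      have h2 := ((((ContinuousLinearMap.compL ℝ (Coord n) (Coord n) ℝ).flip
        (A.symm : Coord n →L[ℝ] Coord n)).hasFDerivAt).comp v
          (hd.comp v A.symm.hasFDerivAt)).fderiv
      have h3 := DFunLike.congr_fun h2 a
      have h4 := (h3.symm.trans ha)
      by_contra hne
      have h5 := hc q (A.symm v) (A.symm a) (by simpa using hne)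
      have h6 := DFunLike.congr_fun h4 a
      exact h5.ne' h6
  have h : ContDiffOn ℝ ∞ (fun z : Coord n × (Coord n →L[ℝ] ℝ) =>
      z.2 (chartVelocity L φ z) - chartLagrangian L φ (z.1, chartVelocity L φ z))
      (φ.target ×ˢ univ) :=
    (contDiffOn_snd.clm_apply hV).sub
      (hl.comp (contDiffOn_fst.prodMk hV) fun z hz => ⟨hz.1, trivial⟩)
  exact h.congr fun z hz => chartHamiltonian_eq_sub hφ hz.1 z.2

theorem isSmoothFun_hamiltonian (hL : ContMDiff (𝓡 n).tangent 𝓘(ℝ, ℝ) ∞ L)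
    (hc : FibreConvex L) (hleg : ∀ q, Function.Surjective (legendre L q)) :
    IsSmoothFun (hamiltonian L) := by
  intro φ hφ
  rw [hamiltonian_comp_ofCoords]
  exact (contDiffOn_chartHamiltonian hL hc hleg hφ).comp
    (contDiffOn_fst.prodMk ((innerSL ℝ).contDiff.comp contDiff_snd).contDiffOn)
    fun z hz => ⟨hz.1, trivial⟩

/-- The velocity is the derivative of the Hamilton function in the momentum. -/
theorem fderiv_chartHamiltonian_apply (hL : ContMDiff (𝓡 n).tangent 𝓘(ℝ, ℝ) ∞ L)
    (hc : FibreConvex L) (hleg : ∀ q, Function.Surjective (legendre L q))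
    {φ : OpenPartialHomeomorph M (Coord n)} (hφ : φ ∈ IsManifold.maximalAtlas (𝓡 n) ∞ M)
    {x : Coord n} (hx : x ∈ φ.target) (α β : Coord n →L[ℝ] ℝ) :
    fderiv ℝ (chartHamiltonian L φ) (x, α) (0, β) = β (chartVelocity L φ (x, α)) := by
  have hd : HasFDerivAt (chartHamiltonian L φ) (fderiv ℝ (chartHamiltonian L φ) (x, α)) (x, α) :=
    (((contDiffOn_chartHamiltonian hL hc hleg hφ).contDiffAt ((φ.open_target.prod
      isOpen_univ).mem_nhds ⟨hx, trivial⟩)).differentiableAt (by norm_num)).hasFDerivAt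
  set v := chartVelocity L φ (x, α) with hv
  have h1 := (hd.comp α (hasFDerivAt_prodMk_right x α)).sub
    ((ContinuousLinearMap.apply ℝ ℝ v).hasFDerivAt (x := α))
  -- The envelope argument: for fixed v, Fenchel's inequality bounds h(x, β) - β(v) below by -l(x,
  -- v), with equality at β = α. The derivative in β therefore vanishes there, without
  -- differentiating the velocity.
  have hmin : IsLocalMin (fun β : Coord n →L[ℝ] ℝ => chartHamiltonian L φ (x, β) -
      ContinuousLinearMap.apply ℝ ℝ v β) α := by
    refine Filter.Eventually.of_forall fun β => ?_
    have h2 := le_chartHamiltonian_add hL hc hleg hφ hx v β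
    have h3 := chartHamiltonian_eq_sub (L := L) hφ hx α
    simp only [ContinuousLinearMap.apply_apply]
    rw [← hv] at h3
    linarith
  have h2 := DFunLike.congr_fun (hmin.hasFDerivAt_eq_zero h1) β
  simp only [sub_apply, ContinuousLinearMap.comp_apply, ContinuousLinearMap.inr_apply,
    ContinuousLinearMap.apply_apply, zero_apply] at h2
  linarith

end Fenchel

end CommutingActions

namespace CommutingActions

variable {n : ℕ} {M : Type*} [TopologicalSpace M] [ChartedSpace (Coord n) M]

/-! ### Paths in charts -/

section Paths

variable {q q' : M} {t : ℝ} {γ : ℝ → M}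

theorem IsPath.continuousOn (hγ : IsPath n q q' t γ) : ContinuousOn γ (Icc 0 t) :=
  hγ.contMDiffOn.continuousOn

theorem IsPath.hasMFDerivWithinAt (hγ : IsPath n q q' t γ) {s : ℝ} (hs : s ∈ Icc 0 t) :
    HasMFDerivWithinAt 𝓘(ℝ, ℝ) (𝓡 n) γ (Icc 0 t) s
      (mfderivWithin 𝓘(ℝ, ℝ) (𝓡 n) γ (Icc 0 t) s) :=
  (hγ.contMDiffOn.mdifferentiableOn (by norm_num) s hs).hasMFDerivWithinAt

theorem IsPath.continuousOn_lagrangian [IsManifold (𝓡 n) ∞ M] {L : Tan n M → ℝ}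
    (hL : ContMDiff (𝓡 n).tangent 𝓘(ℝ, ℝ) ∞ L) (hγ : IsPath n q q' t γ) (ht : 0 < t) :
    ContinuousOn (fun s => L ⟨γ s, velocity n γ t s⟩) (Icc 0 t) := by
  have : IsManifold (𝓡 n) 1 M := IsManifold.of_le (n := ∞) (by simp)
  have h1 := hγ.contMDiffOn.continuousOn_tangentMapWithin le_rfl
    (uniqueDiffOn_Icc ht).uniqueMDiffOn
  have h2 : Continuous (fun s : ℝ => (⟨s, (1 : ℝ)⟩ : TangentBundle 𝓘(ℝ, ℝ) ℝ)) :=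
    (tangentBundleModelSpaceHomeomorph 𝓘(ℝ, ℝ)).symm.continuous.comp
      (Continuous.prodMk_left (1 : ℝ))
  exact hL.continuous.comp_continuousOn (h1.comp h2.continuousOn fun s hs => hs)

theorem IsPath.hasDerivWithinAt_chart [IsManifold (𝓡 n) ∞ M] (hγ : IsPath n q q' t γ)
    {φ : OpenPartialHomeomorph M (Coord n)} (hφ : φ ∈ IsManifold.maximalAtlas (𝓡 n) ∞ M) {s : ℝ}
    (hs : s ∈ Icc 0 t) (hsφ : γ s ∈ φ.source) :
    HasDerivWithinAt (fun s => φ (γ s)) (mfderiv (𝓡 n) (𝓡 n) φ (γ s) (velocity n γ t s))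
      (Icc 0 t) s := by
  have h1 := ((mdifferentiable_of_mem_maximalAtlas hφ).mdifferentiableAt hsφ).hasMFDerivAt
  have h2 : HasFDerivWithinAt (fun s => φ (γ s)) (ContinuousLinearMap.comp (M₂ := Coord n)
      (mfderiv (𝓡 n) (𝓡 n) φ (γ s)) (mfderivWithin 𝓘(ℝ, ℝ) (𝓡 n) γ (Icc 0 t) s) : ℝ →L[ℝ] Coord n)
      (Icc 0 t) s :=
    (h1.comp_hasMFDerivWithinAt s (hγ.hasMFDerivWithinAt hs)).hasFDerivWithinAt
  exact h2.hasDerivWithinAt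

/-- The Lagrange function along a path given by a curve in a chart. -/
theorem lagrangian_velocity_eq [IsManifold (𝓡 n) ∞ M] (L : Tan n M → ℝ)
    {φ : OpenPartialHomeomorph M (Coord n)} (hφ : φ ∈ IsManifold.maximalAtlas (𝓡 n) ∞ M)
    {y : ℝ → Coord n} {y' : Coord n} {s : ℝ} (ht : 0 < t) (hs : s ∈ Icc 0 t)
    (hy : HasDerivWithinAt y y' (Icc 0 t) s) (hyφ : y s ∈ φ.target)
    (hγ : γ =ᶠ[𝓝[Icc 0 t] s] fun s => φ.symm (y s)) :
    L ⟨γ s, velocity n γ t s⟩ = chartLagrangian L φ (y s, y') := by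
  have h1 := ((mdifferentiable_of_mem_maximalAtlas hφ).mdifferentiableAt_symm hyφ).hasMFDerivAt
  have h2 := (h1.comp_hasMFDerivWithinAt s hy.hasFDerivWithinAt.hasMFDerivWithinAt)
  have h3 := h2.congr_of_eventuallyEq hγ (hγ.eq_of_nhdsWithin hs)
  have h4 := h3.mfderivWithin ((uniqueDiffOn_Icc ht).uniqueMDiffOn s hs)
  have h5 : (velocity n γ t s : Coord n) = mfderiv (𝓡 n) (𝓡 n) φ.symm (y s) y' := by
    unfold velocity
    refine (DFunLike.congr_fun h4 (1 : ℝ)).trans ?_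
    exact congrArg (mfderiv (𝓡 n) (𝓡 n) φ.symm (y s)) (one_smul ℝ y')
  have h6 : γ s = φ.symm (y s) := hγ.eq_of_nhdsWithin hs
  change fibreLagrangian L (γ s) (velocity n γ t s : Coord n) = fibreLagrangian L (φ.symm (y s)) _
  rw [h5, h6]

end Paths

end CommutingActions

namespace CommutingActions

/-! ### The Legendre condition for minimizers -/

/-- The bump ends at 3/4 rather than 1, so that a perturbed path agrees with the original one on an
overlap and the two pieces glue to a C¹ path. Its derivative is a mean zero oscillation. -/
theorem exists_bump : ∃ ψ : ℝ → ℝ, ContDiff ℝ ∞ ψ ∧ (∀ s ≤ 0, ψ s = 0) ∧ (∀ s, 3 / 4 ≤ s → ψ s = 0) ∧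
    ∃ c ∈ Icc (0 : ℝ) 1, deriv ψ c ≠ 0 := by
  let f : ContDiffBump (1 / 2 : ℝ) := ⟨1 / 8, 1 / 4, by norm_num, by norm_num⟩
  have h0 : ∀ s : ℝ, (1 / 4 : ℝ) ≤ |s - 1 / 2| → f s = 0 := fun s hs =>
    f.zero_of_le_dist (by simpa [Real.dist_eq, f] using hs)
  have hd : Differentiable ℝ (f : ℝ → ℝ) := (f.contDiff (n := 1)).differentiable (by norm_num)
  refine ⟨f, f.contDiff, fun s hs => h0 s ?_, fun s hs => h0 s ?_, ?_⟩
  · rw [abs_of_nonpos (by linarith)]; linarith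
  · rw [abs_of_nonneg (by linarith)]; linarith
  · obtain ⟨c, hc, hc'⟩ := exists_deriv_eq_slope f (show (0 : ℝ) < 1 / 2 by norm_num)
      hd.continuous.continuousOn hd.differentiableOn
    refine ⟨c, ⟨hc.1.le, by linarith [hc.2]⟩, ?_⟩
    rw [hc', h0 0 (by norm_num [abs_of_nonneg]), f.one_of_mem_closedBall (by simp [f])]
    norm_num

/-- If the averages of `m` over small multiples of a mean zero oscillation are at least `m 0`, then
the second derivative of `m` at `0` is nonnegative. -/
theorem deriv_deriv_nonneg_of_integral {m η : ℝ → ℝ} (hm : ContDiff ℝ 2 m) (hη : Continuous η)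
    (h0 : ∫ s in (0 : ℝ)..1, η s = 0) (hpos : ∃ c ∈ Icc (0 : ℝ) 1, η c ≠ 0)
    (hint : ∀ r : ℝ, 0 ≤ ∫ s in (0 : ℝ)..1, (m (r * η s) - m 0)) : 0 ≤ deriv (deriv m) 0 := by
  by_contra! hneg
  -- With this c, m(x) - m'(0)x + cx² still has a negative second derivative at 0, hence a local
  -- maximum. Averaging over rη kills the linear term and leaves a strictly negative quadratic one.
  set c := -deriv (deriv m) 0 / 4 with hc
  have hc0 : 0 < c := by simp only [hc]; linarith
  have hd1 : Differentiable ℝ m := hm.differentiable (by norm_num)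
  have hd2 : Differentiable ℝ (deriv m) :=
    ((contDiff_succ_iff_deriv (n := 1)).1 hm).2.2.differentiable (by norm_num)
  set g : ℝ → ℝ := fun x => m x - deriv m 0 * x + c * x ^ 2 with hg
  have hg' : deriv g = fun x => deriv m x - deriv m 0 + 2 * c * x := by
    ext x
    have := (((hd1 x).hasDerivAt.sub ((hasDerivAt_id x).const_mul (deriv m 0))).add
      (((hasDerivAt_id x).pow 2).const_mul c)).deriv
    refine this.trans ?_
    simp only [id, Nat.cast_ofNat]
    ring
  have hg'' : deriv (deriv g) 0 < 0 := by
    rw [hg']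
    have := (((hd2 0).hasDerivAt.sub_const (deriv m 0)).add
      ((hasDerivAt_id (0 : ℝ)).const_mul (2 * c))).deriv
    refine this.trans_lt ?_
    simp only [hc]
    linarith
  have hmax : IsLocalMax g 0 := by
    refine isLocalMax_of_deriv_deriv_neg hg'' (by simp [hg']) ?_
    exact ((hd1.continuous.sub (continuous_const.mul continuous_id)).add
      (continuous_const.mul (continuous_id.pow 2))).continuousAt
  obtain ⟨δ, hδ, hball⟩ := Metric.eventually_nhds_iff_ball.1 hmax
  obtain ⟨K, hK⟩ := (isCompact_Icc (a := (0 : ℝ)) (b := 1)).exists_bound_of_continuousOn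
    hη.continuousOn
  set r := δ / (2 * (|K| + 1)) with hr
  have hr0 : 0 < r := by positivity
  have hle : ∀ s ∈ Icc (0 : ℝ) 1, m (r * η s) - m 0 ≤ deriv m 0 * r * η s - c * r ^ 2 * η s ^ 2 := by
    intro s hs
    have hb : |r * η s| < δ := by
      rw [abs_mul, abs_of_pos hr0]
      have h1 : |η s| ≤ |K| + 1 := (hK s hs).trans ((le_abs_self K).trans (by linarith))
      calc r * |η s| ≤ r * (|K| + 1) := mul_le_mul_of_nonneg_left h1 hr0.le
        _ = δ / 2 := by simp only [hr]; field_simp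
        _ < δ := by linarith
    have := hball (r * η s) (by simpa [Real.dist_eq] using hb)
    simp only [hg] at this
    nlinarith
  have hmc : Continuous fun s => m (r * η s) - m 0 :=
    (hd1.continuous.comp (continuous_const.mul hη)).sub continuous_const
  have h1 := (hint r).trans (intervalIntegral.integral_mono_on (zero_le_one' ℝ)
    (hmc.intervalIntegrable _ _) (by apply Continuous.intervalIntegrable; fun_prop) hle)
  rw [intervalIntegral.integral_sub (by apply Continuous.intervalIntegrable; fun_prop)
    (by apply Continuous.intervalIntegrable; fun_prop), intervalIntegral.integral_const_mul,
    intervalIntegral.integral_const_mul, h0] at h1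
  have h2 : 0 < ∫ s in (0 : ℝ)..1, η s ^ 2 := by
    obtain ⟨d, hd, hd'⟩ := hpos
    exact intervalIntegral.integral_pos zero_lt_one (by fun_prop) (fun s _ => sq_nonneg _)
      ⟨d, hd, by positivity⟩
  have h3 : 0 < c * r ^ 2 * ∫ s in (0 : ℝ)..1, η s ^ 2 := by positivity
  linarith

/-- Integrals over `[0, 1]` of a continuous function that depends on a parameter are nonnegative at
the endpoint of the parameter interval if they are so inside. -/
theorem integral_nonneg_of_forall_pos {f : ℝ × ℝ → ℝ} {b : ℝ} (hb : 0 < b)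
    (hf : ContinuousOn f (Icc 0 b ×ˢ Icc 0 1))
    (h : ∀ r ∈ Ioc 0 b, 0 ≤ ∫ s in (0 : ℝ)..1, f (r, s)) : 0 ≤ ∫ s in (0 : ℝ)..1, f (0, s) := by
  -- Clamping both variables extends f continuously to the plane, where parameter integrals are
  -- continuous.
  have hc : Continuous (Function.uncurry fun r s : ℝ => f (max 0 (min r b), max 0 (min s 1))) := by
    refine hf.comp_continuous (f := fun p : ℝ × ℝ => (max 0 (min p.1 b), max 0 (min p.2 1)))
      (by fun_prop) fun p => ⟨⟨le_max_left _ _, max_le hb.le (min_le_right _ _)⟩,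
        ⟨le_max_left _ _, max_le zero_le_one (min_le_right _ _)⟩⟩
  have hI := intervalIntegral.continuous_parametric_intervalIntegral_of_continuous'
    (μ := MeasureTheory.volume) hc 0 1
  have heq : ∀ r ∈ Icc 0 b, ∫ s in (0 : ℝ)..1, f (max 0 (min r b), max 0 (min s 1)) =
      ∫ s in (0 : ℝ)..1, f (r, s) := by
    intro r hr
    refine intervalIntegral.integral_congr fun s hs => ?_
    rw [uIcc_of_le zero_le_one] at hs
    simp only [min_eq_left hr.2, max_eq_right hr.1, min_eq_left hs.2, max_eq_right hs.1]
  rw [← heq 0 ⟨le_rfl, hb.le⟩]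
  refine ge_of_tendsto (hI.continuousAt.tendsto.mono_left
    (nhdsWithin_le_nhds (s := Ioi (0 : ℝ)))) ?_
  filter_upwards [Ioc_mem_nhdsGT hb] with r hr
  rw [heq r ⟨hr.1.le, hr.2⟩]
  exact h r hr

end CommutingActions

/-! ### Oscillating perturbations of a minimizer. -/

namespace CommutingActions

variable {n : ℕ} {M : Type*} [TopologicalSpace M] [ChartedSpace (Coord n) M]
  [IsManifold (𝓡 n) ∞ M] {L : Tan n M → ℝ} {q q' : M} {t : ℝ} {γ : ℝ → M}

/-- Modifying a minimizer by an oscillation in a chart during a short initial time interval does not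
decrease the action. -/
theorem IsMinimizer.integral_oscillation_nonneg (hL : ContMDiff (𝓡 n).tangent 𝓘(ℝ, ℝ) ∞ L)
    (hγ : IsMinimizer L q q' t γ) {φ : OpenPartialHomeomorph M (Coord n)}
    (hφ : φ ∈ IsManifold.maximalAtlas (𝓡 n) ∞ M) {τ₀ τ : ℝ} (hτ : 0 < τ) (hττ₀ : τ < τ₀)
    (hτt : τ₀ < t) (hsrc : ∀ s ∈ Icc 0 τ₀, γ s ∈ φ.source) {y : ℝ → Coord n}
    (hy : y = fun s => φ (γ s)) (hyc : ContDiffOn ℝ 1 y (Icc 0 τ₀)) {ψ : ℝ → ℝ}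
    (hψ : ContDiff ℝ ∞ ψ) (hψ0 : ∀ s ≤ 0, ψ s = 0) (hψ1 : ∀ s, 3 / 4 ≤ s → ψ s = 0) (e : Coord n)
    (htgt : ∀ s ∈ Icc 0 τ₀, y s + (τ * ψ (s / τ)) • e ∈ φ.target) :
    0 ≤ ∫ σ in (0 : ℝ)..1, (chartLagrangian L φ (y (τ * σ) + (τ * ψ σ) • e,
        derivWithin y (Icc 0 τ₀) (τ * σ) + deriv ψ σ • e) -
      chartLagrangian L φ (y (τ * σ), derivWithin y (Icc 0 τ₀) (τ * σ))) := by
  have ht : 0 < t := by linarith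
  have hτ₀ : 0 < τ₀ := by linarith
  set Y : ℝ → Coord n := fun s => y s + (τ * ψ (s / τ)) • e with hY
  -- The displacement has size τ while the velocity changes by ψ'(s/τ)e, which does not shrink with
  -- τ. Both formulas for the path are valid on [3τ/4, τ].
  set γτ : ℝ → M := fun s => if s < τ then φ.symm (Y s) else γ s with hγτ
  have hsub : Icc 0 τ₀ ⊆ Icc 0 t := Icc_subset_Icc_right hτt.le
  have hYy : ∀ s, 3 / 4 * τ ≤ s → Y s = y s := by
    intro s hs
    have : ψ (s / τ) = 0 := hψ1 _ (by rwa [le_div_iff₀ hτ])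
    simp [hY, this]
  have hin : ∀ s ∈ Icc 0 τ₀, φ.symm (y s) = γ s := fun s hs => by
    rw [hy]; exact φ.left_inv (hsrc s hs)
  have hytgt : ∀ s ∈ Icc 0 τ₀, y s ∈ φ.target := fun s hs => by
    rw [hy]; exact φ.map_source (hsrc s hs)
  have h1 : ∀ s ∈ Icc 0 τ₀, γτ s = φ.symm (Y s) := by
    intro s hs
    by_cases h : s < τ
    · simp [hγτ, h]
    · simp only [hγτ, h, if_false]
      rw [hYy s (by linarith [not_lt.1 h]), hin s hs]
  have h2 : ∀ s ∈ Icc 0 t, 3 / 4 * τ ≤ s → γτ s = γ s := by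
    intro s hs hs'
    by_cases h : s < τ
    · rw [h1 s ⟨hs.1, by linarith⟩, hYy s hs', hin s ⟨hs.1, by linarith⟩]
    · simp [hγτ, h]
  have hnhds : ∀ s < τ₀, ∀ {P : ℝ → Prop}, (∀ r ∈ Icc 0 τ₀, P r) → ∀ᶠ r in 𝓝[Icc 0 t] s, P r := by
    intro s hs P hP
    filter_upwards [self_mem_nhdsWithin, mem_nhdsWithin_of_mem_nhds (Iio_mem_nhds hs)] with r hr hr'
    exact hP r ⟨hr.1, le_of_lt hr'⟩
  have hev1 : ∀ s < τ₀, γτ =ᶠ[𝓝[Icc 0 t] s] fun s => φ.symm (Y s) := fun s hs => hnhds s hs h1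
  have hev0 : ∀ s < τ₀, γ =ᶠ[𝓝[Icc 0 t] s] fun s => φ.symm (y s) := fun s hs =>
    hnhds s hs fun r hr => (hin r hr).symm
  have hev2 : ∀ s, 3 / 4 * τ < s → γτ =ᶠ[𝓝[Icc 0 t] s] γ := by
    intro s hs
    filter_upwards [self_mem_nhdsWithin, mem_nhdsWithin_of_mem_nhds (Ioi_mem_nhds hs)] with r hr hr'
    exact h2 r hr (le_of_lt hr')
  have hbc : ContDiff ℝ ∞ fun s => (τ * ψ (s / τ)) • e :=
    (contDiff_const.mul (hψ.comp (contDiff_id.div_const τ))).smul contDiff_const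
  have hYc : ContDiffOn ℝ 1 Y (Icc 0 τ₀) := hyc.add (hbc.of_le (by simp)).contDiffOn
  have hpath : IsPath n q q' t γτ := by
    refine ⟨fun s hs => ?_, ?_, ?_⟩
    · by_cases h : s < τ₀
      · have hmem : Icc 0 τ₀ ∈ 𝓝[Icc 0 t] s := hnhds s h fun r hr => hr
        have hYs : ContMDiffWithinAt 𝓘(ℝ, ℝ) 𝓘(ℝ, Coord n) 1 Y (Icc 0 t) s :=
          ((hYc s ⟨hs.1, h.le⟩).mono_of_mem_nhdsWithin hmem).contMDiffWithinAt
        have hsym : ContMDiffAt (𝓡 n) (𝓡 n) 1 φ.symm (Y s) :=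
          ((contMDiffOn_symm_of_mem_maximalAtlas hφ).contMDiffAt
            (φ.open_target.mem_nhds (htgt s ⟨hs.1, h.le⟩))).of_le (by simp)
        exact (hsym.comp_contMDiffWithinAt s hYs).congr_of_eventuallyEq (hev1 s h)
          (h1 s ⟨hs.1, h.le⟩)
      · have hs' : 3 / 4 * τ < s := by linarith [not_lt.1 h]
        exact (hγ.1.contMDiffOn s hs).congr_of_eventuallyEq (hev2 s hs') (h2 s hs hs'.le)
    · rw [h1 0 ⟨le_rfl, hτ₀.le⟩, ← hγ.1.source, ← hin 0 ⟨le_rfl, hτ₀.le⟩]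
      simp [hY, hψ0]
    · rw [h2 t ⟨ht.le, le_rfl⟩ (by linarith), hγ.1.target]
  have hF := hγ.1.continuousOn_lagrangian hL ht
  have hFτ := hpath.continuousOn_lagrangian hL ht
  have hle := hγ.2 γτ hpath
  set D : ℝ → ℝ := fun s => L ⟨γτ s, velocity n γτ t s⟩ - L ⟨γ s, velocity n γ t s⟩ with hD
  have hDc : ContinuousOn D (Icc 0 t) := hFτ.sub hF
  have hDint : 0 ≤ ∫ s in (0 : ℝ)..t, D s := by
    rw [hD, intervalIntegral.integral_sub (hFτ.intervalIntegrable_of_Icc ht.le)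
      (hF.intervalIntegrable_of_Icc ht.le)]
    exact sub_nonneg.2 hle
  have hD0 : ∫ s in τ..t, D s = 0 := by
    rw [intervalIntegral.integral_congr (g := fun _ => (0 : ℝ)), intervalIntegral.integral_zero]
    intro s hs
    rw [uIcc_of_le (by linarith)] at hs
    have hs' : 3 / 4 * τ < s := by linarith [hs.1]
    have hsI : s ∈ Icc 0 t := ⟨by linarith [hs.1], hs.2⟩
    have e1 : γτ s = γ s := h2 s hsI hs'.le
    have e2 : (velocity n γτ t s : Coord n) = velocity n γ t s := by
      unfold velocity
      exact DFunLike.congr_fun ((hev2 s hs').mfderivWithin_eq e1) (1 : ℝ)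
    have e3 : fibreLagrangian L (γτ s) (velocity n γτ t s) =
      fibreLagrangian L (γ s) (velocity n γ t s) := by rw [e1, e2]
    exact sub_eq_zero.2 e3
  set f : ℝ → ℝ := fun σ => chartLagrangian L φ (y (τ * σ) + (τ * ψ σ) • e,
        derivWithin y (Icc 0 τ₀) (τ * σ) + deriv ψ σ • e) -
      chartLagrangian L φ (y (τ * σ), derivWithin y (Icc 0 τ₀) (τ * σ)) with hf
  have hD1 : ∫ s in (0 : ℝ)..τ, D s = ∫ s in (0 : ℝ)..τ, f (s / τ) := by
    refine intervalIntegral.integral_congr fun s hs => ?_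
    rw [uIcc_of_le hτ.le] at hs
    have hs0 : s < τ₀ := by linarith [hs.2]
    have hsI : s ∈ Icc 0 τ₀ := ⟨hs.1, hs0.le⟩
    have hyd : HasDerivWithinAt y (derivWithin y (Icc 0 τ₀) s) (Icc 0 t) s :=
      ((hyc.differentiableOn (by norm_num) s hsI).hasDerivWithinAt).mono_of_mem_nhdsWithin
        (hnhds s hs0 fun r hr => hr)
    have hbd : HasDerivAt (fun s => (τ * ψ (s / τ)) • e) (deriv ψ (s / τ) • e) s := by
      have h3 := (((hψ.differentiable (by norm_num) (s / τ)).hasDerivAt.comp s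
        ((hasDerivAt_id s).div_const τ)).const_mul τ).smul_const e
      refine h3.congr_deriv ?_
      congr 1
      field_simp
    have hYd := hyd.add hbd.hasDerivWithinAt
    have e1 := lagrangian_velocity_eq L hφ ht (hsub hsI) hYd (htgt s hsI) (hev1 s hs0)
    have e0 := lagrangian_velocity_eq L hφ ht (hsub hsI) hyd (hytgt s hsI) (hev0 s hs0)
    have e2 : τ * (s / τ) = s := by field_simp
    simp only [hD, hf, e2]
    rw [e1, e0]
    rfl
  have hsplit := intervalIntegral.integral_add_adjacent_intervals
    ((hDc.mono (Icc_subset_Icc_right (by linarith))).intervalIntegrable_of_Icc (a := 0) (b := τ) hτ.le)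
    ((hDc.mono (Icc_subset_Icc_left hτ.le)).intervalIntegrable_of_Icc (a := τ) (b := t)
      (by linarith))
    (μ := MeasureTheory.volume)
  rw [← hsplit, hD0, add_zero, hD1, intervalIntegral.integral_comp_div _ hτ.ne', zero_div,
    div_self hτ.ne', smul_eq_mul] at hDint
  exact nonneg_of_mul_nonneg_right hDint hτ

/-- Restriction to the line v + ra, with the oscillation vector e = ra, reduces to one variable. -/
theorem hessian_nonneg_of_integral {E : Type*} [NormedAddCommGroup E] [NormedSpace ℝ E] {f : E → ℝ}
    (hf : ContDiff ℝ ∞ f) {η : ℝ → ℝ} (hη : Continuous η) (h0 : ∫ s in (0 : ℝ)..1, η s = 0)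
    (hpos : ∃ c ∈ Icc (0 : ℝ) 1, η c ≠ 0) {v : E}
    (h : ∀ e, 0 ≤ ∫ σ in (0 : ℝ)..1, (f (v + η σ • e) - f v)) (a : E) :
    0 ≤ fderiv ℝ (fderiv ℝ f) v a a := by
  have hline : ∀ r : ℝ, HasDerivAt (fun r : ℝ => v + r • a) a r := fun r => by
    simpa using ((hasDerivAt_id r).smul_const a).const_add v
  have hmc : ContDiff ℝ 2 fun r : ℝ => f (v + r • a) :=
    (hf.of_le two_le_infty).comp (contDiff_const.add (contDiff_id.smul contDiff_const))
  have hm' : deriv (fun r : ℝ => f (v + r • a)) = fun r => fderiv ℝ f (v + r • a) a := by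
    ext r
    exact ((hf.differentiable (by norm_num) _).hasFDerivAt.comp_hasDerivAt r (hline r)).deriv
  have hm'' : deriv (deriv fun r : ℝ => f (v + r • a)) 0 = fderiv ℝ (fderiv ℝ f) v a a := by
    have hd2 : Differentiable ℝ (fderiv ℝ f) :=
      (hf.fderiv_right (m := ∞) (by norm_num)).differentiable (by norm_num)
    have h1 : HasDerivAt (fun r : ℝ => fderiv ℝ f (v + r • a))
        (fderiv ℝ (fderiv ℝ f) (v + (0 : ℝ) • a) a) 0 :=
      (hd2 _).hasFDerivAt.comp_hasDerivAt 0 (hline 0)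
    have h2 := (h1.clm_apply (hasDerivAt_const (0 : ℝ) a)).deriv
    rw [hm']
    simpa using h2
  rw [← hm'']
  refine deriv_deriv_nonneg_of_integral hmc hη h0 hpos fun r => ?_
  have h1 := h (r • a)
  simpa [mul_comm r, mul_smul] using h1

/-- At the initial velocity of a minimizer, oscillations of the velocity do not decrease the mean
of the Lagrange function. -/
theorem IsMinimizer.exists_integral_nonneg (hL : ContMDiff (𝓡 n).tangent 𝓘(ℝ, ℝ) ∞ L) (ht : 0 < t)
    (hγ : IsMinimizer L q q' t γ) {ψ : ℝ → ℝ}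
    (hψ : ContDiff ℝ ∞ ψ) (hψ0 : ∀ s ≤ 0, ψ s = 0) (hψ1 : ∀ s, 3 / 4 ≤ s → ψ s = 0) :
    ∃ v, ∀ e, 0 ≤ ∫ σ in (0 : ℝ)..1,
      (fibreLagrangian L q (v + deriv ψ σ • e) - fibreLagrangian L q v) := by
  have hφ := IsManifold.chart_mem_maximalAtlas (I := 𝓡 n) (n := ∞) q
  have hq := mem_chart_source (Coord n) q
  set φ := chartAt (Coord n) q
  obtain ⟨A, hA, hA'⟩ := exists_equiv_mfderiv hφ hq
  have hγ0 : γ 0 = q := hγ.1.source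
  set y : ℝ → Coord n := fun s => φ (γ s) with hy
  obtain ⟨ρ, hρ, hρt⟩ := Metric.isOpen_iff.1 φ.open_target (φ q) (φ.map_source hq)
  have hcont : ContinuousWithinAt γ (Icc 0 t) 0 := hγ.1.continuousOn 0 ⟨le_rfl, ht.le⟩
  have hnear : ∀ᶠ s in 𝓝[Icc 0 t] 0, γ s ∈ φ.source ∧ y s ∈ Metric.ball (φ q) (ρ / 2) := by
    have h1 : ∀ᶠ x in 𝓝 q, x ∈ φ.source ∧ φ x ∈ Metric.ball (φ q) (ρ / 2) :=
      (φ.open_source.eventually_mem hq).and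
        ((φ.continuousAt hq).eventually (Metric.ball_mem_nhds _ (by linarith)))
    rw [← hγ0] at h1
    have := hcont.eventually h1
    rw [hγ0] at this
    exact this
  obtain ⟨δ, hδ, hδn⟩ := Metric.eventually_nhds_iff_ball.1 (eventually_nhdsWithin_iff.1 hnear)
  set τ₀ := min δ t / 2 with hτ₀def
  have hmin : 0 < min δ t := lt_min hδ ht
  have hτ₀ : 0 < τ₀ := by positivity
  have hτ₀δ : τ₀ < δ := by have := min_le_left δ t; linarith
  have hτ₀t : τ₀ < t := by have := min_le_right δ t; linarith
  have hnear' : ∀ s ∈ Icc 0 τ₀, γ s ∈ φ.source ∧ y s ∈ Metric.ball (φ q) (ρ / 2) := fun s hs =>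
    hδn s (by rw [Real.ball_eq_Ioo]; constructor <;> linarith [hs.1, hs.2])
      ⟨hs.1, hs.2.trans hτ₀t.le⟩
  have hyc : ContDiffOn ℝ 1 y (Icc 0 τ₀) := by
    rw [← contMDiffOn_iff_contDiffOn]
    exact ((contMDiffOn_of_mem_maximalAtlas hφ).of_le (by simp)).comp
      (hγ.1.contMDiffOn.mono (Icc_subset_Icc_right hτ₀t.le)) fun s hs => (hnear' s hs).1
  have hy1c : ContinuousOn (derivWithin y (Icc 0 τ₀)) (Icc 0 τ₀) :=
    hyc.continuousOn_derivWithin (uniqueDiffOn_Icc hτ₀) le_rfl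
  obtain ⟨K, hK⟩ := (isCompact_Icc (a := (0 : ℝ)) (b := 1)).exists_bound_of_continuousOn
    hψ.continuous.continuousOn
  have hK' : ∀ s, |ψ s| ≤ |K| := by
    intro s
    rcases le_or_gt s 0 with h | h
    · simp [hψ0 s h]
    · rcases le_or_gt s 1 with h' | h'
      · exact (hK s ⟨h.le, h'⟩).trans (le_abs_self K)
      · simp [hψ1 s (by linarith)]
  have hl := contDiffOn_chartLagrangian hL hφ
  set v₀ : Coord n := derivWithin y (Icc 0 τ₀) 0 with hv₀
  have hosc : ∀ e : Coord n, 0 ≤ ∫ σ in (0 : ℝ)..1, (chartLagrangian L φ (φ q, v₀ + deriv ψ σ • e) -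
      chartLagrangian L φ (φ q, v₀)) := by
    intro e
    -- The second bound keeps the displacement below ρ/2; the unperturbed curve stays within ρ/2 of
    -- the centre, so the sum remains in the chart.
    set b := min (τ₀ / 2) (ρ / (2 * (|K| * ‖e‖ + 1))) with hb
    have hb0 : 0 < b := lt_min (by positivity) (by positivity)
    have hbτ : b < τ₀ := (min_le_left _ _).trans_lt (by linarith)
    have htgt : ∀ r ∈ Icc 0 b, ∀ s ∈ Icc 0 τ₀, ∀ σ, y s + (r * ψ σ) • e ∈ φ.target := by
      intro r hr s hs σ
      apply hρt
      have h1 := (hnear' s hs).2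
      rw [mem_ball_iff_norm] at h1 ⊢
      have h2 : ‖(r * ψ σ) • e‖ ≤ ρ / 2 := by
        rw [norm_smul, Real.norm_eq_abs, abs_mul, abs_of_nonneg hr.1]
        have h3 : r ≤ ρ / (2 * (|K| * ‖e‖ + 1)) := hr.2.trans (min_le_right _ _)
        calc r * |ψ σ| * ‖e‖ ≤ r * |K| * ‖e‖ := by
              exact mul_le_mul_of_nonneg_right (mul_le_mul_of_nonneg_left (hK' σ) hr.1)
                (norm_nonneg e)
          _ = r * (|K| * ‖e‖) := by ring
          _ ≤ ρ / (2 * (|K| * ‖e‖ + 1)) * (|K| * ‖e‖ + 1) := by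
              gcongr
              linarith
          _ = ρ / 2 := by field_simp
      calc ‖y s + (r * ψ σ) • e - φ q‖ = ‖(y s - φ q) + (r * ψ σ) • e‖ := by congr 1; abel
        _ ≤ ‖y s - φ q‖ + ‖(r * ψ σ) • e‖ := norm_add_le _ _
        _ < ρ := by linarith
    have hmaps : MapsTo (fun p : ℝ × ℝ => p.1 * p.2) (Icc 0 b ×ˢ Icc 0 1) (Icc 0 τ₀) := by
      rintro ⟨r, σ⟩ ⟨hr, hσ⟩
      exact ⟨mul_nonneg hr.1 hσ.1, (mul_le_of_le_one_right hr.1 hσ.2).trans (hr.2.trans hbτ.le)⟩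
    have hmul : ContinuousOn (fun p : ℝ × ℝ => p.1 * p.2) (Icc 0 b ×ˢ Icc 0 1) :=
      (continuous_fst.mul continuous_snd).continuousOn
    have hyp := hyc.continuousOn.comp hmul hmaps
    have hy1p := hy1c.comp hmul hmaps
    have hdψ : Continuous (deriv ψ) := hψ.continuous_deriv (by simp)
    have hψc := hψ.continuous
    -- As r → 0 the position freezes at q and the base velocity at v₀, while the oscillation ψ'(σ)e
    -- survives. Only continuity of the velocity of the minimizer is used.
    have key := integral_nonneg_of_forall_pos (b := b) (f := fun p =>
        chartLagrangian L φ (y (p.1 * p.2) + (p.1 * ψ p.2) • e,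
          derivWithin y (Icc 0 τ₀) (p.1 * p.2) + deriv ψ p.2 • e) -
        chartLagrangian L φ (y (p.1 * p.2), derivWithin y (Icc 0 τ₀) (p.1 * p.2))) hb0
      (by
        refine (hl.continuousOn.comp (ContinuousOn.prodMk (hyp.add ?_) (hy1p.add ?_)) ?_).sub
          (hl.continuousOn.comp (hyp.prodMk hy1p) ?_)
        · exact Continuous.continuousOn (by fun_prop)
        · exact Continuous.continuousOn (by fun_prop)
        · exact fun p hp => ⟨htgt p.1 hp.1 _ (hmaps hp) _, trivial⟩
        · exact fun p hp => ⟨φ.map_source (hnear' _ (hmaps hp)).1, trivial⟩)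
      (fun r hr => hγ.integral_oscillation_nonneg hL hφ hr.1 (hr.2.trans_lt hbτ) hτ₀t
        (fun s hs => (hnear' s hs).1) hy hyc hψ hψ0 hψ1 e
        fun s hs => htgt r ⟨hr.1.le, hr.2⟩ s hs _)
    simpa [hy, hγ0, ← hv₀] using key
  refine ⟨A.symm v₀, fun e => ?_⟩
  have hfib : ∀ w, chartLagrangian L φ (φ q, w) = fibreLagrangian L q (A.symm w) := fun w =>
    (chartLagrangian_eq L hq w).trans
      (congrArg (fibreLagrangian L q) (DFunLike.congr_fun hA' w).symm)
  have h1 := hosc (A e)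
  simpa only [hfib, map_add, map_smul, A.symm_apply_apply] using h1

/-- The Legendre condition at the initial point of a minimizer. -/
theorem IsMinimizer.exists_hessian_nonneg (hL : ContMDiff (𝓡 n).tangent 𝓘(ℝ, ℝ) ∞ L) (ht : 0 < t)
    (hγ : IsMinimizer L q q' t γ) :
    ∃ v, ∀ a, 0 ≤ fderiv ℝ (fderiv ℝ (fibreLagrangian L q)) v a a := by
  obtain ⟨ψ, hψ, hψ0, hψ1, hψd⟩ := exists_bump
  obtain ⟨v, hv⟩ := hγ.exists_integral_nonneg hL ht hψ hψ0 hψ1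
  have hd : Continuous (deriv ψ) := hψ.continuous_deriv (by simp)
  refine ⟨v, hessian_nonneg_of_integral (contDiff_fibreLagrangian hL q) hd ?_ hψd hv⟩
  rw [intervalIntegral.integral_deriv_eq_sub (fun s _ => hψ.differentiable (by norm_num) s)
    (hd.intervalIntegrable _ _), hψ0 0 le_rfl, hψ1 1 (by norm_num), sub_zero]

/-- For each q, a single minimizing loop from q to q already supplies a velocity at which the
Legendre condition holds. -/
theorem fibreConvex_of_hasMinimizers (hL : ContMDiff (𝓡 n).tangent 𝓘(ℝ, ℝ) ∞ L)
    (hnd : Nondegenerate L) (hmin : HasMinimizers L) : FibreConvex L := by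
  refine fibreConvex_of_exists hL hnd fun q => ?_
  obtain ⟨U, hU, ε, hε, h⟩ := hmin
  obtain ⟨γ, hγ⟩ := h q q (subset_of_mem_nhdsSet hU rfl) (ε / 2) ⟨by linarith, by linarith⟩
  exact hγ.exists_hessian_nonneg hL (by linarith)

end CommutingActions

namespace CommutingActions

variable {n : ℕ} {M : Type*} [TopologicalSpace M] [ChartedSpace (Coord n) M]
  {L L₁ L₂ : Tan n M → ℝ}

/-! ### Paths and principal actions -/

/-- A path that leaves a coordinate ball has a last exit point, which lies on the sphere. -/
theorem IsPath.exists_last_exit [T2Space M] {q q' : M} {t : ℝ} {γ : ℝ → M}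
    (hγ : IsPath n q q' t γ)
    {φ : OpenPartialHomeomorph M (Coord n)} {x₀ : Coord n} {r : ℝ}
    (hr : Metric.closedBall x₀ r ⊆ φ.target) (hq' : q' ∈ φ.source) (hq'r : φ q' ∈ Metric.ball x₀ r) :
    (∀ s ∈ Icc 0 t, γ s ∈ φ.source ∧ φ (γ s) ∈ Metric.ball x₀ r) ∨
    ∃ τ ∈ Icc 0 t, (γ τ ∈ φ.source ∧ φ (γ τ) ∈ Metric.sphere x₀ r) ∧
      ∀ s ∈ Icc τ t, γ s ∈ φ.source ∧ φ (γ s) ∈ Metric.closedBall x₀ r := by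
  set N : Set M := φ.source ∩ φ ⁻¹' Metric.ball x₀ r with hN
  have hNo : IsOpen N := φ.isOpen_inter_preimage Metric.isOpen_ball
  by_cases hall : ∀ s ∈ Icc 0 t, γ s ∈ N
  · exact Or.inl hall
  right
  push Not at hall
  set S : Set ℝ := Icc 0 t ∩ γ ⁻¹' Nᶜ with hS
  have hSc : IsCompact S :=
    isCompact_Icc.of_isClosed_subset (hγ.continuousOn.preimage_isClosed_of_isClosed isClosed_Icc
      hNo.isClosed_compl) inter_subset_left
  have hSne : S.Nonempty := by
    obtain ⟨s, hs, hs'⟩ := hall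
    exact ⟨s, hs, hs'⟩
  have hτS := hSc.sSup_mem hSne
  set τ := sSup S with hτ
  have hτt : τ < t := by
    refine lt_of_le_of_ne hτS.1.2 fun h => hτS.2 ?_
    rw [h, hγ.target]
    exact ⟨hq', hq'r⟩
  have hafter : ∀ s ∈ Ioc τ t, γ s ∈ N := by
    intro s hs
    by_contra hsN
    exact absurd (le_csSup hSc.bddAbove (⟨⟨hτS.1.1.trans hs.1.le, hs.2⟩, hsN⟩ : s ∈ S))
      (not_le.2 hs.1)
  -- The exit point must be shown to lie in the chart domain. It is a limit of points in the image
  -- of the closed ball, and this image is compact, hence closed in the Hausdorff space M.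
  have hK : IsCompact (φ.symm '' Metric.closedBall x₀ r) :=
    (isCompact_closedBall x₀ r).image_of_continuousOn (φ.continuousOn_symm.mono hr)
  have hτK : γ τ ∈ φ.symm '' Metric.closedBall x₀ r := by
    have hcont : Filter.Tendsto γ (𝓝[Ioc τ t] τ) (𝓝 (γ τ)) :=
      (hγ.continuousOn τ hτS.1).mono fun s hs => ⟨hτS.1.1.trans hs.1.le, hs.2⟩
    have hne : (𝓝[Ioc τ t] τ).NeBot := by
      rw [nhdsWithin_Ioc_eq_nhdsGT hτt]
      infer_instance
    refine hK.isClosed.mem_of_tendsto hcont ?_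
    filter_upwards [self_mem_nhdsWithin] with s hs
    have h := hafter s hs
    exact ⟨φ (γ s), Metric.ball_subset_closedBall h.2, φ.left_inv h.1⟩
  obtain ⟨x, hx, hxτ⟩ := hτK
  have hτsrc : γ τ ∈ φ.source := hxτ ▸ φ.map_target (hr hx)
  have hφτ : φ (γ τ) = x := by rw [← hxτ, φ.right_inv (hr hx)]
  have hsph : φ (γ τ) ∈ Metric.sphere x₀ r := by
    refine le_antisymm ?_ (not_lt.1 fun h => hτS.2 ⟨hτsrc, h⟩)
    rw [hφτ]
    exact hx
  refine ⟨τ, hτS.1, ⟨hτsrc, hsph⟩, fun s hs => ?_⟩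
  rcases eq_or_lt_of_le hs.1 with rfl | h
  · exact ⟨hτsrc, Metric.sphere_subset_closedBall hsph⟩
  · exact ⟨(hafter s ⟨h, hs.2⟩).1, Metric.ball_subset_closedBall (hafter s ⟨h, hs.2⟩).2⟩

theorem isPath_segment {φ : OpenPartialHomeomorph M (Coord n)}
    (hφ : φ ∈ IsManifold.maximalAtlas (𝓡 n) ∞ M) {c v : Coord n} {t : ℝ}
    (hc : ∀ s ∈ Icc 0 t, c + s • v ∈ φ.target) :
    IsPath n (φ.symm c) (φ.symm (c + t • v)) t fun s => φ.symm (c + s • v) := by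
  refine ⟨?_, by simp, rfl⟩
  refine ((contMDiffOn_symm_of_mem_maximalAtlas hφ).of_le (by simp)).comp
    (ContDiff.contMDiff ?_).contMDiffOn hc
  exact contDiff_const.add (contDiff_id.smul contDiff_const)

theorem principalAction_le {q q' : M} {t : ℝ} {γ : ℝ → M} (hγ : IsPath n q q' t γ) :
    principalAction L q q' t ≤ (action L t γ : EReal) :=
  iInf₂_le γ hγ

theorem composedAction_le {q q₁ q' : M} {t₁ t₂ : ℝ} {γ₁ γ₂ : ℝ → M} (hγ₁ : IsPath n q q₁ t₁ γ₁)
    (hγ₂ : IsPath n q₁ q' t₂ γ₂) :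
    composedAction L₁ L₂ q q' t₁ t₂ ≤ ((action L₁ t₁ γ₁ + action L₂ t₂ γ₂ : ℝ) : EReal) := by
  rw [EReal.coe_add]
  exact (iInf_le _ q₁).trans (add_le_add (principalAction_le hγ₁) (principalAction_le hγ₂))

variable [IsManifold (𝓡 n) ∞ M]

/-! ### Lower bounds for the action -/

/-- On a compact manifold the Lagrange function is bounded from below. -/
theorem exists_le_lagrangian [CompactSpace M] (hL : ContMDiff (𝓡 n).tangent 𝓘(ℝ, ℝ) ∞ L)
    (hc : FibreConvex L) (hleg : ∀ q, Function.Surjective (legendre L q)) :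
    ∃ C, 0 ≤ C ∧ ∀ z, -C ≤ L z := by
  -- Fenchel's inequality with p = 0 gives L ≥ -H(q, 0), so it is enough to bound H on the zero
  -- section of T*M, a continuous function on compact M.
  have hcont : Continuous fun q : M => hamiltonian L ⟨q, (0 : Coord n →L[ℝ] ℝ)⟩ := by
    rw [continuous_iff_continuousAt]
    intro q
    have hφ := IsManifold.chart_mem_maximalAtlas (I := 𝓡 n) (n := ∞) q
    have hq := mem_chart_source (Coord n) q
    set φ := chartAt (Coord n) q
    have h1 : ContinuousAt (fun q' => chartHamiltonian L φ (φ q', 0)) q :=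
      ((contDiffOn_chartHamiltonian hL hc hleg hφ).continuousOn.continuousAt
        ((φ.open_target.prod isOpen_univ).mem_nhds (x := (φ q, 0))
          ⟨φ.map_source hq, trivial⟩)).comp (f := fun q' => (φ q', (0 : Coord n →L[ℝ] ℝ)))
        ((φ.continuousAt hq).prodMk continuousAt_const)
    refine h1.congr ?_
    filter_upwards [φ.open_source.mem_nhds hq] with q' hq'
    rw [chartHamiltonian_eq L hq']
    exact congrArg (fun p => hamiltonian L ⟨q', p⟩) (ContinuousLinearMap.zero_comp _)
  obtain ⟨C, hC⟩ := isCompact_univ.exists_bound_of_continuousOn hcont.continuousOn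
  refine ⟨|C|, abs_nonneg C, fun z => ?_⟩
  have h1 := le_hamiltonian_add hL hc hleg z.1 (0 : Coord n →L[ℝ] ℝ) z.2
  have h2 := (abs_le.1 (hC z.1 trivial)).2
  have h3 := le_abs_self C
  have h4 : ((0 : Coord n →L[ℝ] ℝ) z.2) = 0 := rfl
  rw [h4] at h1
  change -|C| ≤ L ⟨z.1, z.2⟩
  linarith

theorem le_integral_lagrangian (hL : ContMDiff (𝓡 n).tangent 𝓘(ℝ, ℝ) ∞ L) {C : ℝ}
    (hC : ∀ z, -C ≤ L z) {q q' : M} {t : ℝ} {γ : ℝ → M} (hγ : IsPath n q q' t γ) (ht : 0 < t)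
    {τ : ℝ} (hτ : τ ∈ Icc 0 t) : -C * τ ≤ ∫ s in (0 : ℝ)..τ, L ⟨γ s, velocity n γ t s⟩ := by
  have h1 := intervalIntegral.integral_mono_on (f := fun _ => -C) hτ.1 (by simp)
    (((hγ.continuousOn_lagrangian hL ht).mono
      (Icc_subset_Icc_right hτ.2)).intervalIntegrable_of_Icc hτ.1 (μ := MeasureTheory.volume))
    (fun s _ => hC _)
  rw [intervalIntegral.integral_const, smul_eq_mul, sub_zero] at h1
  linarith

/-- Approximate solutions of the Hamilton–Jacobi equation in a coordinate ball bound the action from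
below, for paths that stay in the ball and for paths that leave it. -/
theorem eventually_hjEnd_le_action [CompactSpace M] [T2Space M]
    (hL : ContMDiff (𝓡 n).tangent 𝓘(ℝ, ℝ) ∞ L)
    (hc : FibreConvex L) (hleg : ∀ q, Function.Surjective (legendre L q))
    {φ : OpenPartialHomeomorph M (Coord n)} (hφ : φ ∈ IsManifold.maximalAtlas (𝓡 n) ∞ M)
    {G : ℝ × Coord n → ℝ} (hG : ContDiffOn ℝ ∞ G (univ ×ˢ φ.target)) {x₀ : Coord n} {r m : ℝ}
    (hr : Metric.closedBall x₀ r ⊆ φ.target) (hm : ∀ x ∈ Metric.sphere x₀ r, G (0, x) ≤ m) :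
    ∃ C, ∀ᶠ ε in 𝓝[>] (0 : ℝ), ∀ (q q' : M) (γ : ℝ → M), IsPath n q q' ε γ → q' ∈ φ.source →
      φ q' ∈ Metric.ball x₀ r →
      (q ∈ φ.source ∧ φ q ∈ Metric.ball x₀ r ∧ hjEnd (chartHamiltonian L φ) G (ε, φ q') ≤
        G (ε, φ q) + action L ε γ + C * ε ^ 3) ∨
      hjEnd (chartHamiltonian L φ) G (ε, φ q') ≤ m + 1 + action L ε γ := by
  have hΩ := φ.open_target
  have hh := contDiffOn_chartHamiltonian hL hc hleg hφ
  obtain ⟨CL, hCL0, hCL⟩ := exists_le_lagrangian hL hc hleg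
  obtain ⟨C, hC0, hC⟩ := exists_hjResidual_le hΩ hh hG (isCompact_closedBall x₀ r) hr
  -- Near time 0 the approximate solution is close to G(0, ·), uniformly on the compact sphere.
  have hsphere : ∀ᶠ z : ℝ × ℝ in 𝓝 (0, 0), ∀ x ∈ Metric.sphere x₀ r,
      hjTaylor (chartHamiltonian L φ) G (z.1, z.2, x) < m + 1 / 2 := by
    refine (isCompact_sphere x₀ r).eventually_forall_of_forall_eventually ?_
    intro x hx
    have hxΩ : x ∈ φ.target := hr (Metric.sphere_subset_closedBall hx)
    have hmem : (univ : Set ℝ) ×ˢ φ.target ∈ 𝓝 ((0 : ℝ), x) :=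
      (isOpen_univ.prod hΩ).mem_nhds ⟨trivial, hxΩ⟩
    have hmap : ContinuousAt (fun w : (ℝ × ℝ) × Coord n => (w.1.2, w.2)) ((0, 0), x) := by fun_prop
    have h0 := (hG.continuousOn.continuousAt hmem).comp_of_eq hmap rfl
    have h1 := ((contDiffOn_hjFirst hΩ hh hG).continuousOn.continuousAt hmem).comp_of_eq hmap rfl
    have h2 := ((contDiffOn_hjSecond hΩ hh hG).continuousOn.continuousAt hmem).comp_of_eq hmap rfl
    have hs : ContinuousAt (fun w : (ℝ × ℝ) × Coord n => w.1.1) ((0, 0), x) := by fun_prop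
    have h3 := (h0.sub (hs.mul h1)).add (((hs.pow 2).div_const 2).mul h2)
    refine h3.eventually (gt_mem_nhds ?_)
    have := hm x hx
    simp only [Pi.add_apply, Pi.sub_apply, Pi.mul_apply, Pi.pow_apply, Function.comp]
    norm_num
    linarith
  obtain ⟨δ, hδ, hball⟩ := Metric.eventually_nhds_iff_ball.1 hsphere
  have hsmall : ∀ᶠ ε in 𝓝[>] (0 : ℝ), C * ε ^ 3 + CL * ε < 1 / 2 := by
    have h : ContinuousAt (fun ε : ℝ => C * ε ^ 3 + CL * ε) 0 := by fun_prop
    refine (h.tendsto.mono_left nhdsWithin_le_nhds).eventually (gt_mem_nhds (by norm_num))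
  refine ⟨C, ?_⟩
  filter_upwards [hsmall, Ioo_mem_nhdsGT hδ, Ioc_mem_nhdsGT (zero_lt_one' ℝ)] with ε hεs hεδ hε1
  intro q q' γ hγ hq' hq'r
  have hε0 : 0 < ε := hε1.1
  -- The starting time τ is arbitrary, so that this also applies to the part of a path after its
  -- last exit from the ball.
  have hverify : ∀ τ ∈ Icc 0 ε,
      (∀ s ∈ Icc τ ε, γ s ∈ φ.source ∧ φ (γ s) ∈ Metric.closedBall x₀ r) →
      hjEnd (chartHamiltonian L φ) G (ε, φ q') - hjTaylor (chartHamiltonian L φ) G (τ, ε, φ (γ τ)) ≤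
        (∫ s in τ..ε, L ⟨γ s, velocity n γ ε s⟩) + C * ε ^ 3 := by
    intro τ hτ hstay
    have hsub : Icc τ ε ⊆ Icc 0 ε := Icc_subset_Icc_left hτ.1
    have h1 := hjTaylor_sub_le_integral hΩ hh hG (C := C * ε ^ 2) (ε := ε) (a := τ) (t := ε)
      (y := fun s => φ (γ s)) (y' := fun s => mfderiv (𝓡 n) (𝓡 n) φ (γ s) (velocity n γ ε s))
      (φ := fun s => L ⟨γ s, velocity n γ ε s⟩) hτ.2
      (fun s hs => (hC s ⟨hτ.1.trans hs.1.le, hs.2.le.trans hε1.2⟩ ε ⟨hε0.le, hε1.2⟩ _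
        (hstay s (Ioo_subset_Icc_self hs)).2).trans (mul_le_mul_of_nonneg_left
          (pow_le_pow_left₀ (hτ.1.trans hs.1.le) hs.2.le 2) hC0))
      (φ.continuousOn.comp (hγ.continuousOn.mono hsub) fun s hs => (hstay s hs).1)
      (fun s hs => (hγ.hasDerivWithinAt_chart hφ (hsub (Ioo_subset_Icc_self hs))
        (hstay s (Ioo_subset_Icc_self hs)).1).hasDerivAt
          (Icc_mem_nhds (hτ.1.trans_lt hs.1) hs.2))
      (fun s hs => hr (hstay s hs).2) ((hγ.continuousOn_lagrangian hL hε0).mono hsub)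
      (fun s hs α => chart_le_hamiltonian_add hL hc hleg (hstay s (Ioo_subset_Icc_self hs)).1 α _)
    rw [hγ.target] at h1
    refine h1.trans (add_le_add le_rfl ?_)
    have : C * ε ^ 2 * (ε - τ) ≤ C * ε ^ 2 * ε :=
      mul_le_mul_of_nonneg_left (by linarith [hτ.1]) (by positivity)
    linarith
  rcases hγ.exists_last_exit hr hq' hq'r with hstay | ⟨τ, hτ, ⟨hτsrc, hτs⟩, hafter⟩
  · left
    have h0 := hstay 0 ⟨le_rfl, hε0.le⟩
    rw [hγ.source] at h0
    refine ⟨h0.1, h0.2, ?_⟩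
    have h1 := hverify 0 ⟨le_rfl, hε0.le⟩ fun s hs =>
      ⟨(hstay s hs).1, Metric.ball_subset_closedBall (hstay s hs).2⟩
    rw [hγ.source] at h1
    have h2 : hjTaylor (chartHamiltonian L φ) G (0, ε, φ q) = G (ε, φ q) := by simp [hjTaylor]
    rw [h2] at h1
    change _ ≤ action L ε γ + _ at h1
    linarith
  · right
    -- After τ the approximate solution controls the action, starting from its small value on the
    -- sphere; before τ the path may run anywhere, and the lower bound of L costs at most `CL * ε`.
    have h1 := hverify τ hτ hafter
    have h2 := hball (τ, ε) (by
      rw [mem_ball_iff_norm, Prod.norm_def]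
      refine max_lt ?_ ?_
      · simpa [abs_of_nonneg hτ.1] using hτ.2.trans_lt hεδ.2
      · simpa [abs_of_pos hε0] using hεδ.2) _ hτs
    have h3 := le_integral_lagrangian hL hCL hγ hε0 hτ
    have hint := hγ.continuousOn_lagrangian hL hε0
    have h4 := intervalIntegral.integral_add_adjacent_intervals
      ((hint.mono (Icc_subset_Icc_right hτ.2)).intervalIntegrable_of_Icc hτ.1)
      ((hint.mono (Icc_subset_Icc_left hτ.1)).intervalIntegrable_of_Icc hτ.2)
      (μ := MeasureTheory.volume)
    have h5 : CL * τ ≤ CL * ε := mul_le_mul_of_nonneg_left hτ.2 hCL0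
    dsimp only at h2
    unfold action
    linarith

/-! ### Upper bounds for the action -/

theorem action_segment (L : Tan n M → ℝ) {φ : OpenPartialHomeomorph M (Coord n)}
    (hφ : φ ∈ IsManifold.maximalAtlas (𝓡 n) ∞ M) {c v : Coord n} {t : ℝ} (ht : 0 < t)
    (hc : ∀ s ∈ Icc 0 t, c + s • v ∈ φ.target) :
    action L t (fun s => φ.symm (c + s • v)) =
      ∫ s in (0 : ℝ)..t, chartLagrangian L φ (c + s • v, v) := by
  refine intervalIntegral.integral_congr fun s hs => ?_
  rw [uIcc_of_le ht.le] at hs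
  have hd : HasDerivWithinAt (fun s : ℝ => c + s • v) v (Icc 0 t) s := by
    simpa using (((hasDerivAt_id s).smul_const v).const_add c).hasDerivWithinAt
  exact lagrangian_velocity_eq L hφ ht hs hd (hc s hs) Filter.EventuallyEq.rfl

/-! ### Principal actions -/

theorem principalAction_ne_bot (hL : ContMDiff (𝓡 n).tangent 𝓘(ℝ, ℝ) ∞ L) {C : ℝ}
    (hC : ∀ z, -C ≤ L z) {q q' : M} {t : ℝ} (ht : 0 < t) : principalAction L q q' t ≠ ⊥ := by
  have h : ((-C * t : ℝ) : EReal) ≤ principalAction L q q' t :=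
    le_iInf₂ fun γ hγ => EReal.coe_le_coe_iff.2
      (le_integral_lagrangian hL hC hγ ht ⟨ht.le, le_rfl⟩)
  exact ((EReal.bot_lt_coe _).trans_le h).ne'

/-- Passing from paths to infima of sums in `EReal` requires excluding ⊥ + ⊤; the lower bounds of
the Lagrange functions exclude ⊥. -/
theorem le_composedAction [CompactSpace M] (hL₁ : ContMDiff (𝓡 n).tangent 𝓘(ℝ, ℝ) ∞ L₁)
    (hL₂ : ContMDiff (𝓡 n).tangent 𝓘(ℝ, ℝ) ∞ L₂) (hc₁ : FibreConvex L₁) (hc₂ : FibreConvex L₂)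
    (hleg₁ : ∀ q, Function.Surjective (legendre L₁ q))
    (hleg₂ : ∀ q, Function.Surjective (legendre L₂ q)) {q q' : M} {t₁ t₂ c : ℝ} (ht₁ : 0 < t₁)
    (ht₂ : 0 < t₂)
    (h : ∀ q₁ γ₁ γ₂, IsPath n q q₁ t₁ γ₁ → IsPath n q₁ q' t₂ γ₂ →
      c ≤ action L₁ t₁ γ₁ + action L₂ t₂ γ₂) :
    (c : EReal) ≤ composedAction L₁ L₂ q q' t₁ t₂ := by
  obtain ⟨C₁, -, hC₁⟩ := exists_le_lagrangian hL₁ hc₁ hleg₁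
  obtain ⟨C₂, -, hC₂⟩ := exists_le_lagrangian hL₂ hc₂ hleg₂
  refine le_iInf fun q₁ => ?_
  refine EReal.le_add_of_forall_gt (Or.inl (principalAction_ne_bot hL₁ hC₁ ht₁))
    (Or.inr (principalAction_ne_bot hL₂ hC₂ ht₂)) fun a ha b hb => ?_
  simp only [principalAction, gt_iff_lt, iInf_lt_iff] at ha hb
  obtain ⟨γ₁, hγ₁, ha⟩ := ha
  obtain ⟨γ₂, hγ₂, hb⟩ := hb
  refine le_trans ?_ (add_le_add ha.le hb.le)
  rw [← EReal.coe_add]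
  exact EReal.coe_le_coe_iff.2 (h q₁ γ₁ γ₂ hγ₁ hγ₂)

end CommutingActions

namespace CommutingActions

variable {n : ℕ} {M : Type*} [TopologicalSpace M] [ChartedSpace (Coord n) M]
  {L L₁ L₂ : Tan n M → ℝ}

/-! ### The Poisson bracket -/

theorem ActionsCommute.symm (h : ActionsCommute L₁ L₂) : ActionsCommute L₂ L₁ := by
  obtain ⟨U, hU, ε, hε, h⟩ := h
  exact ⟨U, hU, ε, hε, fun q q' hq t₁ ht₁ t₂ ht₂ => (h q q' hq t₂ ht₂ t₁ ht₁).symm⟩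

/-- A concave quadratic function with prescribed differential at the centre of a ball that is very
negative on the boundary of the ball. -/
theorem exists_peak {E : Type*} [NormedAddCommGroup E] [InnerProductSpace ℝ E] (x₀ : E)
    (p : E →L[ℝ] ℝ) {r : ℝ} (hr : 0 < r) :
    ∃ u : E → ℝ, ContDiff ℝ ∞ u ∧ u x₀ = 0 ∧ fderiv ℝ u x₀ = p ∧
      ∀ x ∈ Metric.sphere x₀ r, u x ≤ -4 := by
  -- On the sphere p(x - x₀) ≤ ‖p‖r and the quadratic term equals ‖p‖r + 4.
  set κ := (‖p‖ * r + 4) / r ^ 2 with hκ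
  have hid : HasFDerivAt (fun x : E => x - x₀) (ContinuousLinearMap.id ℝ E) x₀ :=
    (hasFDerivAt_id x₀).sub_const x₀
  refine ⟨fun x => p (x - x₀) - κ * ‖x - x₀‖ ^ 2, ?_, by simp, ?_, fun x hx => ?_⟩
  · exact (p.contDiff.comp (contDiff_id.sub contDiff_const)).sub
      (contDiff_const.mul ((contDiff_norm_sq ℝ).comp (contDiff_id.sub contDiff_const)))
  · refine ((p.hasFDerivAt.comp x₀ hid).sub (hid.norm_sq.const_mul κ)).fderiv.trans ?_
    ext v
    simp
  · have hx' : ‖x - x₀‖ = r := by simpa [dist_eq_norm] using hx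
    have h1 : p (x - x₀) ≤ ‖p‖ * r := by
      rw [← hx']
      exact (le_abs_self _).trans (p.le_opNorm _)
    have h2 : κ * r ^ 2 = ‖p‖ * r + 4 := by simp only [hκ]; field_simp
    change p (x - x₀) - κ * ‖x - x₀‖ ^ 2 ≤ -4
    rw [hx', h2]
    linarith

theorem coords_fst_mem_target {φ : OpenPartialHomeomorph M (Coord n)} {z : Cotan n M}
    (hz : z.1 ∈ φ.source) : (coords φ z).1 ∈ φ.target := φ.map_source hz

variable [IsManifold (𝓡 n) ∞ M]

/-- Broken segments with the optimal velocities bound the composed action from above. -/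
theorem exists_composedAction_le (hL₁ : ContMDiff (𝓡 n).tangent 𝓘(ℝ, ℝ) ∞ L₁)
    (hL₂ : ContMDiff (𝓡 n).tangent 𝓘(ℝ, ℝ) ∞ L₂) (hc₁ : FibreConvex L₁) (hc₂ : FibreConvex L₂)
    (hleg₁ : ∀ q, Function.Surjective (legendre L₁ q))
    (hleg₂ : ∀ q, Function.Surjective (legendre L₂ q))
    {φ : OpenPartialHomeomorph M (Coord n)} (hφ : φ ∈ IsManifold.maximalAtlas (𝓡 n) ∞ M)
    {x₀ : Coord n} (hx₀ : x₀ ∈ φ.target) {u : Coord n → ℝ} (hu : ContDiff ℝ ∞ u) {v₁ v₂ : Coord n}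
    (hv₁ : v₁ = chartVelocity L₁ φ (x₀, fderiv ℝ u x₀))
    (hv₂ : v₂ = chartVelocity L₂ φ (x₀, fderiv ℝ u x₀)) :
    ∃ C, ∀ᶠ ε in 𝓝[>] (0 : ℝ),
      composedAction L₁ L₂ (φ.symm (x₀ - ε • v₂ - ε • v₁)) (φ.symm x₀) ε ε ≤
      ((hjEnd (chartHamiltonian L₂ φ) (hjEnd (chartHamiltonian L₁ φ) fun z => u z.2) (ε, x₀) -
        u (x₀ - ε • v₂ - ε • v₁) + C * ε ^ 3 : ℝ) : EReal) := by
  have hΩ := φ.open_target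
  have hh₁ := contDiffOn_chartHamiltonian hL₁ hc₁ hleg₁ hφ
  have hh₂ := contDiffOn_chartHamiltonian hL₂ hc₂ hleg₂ hφ
  have hG : ContDiffOn ℝ ∞ (fun z : ℝ × Coord n => u z.2) (univ ×ˢ φ.target) :=
    contDiffOn_comp_snd hu.contDiffOn
  have hd : fderivSnd (fun z : ℝ × Coord n => u z.2) (0, x₀) = fderiv ℝ u x₀ :=
    fderivSnd_comp_snd hΩ hu.contDiffOn 0 hx₀
  have hG₁ := contDiffOn_hjEnd hΩ hh₁ hG
  have hd₁ := (fderivSnd_hjEnd_zero hΩ hh₁ hG hx₀).trans hd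
  -- The broken segment follows v₁ and then v₂ and arrives at x₀. All of it lies within Nε of x₀, as
  -- the segment estimates demand of its starting points.
  set N := ‖v₁‖ + ‖v₂‖ with hN
  have hN0 : 0 ≤ N := by positivity
  obtain ⟨C₁, -, h₁⟩ := exists_integral_segment_le hΩ hh₁ hG (contDiffOn_chartLagrangian hL₁ hφ)
    (fun x hx v α => le_chartHamiltonian_add hL₁ hc₁ hleg₁ hφ hx v α) (v := v₁) hx₀
    (by rw [hd, hv₁]; linarith [chartHamiltonian_eq_sub (L := L₁) hφ hx₀ (fderiv ℝ u x₀)]) hN0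
  obtain ⟨C₂, -, h₂⟩ := exists_integral_segment_le hΩ hh₂ hG₁ (contDiffOn_chartLagrangian hL₂ hφ)
    (fun x hx v α => le_chartHamiltonian_add hL₂ hc₂ hleg₂ hφ hx v α) (v := v₂) hx₀
    (by rw [hd₁, hv₂]; linarith [chartHamiltonian_eq_sub (L := L₂) hφ hx₀ (fderiv ℝ u x₀)]) hN0
  obtain ⟨r, hr, hrt⟩ := Metric.isOpen_iff.1 hΩ x₀ hx₀
  have hsmall : ∀ᶠ ε in 𝓝[>] (0 : ℝ), N * ε < r := by
    have h : ContinuousAt (fun ε : ℝ => N * ε) 0 := by fun_prop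
    exact (h.tendsto.mono_left nhdsWithin_le_nhds).eventually (gt_mem_nhds (by simpa using hr))
  refine ⟨C₁ + C₂, ?_⟩
  filter_upwards [h₁, h₂, hsmall, self_mem_nhdsWithin] with ε h₁ h₂ hεr hε
  have hε0 : 0 < ε := hε
  have hseg₁ : ∀ s ∈ Icc 0 ε, ‖(x₀ - ε • v₂ - ε • v₁ + s • v₁) - x₀‖ ≤ N * ε := by
    intro s hs
    calc ‖(x₀ - ε • v₂ - ε • v₁ + s • v₁) - x₀‖ = ‖-(ε • v₂) - (ε - s) • v₁‖ := by
          congr 1; rw [sub_smul]; abel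
      _ ≤ ‖-(ε • v₂)‖ + ‖(ε - s) • v₁‖ := norm_sub_le _ _
      _ = ε * ‖v₂‖ + (ε - s) * ‖v₁‖ := by
          rw [norm_neg, norm_smul, norm_smul, Real.norm_of_nonneg hε0.le,
            Real.norm_of_nonneg (by linarith [hs.2])]
      _ ≤ N * ε := by
          have := mul_nonneg hs.1 (norm_nonneg v₁)
          simp only [hN]
          linarith
  have hseg₂ : ∀ s ∈ Icc 0 ε, ‖(x₀ - ε • v₂ + s • v₂) - x₀‖ ≤ N * ε := by
    intro s hs
    calc ‖(x₀ - ε • v₂ + s • v₂) - x₀‖ = ‖-((ε - s) • v₂)‖ := by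
          congr 1; rw [sub_smul]; abel
      _ = (ε - s) * ‖v₂‖ := by
          rw [norm_neg, norm_smul, Real.norm_of_nonneg (by linarith [hs.2])]
      _ ≤ N * ε := by
          have := mul_nonneg hs.1 (norm_nonneg v₂)
          have := mul_nonneg hε0.le (norm_nonneg v₁)
          simp only [hN]
          linarith
  have ht₁ : ∀ s ∈ Icc 0 ε, x₀ - ε • v₂ - ε • v₁ + s • v₁ ∈ φ.target := fun s hs =>
    hrt (mem_ball_iff_norm.2 ((hseg₁ s hs).trans_lt hεr))
  have ht₂ : ∀ s ∈ Icc 0 ε, x₀ - ε • v₂ + s • v₂ ∈ φ.target := fun s hs =>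
    hrt (mem_ball_iff_norm.2 ((hseg₂ s hs).trans_lt hεr))
  have hp₁ := isPath_segment hφ ht₁
  have hp₂ := isPath_segment hφ ht₂
  rw [sub_add_cancel] at hp₁ hp₂
  refine (composedAction_le (L₁ := L₁) (L₂ := L₂) hp₁ hp₂).trans (EReal.coe_le_coe_iff.2 ?_)
  rw [action_segment L₁ hφ hε0 ht₁, action_segment L₂ hφ hε0 ht₂]
  have e₁ := h₁ (x₀ - ε • v₂ - ε • v₁) (by simpa using hseg₁ 0 ⟨le_rfl, hε0.le⟩)
  have e₂ := h₂ (x₀ - ε • v₂) (by simpa using hseg₂ 0 ⟨le_rfl, hε0.le⟩)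
  rw [sub_add_cancel] at e₁ e₂
  linarith

/-- Approximate solutions of the Hamilton–Jacobi equations bound the composed action from below. -/
theorem exists_le_composedAction [CompactSpace M] [T2Space M]
    (hL₁ : ContMDiff (𝓡 n).tangent 𝓘(ℝ, ℝ) ∞ L₁)
    (hL₂ : ContMDiff (𝓡 n).tangent 𝓘(ℝ, ℝ) ∞ L₂) (hc₁ : FibreConvex L₁) (hc₂ : FibreConvex L₂)
    (hleg₁ : ∀ q, Function.Surjective (legendre L₁ q))
    (hleg₂ : ∀ q, Function.Surjective (legendre L₂ q))
    {φ : OpenPartialHomeomorph M (Coord n)} (hφ : φ ∈ IsManifold.maximalAtlas (𝓡 n) ∞ M)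
    {x₀ : Coord n} {r : ℝ} (hr : 0 < r) (hrt : Metric.closedBall x₀ r ⊆ φ.target) {u : Coord n → ℝ}
    (hu : ContDiff ℝ ∞ u) (hsph : ∀ x ∈ Metric.sphere x₀ r, u x ≤ -4) :
    ∃ C, ∀ᶠ ε in 𝓝[>] (0 : ℝ), ∀ x ∈ φ.target, -1 ≤ u x →
      ((hjEnd (chartHamiltonian L₂ φ) (hjEnd (chartHamiltonian L₁ φ) fun z => u z.2) (ε, x₀) -
        u x - C * ε ^ 3 : ℝ) : EReal) ≤ composedAction L₁ L₂ (φ.symm x) (φ.symm x₀) ε ε := by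
  have hΩ := φ.open_target
  have hx₀ : x₀ ∈ φ.target := hrt (Metric.mem_closedBall_self hr.le)
  have hh₁ := contDiffOn_chartHamiltonian hL₁ hc₁ hleg₁ hφ
  have hG : ContDiffOn ℝ ∞ (fun z : ℝ × Coord n => u z.2) (univ ×ˢ φ.target) :=
    contDiffOn_comp_snd hu.contDiffOn
  have hG₁ := contDiffOn_hjEnd hΩ hh₁ hG
  obtain ⟨C₁, h₁⟩ := eventually_hjEnd_le_action hL₁ hc₁ hleg₁ hφ hG hrt hsph
  obtain ⟨C₂, h₂⟩ := eventually_hjEnd_le_action hL₂ hc₂ hleg₂ hφ hG₁ (m := -4) hrt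
    (fun x hx => by simpa [hjEnd, hjTaylor] using hsph x hx)
  obtain ⟨CL, hCL0, hCL⟩ := exists_le_lagrangian hL₁ hc₁ hleg₁
  have hsmall : ∀ᶠ ε in 𝓝[>] (0 : ℝ), CL * ε < 1 := by
    have h : ContinuousAt (fun ε : ℝ => CL * ε) 0 := by fun_prop
    exact (h.tendsto.mono_left nhdsWithin_le_nhds).eventually (gt_mem_nhds (by norm_num))
  refine ⟨|C₁| + |C₂|, ?_⟩
  filter_upwards [h₁, h₂, hsmall, self_mem_nhdsWithin] with ε h₁ h₂ hεL hε x hx hux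
  have hε0 : 0 < ε := hε
  refine le_composedAction hL₁ hL₂ hc₁ hc₂ hleg₁ hleg₂ hε0 hε0 fun q₁ γ₁ γ₂ hγ₁ hγ₂ => ?_
  have hε3 : 0 < ε ^ 3 := by positivity
  have b₁ : C₁ * ε ^ 3 ≤ |C₁| * ε ^ 3 := mul_le_mul_of_nonneg_right (le_abs_self _) hε3.le
  have b₂ : C₂ * ε ^ 3 ≤ |C₂| * ε ^ 3 := mul_le_mul_of_nonneg_right (le_abs_self _) hε3.le
  have b₃ : 0 ≤ |C₁| * ε ^ 3 := by positivity
  have b₄ : 0 ≤ |C₂| * ε ^ 3 := by positivity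
  have e₂ := h₂ q₁ (φ.symm x₀) γ₂ hγ₂ (φ.map_target hx₀)
    (by rw [φ.right_inv hx₀]; exact Metric.mem_ball_self hr)
  rw [φ.right_inv hx₀] at e₂
  -- If one of the paths leaves the ball, its bound starts from -4 + 1 = -3. This lies far enough
  -- below u(x) ≥ -1 to absorb the other path's loss, which is at most 1 or of order ε³.
  rcases e₂ with ⟨hq₁, hq₁r, e₂⟩ | e₂
  · rcases h₁ (φ.symm x) q₁ γ₁ hγ₁ hq₁ hq₁r with ⟨-, -, e₁⟩ | e₁
    · rw [φ.right_inv hx] at e₁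
      linarith
    · linarith
  · have e₁ := le_integral_lagrangian hL₁ hCL hγ₁ hε0 ⟨hε0.le, le_rfl⟩
    change _ ≤ action L₁ ε γ₁ at e₁
    linarith

/-- Both bounds are used for paths from x₀ - εv₂ - εv₁ to x₀, the endpoints of the segments that are
nearly optimal in the order L₁, L₂. The lower bound is for the order L₂, L₁; commutation links the
two. -/
theorem fderiv_chartHamiltonian_le [CompactSpace M] [T2Space M]
    (hL₁ : ContMDiff (𝓡 n).tangent 𝓘(ℝ, ℝ) ∞ L₁)
    (hL₂ : ContMDiff (𝓡 n).tangent 𝓘(ℝ, ℝ) ∞ L₂) (hc₁ : FibreConvex L₁) (hc₂ : FibreConvex L₂)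
    (hleg₁ : ∀ q, Function.Surjective (legendre L₁ q))
    (hleg₂ : ∀ q, Function.Surjective (legendre L₂ q)) (hcomm : ActionsCommute L₁ L₂)
    {φ : OpenPartialHomeomorph M (Coord n)} (hφ : φ ∈ IsManifold.maximalAtlas (𝓡 n) ∞ M)
    {x₀ : Coord n} (hx₀ : x₀ ∈ φ.target) (p : Coord n →L[ℝ] ℝ) :
    fderiv ℝ (chartHamiltonian L₂ φ) (x₀, p) (chartVelocity L₁ φ (x₀, p), 0) ≤
      fderiv ℝ (chartHamiltonian L₁ φ) (x₀, p) (chartVelocity L₂ φ (x₀, p), 0) := by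
  have hΩ := φ.open_target
  obtain ⟨r, hr, hrt⟩ := Metric.nhds_basis_closedBall.mem_iff.1 (hΩ.mem_nhds hx₀)
  obtain ⟨u, hu, hux₀, rfl, hsph⟩ := exists_peak x₀ p hr
  set p := fderiv ℝ u x₀
  set v₁ := chartVelocity L₁ φ (x₀, p) with hv₁
  set v₂ := chartVelocity L₂ φ (x₀, p) with hv₂
  obtain ⟨C, hC⟩ := exists_composedAction_le hL₁ hL₂ hc₁ hc₂ hleg₁ hleg₂ hφ hx₀ hu hv₁ hv₂
  obtain ⟨C', hC'⟩ := exists_le_composedAction hL₂ hL₁ hc₂ hc₁ hleg₂ hleg₁ hφ hr hrt hu hsph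
  obtain ⟨U, hU, ε₀, hε₀, hcomm⟩ := hcomm
  have hlim : Filter.Tendsto (fun ε : ℝ => x₀ - ε • v₂ - ε • v₁) (𝓝[>] 0) (𝓝 x₀) := by
    have h : ContinuousAt (fun ε : ℝ => x₀ - ε • v₂ - ε • v₁) 0 := by fun_prop
    have := h.tendsto.mono_left (nhdsWithin_le_nhds (s := Ioi (0 : ℝ)))
    simpa using this
  have hUq : U ∈ 𝓝 (φ.symm x₀, φ.symm x₀) := mem_nhdsSet_iff_forall.1 hU _ rfl
  have hx₀U : ∀ᶠ x in 𝓝 x₀, (φ.symm x, φ.symm x₀) ∈ U :=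
    (((φ.continuousAt_symm hx₀).prodMk continuousAt_const).eventually hUq)
  have hu1 : ∀ᶠ x in 𝓝 x₀, -1 ≤ u x :=
    (hu.continuous.continuousAt.eventually (lt_mem_nhds (by rw [hux₀]; norm_num))).mono
      fun _ h => le_of_lt h
  refine fderiv_le_fderiv_of_hjEnd_le hΩ (contDiffOn_chartHamiltonian hL₁ hc₁ hleg₁ hφ)
    (contDiffOn_chartHamiltonian hL₂ hc₂ hleg₂ hφ) hu.contDiffOn hx₀
    (fderiv_chartHamiltonian_apply hL₁ hc₁ hleg₁ hφ hx₀ p)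
    (fderiv_chartHamiltonian_apply hL₂ hc₂ hleg₂ hφ hx₀ p) (C := C + C') ?_
  filter_upwards [hC, hC', Ioo_mem_nhdsGT hε₀, hlim.eventually hx₀U, hlim.eventually hu1,
    hlim.eventually (hΩ.mem_nhds hx₀)] with ε h₁ h₂ hε hεU hεu hεt
  have h3 := (h₂ _ hεt hεu).trans ((hcomm _ _ hεU ε hε ε hε).symm.le.trans h₁)
  have h4 := EReal.coe_le_coe_iff.1 h3
  linarith

theorem fderiv_hamiltonian_ofCoords (hL : ContMDiff (𝓡 n).tangent 𝓘(ℝ, ℝ) ∞ L)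
    (hc : FibreConvex L) (hleg : ∀ q, Function.Surjective (legendre L q))
    {φ : OpenPartialHomeomorph M (Coord n)} (hφ : φ ∈ IsManifold.maximalAtlas (𝓡 n) ∞ M)
    {y : Coord n × Coord n} (hy : y.1 ∈ φ.target) (a b : Coord n) :
    fderiv ℝ (hamiltonian L ∘ ofCoords φ) y (a, b) =
      fderiv ℝ (chartHamiltonian L φ) (y.1, innerSL ℝ y.2) (a, innerSL ℝ b) := by
  have h1 := (((contDiffOn_chartHamiltonian hL hc hleg hφ).contDiffAt ((φ.open_target.prod
    isOpen_univ).mem_nhds (x := (y.1, innerSL ℝ y.2)) ⟨hy, trivial⟩)).differentiableAt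
    (by norm_num)).hasFDerivAt
  have h2 := h1.comp y ((hasFDerivAt_fst (p := y)).prodMk
    ((innerSL ℝ (E := Coord n)).hasFDerivAt.comp y hasFDerivAt_snd))
  exact DFunLike.congr_fun h2.fderiv (a, b)

theorem sum_smul_basisVec (v : Coord n) : ∑ j, v j • (basisVec j : Coord n) = v := by
  ext k
  simp [basisVec, Finset.sum_apply, Pi.single_apply]

theorem poissonBracket_eq (hL₁ : ContMDiff (𝓡 n).tangent 𝓘(ℝ, ℝ) ∞ L₁)
    (hL₂ : ContMDiff (𝓡 n).tangent 𝓘(ℝ, ℝ) ∞ L₂) (hc₁ : FibreConvex L₁) (hc₂ : FibreConvex L₂)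
    (hleg₁ : ∀ q, Function.Surjective (legendre L₁ q))
    (hleg₂ : ∀ q, Function.Surjective (legendre L₂ q))
    {φ : OpenPartialHomeomorph M (Coord n)} (hφ : φ ∈ IsManifold.maximalAtlas (𝓡 n) ∞ M)
    {z : Cotan n M} (hz : z.1 ∈ φ.source) {x₀ : Coord n} {p : Coord n →L[ℝ] ℝ}
    (hx₀ : x₀ = (coords φ z).1) (hp : p = innerSL ℝ (coords φ z).2) :
    poissonBracket φ (hamiltonian L₁) (hamiltonian L₂) z =
      fderiv ℝ (chartHamiltonian L₂ φ) (x₀, p) (chartVelocity L₁ φ (x₀, p), 0) -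
      fderiv ℝ (chartHamiltonian L₁ φ) (x₀, p) (chartVelocity L₂ φ (x₀, p), 0) := by
  have hy := coords_fst_mem_target hz
  have hxt : x₀ ∈ φ.target := hx₀ ▸ hy
  have hdp : ∀ {L : Tan n M → ℝ}, ContMDiff (𝓡 n).tangent 𝓘(ℝ, ℝ) ∞ L → FibreConvex L →
      (∀ q, Function.Surjective (legendre L q)) → ∀ j,
      dp φ (hamiltonian L) j z = chartVelocity L φ (x₀, p) j := by
    intro L hL hc hleg j
    rw [dp, fderiv_hamiltonian_ofCoords hL hc hleg hφ hy, ← hx₀, ← hp,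
      fderiv_chartHamiltonian_apply hL hc hleg hφ hxt]
    simp [basisVec, EuclideanSpace.inner_single_left]
  have hdq : ∀ {L : Tan n M → ℝ}, ContMDiff (𝓡 n).tangent 𝓘(ℝ, ℝ) ∞ L → FibreConvex L →
      (∀ q, Function.Surjective (legendre L q)) → ∀ j,
      dq φ (hamiltonian L) j z = fderiv ℝ (chartHamiltonian L φ) (x₀, p) (basisVec j, 0) := by
    intro L hL hc hleg j
    rw [dq, fderiv_hamiltonian_ofCoords hL hc hleg hφ hy, ← hx₀, ← hp, map_zero]
  have hsum : ∀ (T : Coord n × (Coord n →L[ℝ] ℝ) →L[ℝ] ℝ) (v : Coord n),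
      T (v, 0) = ∑ j, v j * T (basisVec j, 0) := by
    intro T v
    have h : (T.comp (ContinuousLinearMap.inl ℝ (Coord n) (Coord n →L[ℝ] ℝ))) v =
      ∑ j, v j * T (basisVec j, 0) := by
      conv_lhs => rw [← sum_smul_basisVec v, map_sum]
      simp
    simpa using h
  rw [hsum, hsum, ← Finset.sum_sub_distrib]
  refine Finset.sum_congr rfl fun j _ => ?_
  rw [hdp hL₁ hc₁ hleg₁, hdp hL₂ hc₂ hleg₂, hdq hL₁ hc₁ hleg₁, hdq hL₂ hc₂ hleg₂]
  ring

/-- The hypothesis is symmetric in L₁ and L₂, so the one-sided estimate also holds with their roles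
exchanged. -/
theorem poissonCommute_of_actionsCommute [CompactSpace M] [T2Space M]
    (hL₁ : ContMDiff (𝓡 n).tangent 𝓘(ℝ, ℝ) ∞ L₁)
    (hL₂ : ContMDiff (𝓡 n).tangent 𝓘(ℝ, ℝ) ∞ L₂) (hc₁ : FibreConvex L₁) (hc₂ : FibreConvex L₂)
    (hleg₁ : ∀ q, Function.Surjective (legendre L₁ q))
    (hleg₂ : ∀ q, Function.Surjective (legendre L₂ q)) (hcomm : ActionsCommute L₁ L₂) :
    PoissonCommute (hamiltonian L₁) (hamiltonian L₂) := by
  intro φ hφ z hz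
  have hy := coords_fst_mem_target hz
  rw [poissonBracket_eq hL₁ hL₂ hc₁ hc₂ hleg₁ hleg₂ hφ hz rfl rfl, sub_eq_zero]
  exact le_antisymm
    (fderiv_chartHamiltonian_le hL₁ hL₂ hc₁ hc₂ hleg₁ hleg₂ hcomm hφ hy _)
    (fderiv_chartHamiltonian_le hL₂ hL₁ hc₂ hc₁ hleg₂ hleg₁ hcomm.symm hφ hy _)

end CommutingActions

namespace CommutingActions

/-! ### Commuting vector fields -/

section CommutingFields

variable {F : Type*} [NormedAddCommGroup F] [NormedSpace ℝ F]

/-- Functions whose bracket vanishes have commuting Hamiltonian vector fields. -/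
theorem fderiv_field_comm {f₁ f₂ : F → ℝ} {Ω : Set F} (hΩ : IsOpen Ω) (h₁ : ContDiffOn ℝ ∞ f₁ Ω)
    (h₂ : ContDiffOn ℝ ∞ f₂ Ω) {J : (F →L[ℝ] ℝ) →L[ℝ] F} (hJ : ∀ α β : F →L[ℝ] ℝ, α (J β) = -β (J α))
    (hbr : ∀ y ∈ Ω, fderiv ℝ f₂ y (J (fderiv ℝ f₁ y)) = 0) {y : F} (hy : y ∈ Ω) :
    fderiv ℝ (fun y => J (fderiv ℝ f₁ y)) y (J (fderiv ℝ f₂ y)) =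
      fderiv ℝ (fun y => J (fderiv ℝ f₂ y)) y (J (fderiv ℝ f₁ y)) := by
  have hd : ∀ {f : F → ℝ}, ContDiffOn ℝ ∞ f Ω →
      HasFDerivAt (fderiv ℝ f) (fderiv ℝ (fderiv ℝ f) y) y := fun hf =>
    (((hf.fderiv_of_isOpen hΩ (m := ∞) (by norm_num)).contDiffAt
      (hΩ.mem_nhds hy)).differentiableAt (by norm_num)).hasFDerivAt
  have hX : ∀ {f : F → ℝ}, ContDiffOn ℝ ∞ f Ω →
      HasFDerivAt (fun y => J (fderiv ℝ f y)) (J.comp (fderiv ℝ (fderiv ℝ f) y)) y := fun hf =>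
    J.hasFDerivAt.comp y (hd hf)
  have hs : ∀ {f : F → ℝ}, ContDiffOn ℝ ∞ f Ω → ∀ a b,
      fderiv ℝ (fderiv ℝ f) y a b = fderiv ℝ (fderiv ℝ f) y b a := fun hf =>
    (hf.contDiffAt (hΩ.mem_nhds hy)).isSymmSndFDerivAt (by simpa using two_le_infty)
  rw [(hX h₁).fderiv, (hX h₂).fderiv]
  change J _ = J _
  congr 1
  ext a
  -- The bracket vanishes identically, so its derivative does too. In that derivative the
  -- antisymmetry of J turns df₂(J D²f₁ a) into -(D²f₁ a)(J df₂), and symmetry of the second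
  -- derivatives finishes.
  have h0 : HasFDerivAt (fun y => fderiv ℝ f₂ y (J (fderiv ℝ f₁ y))) (0 : F →L[ℝ] ℝ) y :=
    (hasFDerivAt_const (0 : ℝ) y).congr_of_eventuallyEq (by
      filter_upwards [hΩ.mem_nhds hy] with z hz using hbr z hz)
  have h := DFunLike.congr_fun (((hd h₂).clm_apply (hX h₁)).unique h0) a
  simp only [add_apply, ContinuousLinearMap.comp_apply, ContinuousLinearMap.flip_apply,
    zero_apply] at h
  rw [hJ] at h
  change fderiv ℝ (fderiv ℝ f₁) y (J (fderiv ℝ f₂ y)) a =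
    fderiv ℝ (fderiv ℝ f₂) y (J (fderiv ℝ f₁ y)) a
  rw [hs h₁, hs h₂ (J _) a]
  linarith

/-- Second order Taylor estimate for a vector field with Lipschitz derivative. -/
theorem norm_sub_fderiv_le {X : F → F} {B : Set F} (hB : Convex ℝ B)
    (hd : ∀ y ∈ B, DifferentiableAt ℝ X y) {K : NNReal} (hK : LipschitzOnWith K (fderiv ℝ X) B)
    {y w : F} (hy : y ∈ B) (hw : y + w ∈ B) :
    ‖X (y + w) - X y - fderiv ℝ X y w‖ ≤ K * ‖w‖ ^ 2 := by
  have hseg : segment ℝ y (y + w) ⊆ B := hB.segment_subset hy hw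
  have h := (convex_segment y (y + w)).norm_image_sub_le_of_norm_fderiv_le' (𝕜 := ℝ) (f := X)
    (φ := fderiv ℝ X y) (C := K * ‖w‖) (fun z hz => hd z (hseg hz)) (fun z hz => by
      refine (hK.norm_sub_le (hseg hz) hy).trans ?_
      refine mul_le_mul_of_nonneg_left ?_ K.coe_nonneg
      obtain ⟨θ, hθ, rfl⟩ := (segment_eq_image' ℝ y (y + w)) ▸ hz
      rw [add_sub_cancel_left, add_sub_cancel_left, norm_smul, Real.norm_of_nonneg hθ.1]
      exact mul_le_of_le_one_left (norm_nonneg w) hθ.2)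
    (left_mem_segment ℝ y (y + w)) (right_mem_segment ℝ y (y + w))
  rw [add_sub_cancel_left] at h
  rwa [sq, ← mul_assoc]

/-- The flow of a vector field maps the direction of a commuting vector field to itself. -/
theorem hasDerivAt_flow_of_comm [FiniteDimensional ℝ F] {X₁ X₂ : F → F} {Ω : Set F}
    (hΩ : IsOpen Ω)
    (h₁ : ContDiffOn ℝ ∞ X₁ Ω) (h₂ : ContDiffOn ℝ ∞ X₂ Ω)
    (hcomm : ∀ y ∈ Ω, fderiv ℝ X₁ y (X₂ y) = fderiv ℝ X₂ y (X₁ y)) {y₀ : F} {R : ℝ} (hR : 0 < R)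
    (hRΩ : Metric.closedBall y₀ (2 * R) ⊆ Ω) {A : F → ℝ → F} {W : Set F} {t : ℝ} (ht : 0 ≤ t)
    (hA0 : ∀ z ∈ W, A z 0 = z)
    (hA : ∀ z ∈ W, ∀ τ ∈ Icc 0 t, HasDerivAt (A z) (X₂ (A z τ)) τ)
    (hAR : ∀ z ∈ W, ∀ τ ∈ Icc 0 t, A z τ ∈ Metric.closedBall y₀ R) {c : ℝ → F} {s₀ : ℝ}
    (hW : W ∈ 𝓝 (c s₀)) (hc : HasDerivAt c (X₁ (c s₀)) s₀) :
    HasDerivAt (fun s => A (c s) t) (X₁ (A (c s₀) t)) s₀ := by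
  set B := Metric.closedBall y₀ (2 * R) with hB
  have hBR : Metric.closedBall y₀ R ⊆ B := Metric.closedBall_subset_closedBall (by linarith)
  have hBconv : Convex ℝ B := convex_closedBall y₀ (2 * R)
  have hBc : IsCompact B := isCompact_closedBall y₀ (2 * R)
  have hdiff : ∀ {X : F → F}, ContDiffOn ℝ ∞ X Ω → ∀ y ∈ B, DifferentiableAt ℝ X y :=
    fun hX y hy => (hX.contDiffAt (hΩ.mem_nhds (hRΩ hy))).differentiableAt (by norm_num)
  have hlip : ∀ {G : Type _} [NormedAddCommGroup G] [NormedSpace ℝ G] {X : F → G},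
      ContDiffOn ℝ ∞ X Ω → ∃ K : NNReal, LipschitzOnWith K X B := by
    intro G _ _ X hX
    obtain ⟨C, hC⟩ := hBc.exists_bound_of_continuousOn
      ((hX.fderiv_of_isOpen hΩ (m := ∞) (by norm_num)).continuousOn.mono hRΩ)
    refine ⟨C.toNNReal, hBconv.lipschitzOnWith_of_nnnorm_fderiv_le (𝕜 := ℝ) (fun y hy =>
      (hX.contDiffAt (hΩ.mem_nhds (hRΩ hy))).differentiableAt (by norm_num)) fun y hy => ?_⟩
    rw [← NNReal.coe_le_coe]
    exact (hC y hy).trans (Real.le_coe_toNNReal C)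
  obtain ⟨K₀, hK₀⟩ := hlip h₂
  obtain ⟨K₁, hK₁⟩ := hlip (h₂.fderiv_of_isOpen hΩ (m := ∞) (by norm_num))
  obtain ⟨N₀, hN₀⟩ := hBc.exists_bound_of_continuousOn (h₁.continuousOn.mono hRΩ)
  -- The summand 1 makes K nonzero, as the explicit Grönwall bound requires.
  set K : NNReal := K₀ + 1 with hKdef
  have hK : LipschitzOnWith K X₂ B := hK₀.weaken (by simp [hKdef])
  have hKne : (K : ℝ) ≠ 0 := by simp only [hKdef, NNReal.coe_add, NNReal.coe_one]; positivity
  set N := |N₀| + 1 with hN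
  have hN0 : 0 < N := by positivity
  have hNX : ∀ y ∈ B, ‖X₁ y‖ ≤ N := fun y hy => (hN₀ y hy).trans
    ((le_abs_self N₀).trans (by simp [hN]))
  have hWs : c s₀ ∈ W := mem_of_mem_nhds hW
  have hest : ∀ᶠ s in 𝓝 s₀, ‖A (c s) t - A (c s₀) t - (s - s₀) • X₁ (A (c s₀) t)‖ ≤
      ‖c s - c s₀ - (s - s₀) • X₁ (c s₀)‖ * Real.exp (K * t) +
        K₁ * N ^ 2 / K * (Real.exp (K * t) - 1) * |s - s₀| ^ 2 := by
    have hnear : ∀ᶠ s in 𝓝 s₀, |s - s₀| * N ≤ R := by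
      have h : ContinuousAt (fun s : ℝ => |s - s₀| * N) s₀ := by fun_prop
      exact (h.eventually (gt_mem_nhds (by simpa using hR))).mono fun s hs => le_of_lt hs
    filter_upwards [hc.continuousAt.eventually hW, hnear] with s hs hsR
    set h := s - s₀ with hh
    set y : ℝ → F := A (c s₀) with hy
    have hyB : ∀ τ ∈ Icc 0 t, y τ ∈ B := fun τ hτ => hBR (hAR _ hWs τ hτ)
    have hgB : ∀ τ ∈ Icc 0 t, y τ + h • X₁ (y τ) ∈ B := by
      intro τ hτ
      have h1 := hAR _ hWs τ hτ
      rw [mem_closedBall_iff_norm] at h1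
      rw [hB, mem_closedBall_iff_norm]
      calc ‖y τ + h • X₁ (y τ) - y₀‖ = ‖(y τ - y₀) + h • X₁ (y τ)‖ := by congr 1; abel
        _ ≤ ‖y τ - y₀‖ + ‖h • X₁ (y τ)‖ := norm_add_le _ _
        _ ≤ R + |h| * N := by
          rw [norm_smul, Real.norm_eq_abs]
          exact add_le_add h1 (mul_le_mul_of_nonneg_left (hNX _ (hyB τ hτ)) (abs_nonneg h))
        _ ≤ 2 * R := by linarith
    have hg : ∀ τ ∈ Icc 0 t, HasDerivAt (fun τ => y τ + h • X₁ (y τ))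
        (X₂ (y τ) + h • fderiv ℝ X₁ (y τ) (X₂ (y τ))) τ := fun τ hτ =>
      (hA _ hWs τ hτ).add
        (((hdiff h₁ _ (hyB τ hτ)).hasFDerivAt.comp_hasDerivAt τ (hA _ hWs τ hτ)).const_smul h)
    -- Along a trajectory y of X₂, commutation makes y + hX₁(y) an X₂-trajectory up to an error
    -- O(h²). Grönwall compares it with the exact trajectory from c(s), whose initial distance is
    -- o(h). Differentiability of the flow in its initial value is not needed.
    have hgr := dist_le_of_approx_trajectories_ODE_of_mem (v := fun _ => X₂) (s := fun _ => B)
      (K := K) (f := A (c s)) (g := fun τ => y τ + h • X₁ (y τ)) (a := 0) (b := t)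
      (f' := fun τ => X₂ (A (c s) τ)) (εf := 0) (εg := K₁ * N ^ 2 * |h| ^ 2)
      (δ := ‖c s - c s₀ - h • X₁ (c s₀)‖)
      (fun _ _ => hK)
      (fun τ hτ => (hA _ hs τ hτ).continuousAt.continuousWithinAt)
      (fun τ hτ => (hA _ hs τ (Ico_subset_Icc_self hτ)).hasDerivWithinAt)
      (fun τ _ => by simp)
      (fun τ hτ => hBR (hAR _ hs τ (Ico_subset_Icc_self hτ)))
      (fun τ hτ => (hg τ hτ).continuousAt.continuousWithinAt)
      (fun τ hτ => (hg τ (Ico_subset_Icc_self hτ)).hasDerivWithinAt)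
      (fun τ hτ => by
        have hτ' := Ico_subset_Icc_self hτ
        have h1 := norm_sub_fderiv_le hBconv (hdiff h₂) hK₁ (hyB τ hτ') (hgB τ hτ')
        rw [hcomm _ (hRΩ (hyB τ hτ')), dist_comm, dist_eq_norm]
        rw [map_smul] at h1
        rw [← sub_sub]
        refine h1.trans ?_
        rw [norm_smul, Real.norm_eq_abs, mul_pow]
        have h2 := pow_le_pow_left₀ (norm_nonneg _) (hNX _ (hyB τ hτ')) 2
        calc (K₁ : ℝ) * (|h| ^ 2 * ‖X₁ (y τ)‖ ^ 2) ≤ K₁ * (|h| ^ 2 * N ^ 2) := by gcongr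
          _ = _ := by ring)
      (fun τ hτ => hgB τ (Ico_subset_Icc_self hτ))
      (by
        simp only [hy]
        rw [hA0 _ hs, hA0 _ hWs, dist_eq_norm, sub_sub]) t ⟨ht, le_rfl⟩
    rw [dist_eq_norm, gronwallBound_of_K_ne_0 hKne, sub_zero, zero_add, ← sub_sub] at hgr
    refine hgr.trans (le_of_eq ?_)
    ring
  rw [hasDerivAt_iff_isLittleO]
  refine Asymptotics.IsBigO.trans_isLittleO (g := fun s =>
    ‖c s - c s₀ - (s - s₀) • X₁ (c s₀)‖ * Real.exp (K * t) +
      K₁ * N ^ 2 / K * (Real.exp (K * t) - 1) * |s - s₀| ^ 2)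
    (Asymptotics.IsBigO.of_bound' (hest.mono fun s hs => hs.trans (le_abs_self _))) ?_
  have hc' := hasDerivAt_iff_isLittleO.1 hc
  refine Asymptotics.IsLittleO.add ?_ ?_
  · simpa [mul_comm] using (hc'.norm_left.const_mul_left (Real.exp (K * t)))
  · have h1 : (fun s : ℝ => |s - s₀| ^ 2) =o[𝓝 s₀] fun s => s - s₀ := by
      have : Filter.Tendsto (fun s : ℝ => s - s₀) (𝓝 s₀) (𝓝 0) := by
        have h : ContinuousAt (fun s : ℝ => s - s₀) s₀ := by fun_prop
        simpa using h.tendsto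
      simp only [sq_abs]
      exact (Asymptotics.isLittleO_pow_id (𝕜 := ℝ) one_lt_two).comp_tendsto this
    exact h1.const_mul_left _

/-- A local flow of a vector field, and its effect on integral curves of a commuting field. -/
theorem exists_local_flow_of_comm [FiniteDimensional ℝ F] {X₁ X₂ : F → F} {Ω : Set F}
    (hΩ : IsOpen Ω)
    (h₁ : ContDiffOn ℝ ∞ X₁ Ω) (h₂ : ContDiffOn ℝ ∞ X₂ Ω)
    (hcomm : ∀ y ∈ Ω, fderiv ℝ X₁ y (X₂ y) = fderiv ℝ X₂ y (X₁ y)) {y₀ : F} (hy₀ : y₀ ∈ Ω) :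
    ∃ (A : F → ℝ → F) (W : Set F) (δ : ℝ), IsOpen W ∧ y₀ ∈ W ∧ 0 < δ ∧
      (∀ z ∈ W, A z 0 = z) ∧
      (∀ z ∈ W, ∀ t ∈ Ioo (-δ) δ, HasDerivAt (A z) (X₂ (A z t)) t ∧ A z t ∈ Ω) ∧
      ∀ (c : ℝ → F) (s₀ : ℝ), c s₀ ∈ W → HasDerivAt c (X₁ (c s₀)) s₀ → ∀ t ∈ Ioo (-δ) δ,
        HasDerivAt (fun s => A (c s) t) (X₁ (A (c s₀) t)) s₀ := by
  obtain ⟨ε, hε, a, r, L, K, hr, hpl⟩ := IsPicardLindelof.of_contDiffAt_one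
    ((h₂.contDiffAt (hΩ.mem_nhds hy₀)).of_le (m := 1) (by norm_num))
  obtain ⟨α, hα, hαc⟩ := (hpl 0).exists_forall_mem_closedBall_eq_hasDerivWithinAt_continuousOn
  obtain ⟨R', hR', hR'Ω⟩ := Metric.nhds_basis_closedBall.mem_iff.1 (hΩ.mem_nhds hy₀)
  set R := R' / 2 with hRdef
  have hR : 0 < R := by positivity
  have hRΩ : Metric.closedBall y₀ (2 * R) ⊆ Ω := by
    rwa [hRdef, mul_div_cancel₀ _ (two_ne_zero' ℝ)]
  have hnhds : Metric.closedBall y₀ (r : ℝ) ×ˢ Icc (0 - ε) (0 + ε) ∈ 𝓝 (y₀, (0 : ℝ)) :=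
    prod_mem_nhds (Metric.closedBall_mem_nhds y₀ hr) (Icc_mem_nhds (by linarith) (by linarith))
  have hα0 : α (y₀, 0) = y₀ := (hα y₀ (Metric.mem_closedBall_self hr.le)).1
  have hev : ∀ᶠ p in 𝓝 (y₀, (0 : ℝ)), α p ∈ Metric.closedBall y₀ R := by
    have h := (hαc.continuousAt hnhds).eventually
      (Metric.closedBall_mem_nhds (α (y₀, 0)) hR)
    rwa [hα0] at h
  obtain ⟨W', hW', I, hI, hWI⟩ := mem_nhds_prod_iff.1 (hev.and hnhds)
  obtain ⟨δ, hδ, hδI⟩ := Metric.mem_nhds_iff.1 hI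
  rw [Real.ball_eq_Ioo, zero_sub, zero_add] at hδI
  obtain ⟨W, hWW', hWo, hy₀W⟩ := mem_nhds_iff.1 hW'
  have hball : ∀ z ∈ W, ∀ t ∈ Ioo (-δ) δ, α (z, t) ∈ Metric.closedBall y₀ R ∧
      z ∈ Metric.closedBall y₀ (r : ℝ) := fun z hz t ht =>
    have h := hWI (show (z, t) ∈ W' ×ˢ I from ⟨hWW' hz, hδI ht⟩)
    ⟨h.1, h.2.1⟩
  have h0δ : (0 : ℝ) ∈ Ioo (-δ) δ := ⟨by linarith, hδ⟩
  have hder : ∀ z ∈ W, ∀ t ∈ Ioo (-δ) δ, HasDerivAt (fun t => α (z, t)) (X₂ (α (z, t))) t := by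
    intro z hz t ht
    refine ((hα z (hball z hz 0 h0δ).2).2 t
      (hWI (show (z, t) ∈ W' ×ˢ I from ⟨hWW' hz, hδI ht⟩)).2.2).hasDerivAt ?_
    filter_upwards [isOpen_Ioo.mem_nhds ht] with t' ht'
    exact (hWI (show (z, t') ∈ W' ×ˢ I from ⟨hWW' hz, hδI ht'⟩)).2.2
  have hstart : ∀ z ∈ W, α (z, 0) = z := fun z hz => (hα z (hball z hz 0 h0δ).2).1
  have hR2 : Metric.closedBall y₀ R ⊆ Ω :=
    (Metric.closedBall_subset_closedBall (by linarith)).trans hRΩ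
  refine ⟨fun z t => α (z, t), W, δ, hWo, hy₀W, hδ, hstart, fun z hz t ht =>
    ⟨hder z hz t ht, hR2 (hball z hz t ht).1⟩, fun c s₀ hcW hc t ht => ?_⟩
  rcases le_total 0 t with ht0 | ht0
  · have hsub : ∀ τ ∈ Icc 0 t, τ ∈ Ioo (-δ) δ := fun τ hτ =>
      ⟨by linarith [hτ.1], hτ.2.trans_lt ht.2⟩
    exact hasDerivAt_flow_of_comm hΩ h₁ h₂ hcomm hR hRΩ (A := fun z t => α (z, t)) ht0 hstart
      (fun z hz τ hτ => hder z hz τ (hsub τ hτ)) (fun z hz τ hτ => (hball z hz τ (hsub τ hτ)).1)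
      (hWo.mem_nhds hcW) hc
  -- Negative times follow by reversing time, with -X₂ in place of X₂.
  · have hsub : ∀ τ ∈ Icc 0 (-t), -τ ∈ Ioo (-δ) δ := fun τ hτ =>
      ⟨by linarith [hτ.2, ht.1], by linarith [hτ.1]⟩
    have := hasDerivAt_flow_of_comm hΩ h₁ h₂.neg
      (fun y hy => by
        rw [fderiv_fun_neg, map_neg, hcomm y hy]
        rfl) hR hRΩ
      (A := fun z τ => α (z, -τ)) (neg_nonneg.2 ht0)
      (fun z hz => by simpa using hstart z hz)
      (fun z hz τ hτ => by
        simpa [Function.comp_def] using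
          (hder z hz (-τ) (hsub τ hτ)).scomp τ (hasDerivAt_neg τ))
      (fun z hz τ hτ => (hball z hz (-τ) (hsub τ hτ)).1) (hWo.mem_nhds hcW) hc
    simpa using this

end CommutingFields

end CommutingActions

namespace CommutingActions

variable {n : ℕ} {M : Type*} [TopologicalSpace M] [ChartedSpace (Coord n) M]

/-! ### Hamiltonian vector fields in canonical coordinates -/

/-- The map `(α_q, α_p) ↦ (α_p, -α_q)` from linear forms to vectors of `ℝⁿ × ℝⁿ`. -/
noncomputable def symplecticGradient (n : ℕ) :
    (Coord n × Coord n →L[ℝ] ℝ) →L[ℝ] Coord n × Coord n :=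
  LinearMap.toContinuousLinearMap
    { toFun := fun α => (WithLp.toLp 2 fun j => α (0, basisVec j),
        WithLp.toLp 2 fun j => -α (basisVec j, 0))
      map_add' := fun α β => by
        refine Prod.ext ?_ ?_ <;> ext j
        · rfl
        · exact neg_add _ _
      map_smul' := fun c α => by
        refine Prod.ext ?_ ?_ <;> ext j
        · rfl
        · exact (mul_neg c _).symm }

theorem symplecticGradient_fst (α : Coord n × Coord n →L[ℝ] ℝ) (j : Fin n) :
    (symplecticGradient n α).1 j = α (0, basisVec j) := rfl

theorem symplecticGradient_snd (α : Coord n × Coord n →L[ℝ] ℝ) (j : Fin n) :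
    (symplecticGradient n α).2 j = -α (basisVec j, 0) := rfl

theorem apply_eq_sum_basisVec (α : Coord n →L[ℝ] ℝ) (v : Coord n) :
    α v = ∑ j, v j * α (basisVec j) := by
  conv_lhs => rw [← sum_smul_basisVec v, map_sum]
  simp

theorem inner_apply_inverse_basisVec {A : Coord n ≃L[ℝ] Coord n} {B : Coord n →L[ℝ] Coord n}
    (hA : (A : Coord n →L[ℝ] Coord n) = B) (b : Coord n) (j : Fin n) :
    inner ℝ b (B (B.inverse (basisVec j))) = b j := by
  subst hA
  rw [ContinuousLinearMap.inverse_equiv]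
  simp [basisVec, EuclideanSpace.inner_single_right]

theorem innerSL_comp_eq {A : Coord n ≃L[ℝ] Coord n} {B : Coord n →L[ℝ] Coord n}
    (hA : (A : Coord n →L[ℝ] Coord n) = B) (p : Coord n →L[ℝ] ℝ) :
    (innerSL ℝ (WithLp.toLp 2 fun j => p (B.inverse (basisVec j)) : Coord n)).comp B = p := by
  subst hA
  rw [ContinuousLinearMap.inverse_equiv]
  ext v
  have h1 := apply_eq_sum_basisVec (p.comp (A.symm : Coord n →L[ℝ] Coord n)) (A v)
  simp only [ContinuousLinearMap.comp_apply, ContinuousLinearEquiv.coe_coe,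
    A.symm_apply_apply] at h1
  rw [h1]
  simp [PiLp.inner_apply]

theorem apply_symplecticGradient (α β : Coord n × Coord n →L[ℝ] ℝ) :
    α (symplecticGradient n β) =
      ∑ j, (β (0, basisVec j) * α (basisVec j, 0) - β (basisVec j, 0) * α (0, basisVec j)) := by
  have h1 := apply_eq_sum_basisVec (α.comp (ContinuousLinearMap.inl ℝ (Coord n) (Coord n)))
    (symplecticGradient n β).1
  have h2 := apply_eq_sum_basisVec (α.comp (ContinuousLinearMap.inr ℝ (Coord n) (Coord n)))
    (symplecticGradient n β).2
  have h3 : α (symplecticGradient n β) = α ((symplecticGradient n β).1, 0) +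
      α (0, (symplecticGradient n β).2) := by
    rw [← map_add]
    simp
  simp only [ContinuousLinearMap.comp_apply, ContinuousLinearMap.inl_apply,
    ContinuousLinearMap.inr_apply, symplecticGradient_fst, symplecticGradient_snd] at h1 h2
  rw [h3, h1, h2, ← Finset.sum_add_distrib]
  exact Finset.sum_congr rfl fun j _ => by ring

theorem symplecticGradient_antisymm (α β : Coord n × Coord n →L[ℝ] ℝ) :
    α (symplecticGradient n β) = -β (symplecticGradient n α) := by
  rw [apply_symplecticGradient, apply_symplecticGradient, ← Finset.sum_neg_distrib]
  exact Finset.sum_congr rfl fun j _ => by ring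

/-- The Hamiltonian vector field in canonical coordinates. -/
noncomputable def hamField (φ : OpenPartialHomeomorph M (Coord n)) (H : Cotan n M → ℝ)
    (y : Coord n × Coord n) : Coord n × Coord n :=
  symplecticGradient n (fderiv ℝ (H ∘ ofCoords φ) y)

theorem IsSmoothFun.contDiffOn_hamField {H : Cotan n M → ℝ} (hH : IsSmoothFun H)
    {φ : OpenPartialHomeomorph M (Coord n)} (hφ : φ ∈ IsManifold.maximalAtlas (𝓡 n) ∞ M) :
    ContDiffOn ℝ ∞ (hamField φ H) (φ.target ×ˢ univ) :=
  (symplecticGradient n).contDiff.comp_contDiffOn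
    ((hH φ hφ).fderiv_of_isOpen (φ.open_target.prod isOpen_univ) (m := ∞) (by norm_num))

section Coordinates

variable [IsManifold (𝓡 n) ∞ M] {φ : OpenPartialHomeomorph M (Coord n)}

theorem coords_ofCoords (hφ : φ ∈ IsManifold.maximalAtlas (𝓡 n) ∞ M) {y : Coord n × Coord n}
    (hy : y.1 ∈ φ.target) : coords φ (ofCoords φ y) = y := by
  obtain ⟨A, hA, -⟩ := exists_equiv_mfderiv hφ (φ.map_target hy)
  refine Prod.ext (φ.right_inv hy) ?_
  ext j
  exact inner_apply_inverse_basisVec hA y.2 j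

theorem ofCoords_coords (hφ : φ ∈ IsManifold.maximalAtlas (𝓡 n) ∞ M) {z : Cotan n M}
    (hz : z.1 ∈ φ.source) : ofCoords φ (coords φ z) = z := by
  obtain ⟨A, hA, -⟩ := exists_equiv_mfderiv hφ hz
  obtain ⟨q, p⟩ := z
  have h := φ.left_inv hz
  unfold ofCoords coords
  dsimp only at h hA ⊢
  rw [h]
  exact congrArg (Bundle.TotalSpace.mk q) (innerSL_comp_eq hA p)

theorem PoissonCommute.fderiv_hamField {f g : Cotan n M → ℝ} (h : PoissonCommute f g)
    (hφ : φ ∈ IsManifold.maximalAtlas (𝓡 n) ∞ M) {y : Coord n × Coord n} (hy : y.1 ∈ φ.target) :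
    fderiv ℝ (g ∘ ofCoords φ) y (hamField φ f y) = 0 := by
  have h1 := h φ hφ (ofCoords φ y) (φ.map_target hy)
  simp only [poissonBracket, dp, dq, coords_ofCoords hφ hy] at h1
  rw [hamField, apply_symplecticGradient, h1]

end Coordinates

/-! ### Hamiltonian curves -/

/-- The curve solves Hamilton's equations for all times close to `t₀`, in some canonical
coordinates. -/
def IsLocalCurve (H : Cotan n M → ℝ) (η : ℝ → Cotan n M) (t₀ : ℝ) : Prop :=
  ∃ φ ∈ IsManifold.maximalAtlas (𝓡 n) ∞ M, ∀ᶠ t in 𝓝 t₀, (η t).1 ∈ φ.source ∧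
    HasDerivAt (fun s => coords φ (η s)) (hamField φ H (coords φ (η t))) t

variable {H H₁ H₂ : Cotan n M → ℝ} {Γ η : ℝ → Cotan n M}

theorem hasDerivAt_coord {f : ℝ → Coord n} {f' : Coord n} {t : ℝ}
    (h : ∀ j, HasDerivAt (fun s => f s j) (f' j) t) : HasDerivAt f f' t := by
  have h1 : HasDerivAt (fun s => WithLp.ofLp (f s)) (WithLp.ofLp f') t := hasDerivAt_pi.2 h
  exact (EuclideanSpace.equiv (Fin n) ℝ).symm.toContinuousLinearMap.hasFDerivAt.comp_hasDerivAt t h1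

theorem IsHamiltonianCurve.eventually (hΓ : IsHamiltonianCurve H Γ)
    {φ : OpenPartialHomeomorph M (Coord n)} (hφ : φ ∈ IsManifold.maximalAtlas (𝓡 n) ∞ M) {t₀ : ℝ}
    (ht₀ : (Γ t₀).1 ∈ φ.source) : ∀ᶠ t in 𝓝 t₀, (Γ t).1 ∈ φ.source ∧
      HasDerivAt (fun s => coords φ (Γ s)) (hamField φ H (coords φ (Γ t))) t := by
  filter_upwards [hΓ.continuous_base.continuousAt.eventually (φ.open_source.mem_nhds ht₀)] with t ht
  exact ⟨ht, (hasDerivAt_coord (hΓ.hasDerivAt_q φ hφ t ht)).prodMk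
    (hasDerivAt_coord (hΓ.hasDerivAt_p φ hφ t ht))⟩

theorem IsHamiltonianCurve.comp_add_const (hΓ : IsHamiltonianCurve H Γ) (a : ℝ) :
    IsHamiltonianCurve H fun t => Γ (t + a) where
  continuous_base := hΓ.continuous_base.comp (continuous_add_const a)
  hasDerivAt_q φ hφ t ht j := (hΓ.hasDerivAt_q φ hφ (t + a) ht j).comp_add_const t a
  hasDerivAt_p φ hφ t ht j := (hΓ.hasDerivAt_p φ hφ (t + a) ht j).comp_add_const t a

theorem IsLocalCurve.continuousAt_base (hη : IsLocalCurve H η t₀) :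
    ContinuousAt (fun t => (η t).1) t₀ := by
  obtain ⟨φ, -, h⟩ := hη
  have h1 : ContinuousAt (fun t => φ.symm (coords φ (η t)).1) t₀ :=
    ContinuousAt.comp (g := φ.symm) (φ.continuousAt_symm (φ.map_source h.self_of_nhds.1))
      h.self_of_nhds.2.continuousAt.fst
  exact h1.congr (h.mono fun t ht => φ.left_inv ht.1)

variable [IsManifold (𝓡 n) ∞ M]

theorem IsHamiltonianCurve.isLocalCurve (hΓ : IsHamiltonianCurve H Γ) (t : ℝ) :
    IsLocalCurve H Γ t :=
  ⟨_, IsManifold.chart_mem_maximalAtlas _, hΓ.eventually (IsManifold.chart_mem_maximalAtlas _)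
    (mem_chart_source (Coord n) _)⟩

/-- Local uniqueness is the Lipschitz uniqueness theorem in the chart that witnesses `IsLocalCurve`.
-/
theorem IsHamiltonianCurve.eventuallyEq (hH : IsSmoothFun H) (hΓ : IsHamiltonianCurve H Γ)
    {t₀ : ℝ} (hη : IsLocalCurve H η t₀) (h : Γ t₀ = η t₀) : Γ =ᶠ[𝓝 t₀] η := by
  obtain ⟨φ, hφ, hη⟩ := hη
  have hΓφ := hΓ.eventually hφ (h ▸ hη.self_of_nhds.1)
  have hX := ((hH.contDiffOn_hamField hφ).contDiffAt ((φ.open_target.prod isOpen_univ).mem_nhds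
    (x := coords φ (η t₀)) ⟨φ.map_source hη.self_of_nhds.1, trivial⟩)).of_le (m := 1) (by norm_num)
  obtain ⟨K, B, hB, hK⟩ := hX.exists_lipschitzOnWith
  have h1 := ODE_solution_unique_of_eventually (v := fun _ => hamField φ H) (s := fun _ => B)
    (K := K) (t₀ := t₀) (f := fun t => coords φ (Γ t)) (g := fun t => coords φ (η t))
    (.of_forall fun _ => hK)
    ((hΓφ.mono fun t ht => ht.2).and (hΓφ.self_of_nhds.2.continuousAt.eventually
      (show B ∈ 𝓝 (coords φ (Γ t₀)) by rwa [h])))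
    ((hη.mono fun t ht => ht.2).and (hη.self_of_nhds.2.continuousAt.eventually hB))
    (congrArg (coords φ) h)
  filter_upwards [h1, hΓφ, hη] with t h1 h2 h3
  rw [← ofCoords_coords hφ h2.1, ← ofCoords_coords hφ h3.1]
  exact congrArg (ofCoords φ) h1

/-- Uniqueness of solutions of Hamilton's equations. -/
theorem IsHamiltonianCurve.eqOn [T2Space M] (hH : IsSmoothFun H) (hΓ : IsHamiltonianCurve H Γ)
    {I : Set ℝ} (hI : IsPreconnected I) (hη : ∀ t ∈ I, IsLocalCurve H η t) {t₀ : ℝ} (ht₀ : t₀ ∈ I)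
    (h : Γ t₀ = η t₀) : EqOn Γ η I := by
  have hsub : I ⊆ {t | Γ =ᶠ[𝓝 t] η} := by
    refine hI.subset_of_closure_inter_subset isOpen_setOfPred_eventually_nhds
      ⟨t₀, ht₀, hΓ.eventuallyEq hH (hη t₀ ht₀) h⟩ ?_
    rintro t ⟨ht, htI⟩
    refine hΓ.eventuallyEq hH (hη t htI) ?_
    have hfr : ∃ᶠ s in 𝓝 t, Γ s = η s :=
      (mem_closure_iff_frequently.1 ht).mono fun s hs => Filter.EventuallyEq.eq_of_nhds hs
    -- Limits are compared first in the Hausdorff manifold M, which puts both curves in one chart,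
    -- and then in coordinates. No topology on T*M is involved.
    have hbase : (Γ t).1 = (η t).1 := tendsto_nhds_unique_of_frequently_eq
      hΓ.continuous_base.continuousAt (hη t htI).continuousAt_base
      (hfr.mono fun s hs => congrArg Bundle.TotalSpace.proj hs)
    obtain ⟨φ, hφ, hηφ⟩ := hη t htI
    have hηt := hηφ.self_of_nhds
    have hΓt := (hΓ.eventually hφ (hbase ▸ hηt.1)).self_of_nhds
    have h1 : coords φ (Γ t) = coords φ (η t) := tendsto_nhds_unique_of_frequently_eq
      hΓt.2.continuousAt hηt.2.continuousAt (hfr.mono fun s hs => congrArg (coords φ) hs)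
    rw [← ofCoords_coords hφ hΓt.1, ← ofCoords_coords hφ hηt.1, h1]
  exact fun t ht => Filter.EventuallyEq.eq_of_nhds (hsub ht)

/-! ### Hamiltonian flows -/

variable [T2Space M] {F F₁ F₂ : ℝ → Cotan n M → Cotan n M}

theorem IsHamiltonianFlow.map_add (hH : IsSmoothFun H) (hF : IsHamiltonianFlow H F) (s t : ℝ)
    (z : Cotan n M) : F (s + t) z = F s (F t z) :=
  ((hF z).2.comp_add_const t).eqOn hH isPreconnected_univ
    (fun s _ => (hF (F t z)).2.isLocalCurve s) (mem_univ 0)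
    (by rw [zero_add, (hF (F t z)).1]) (mem_univ s)

theorem IsHamiltonianFlow.injective (hH : IsSmoothFun H) (hF : IsHamiltonianFlow H F) (t : ℝ) :
    Function.Injective (F t) :=
  Function.LeftInverse.injective (g := F (-t)) fun z => by
    rw [← hF.map_add hH, neg_add_cancel, (hF z).1]

/-- For short times, the flow of a Poisson commuting Hamilton function maps Hamiltonian curves to
Hamiltonian curves. -/
theorem IsHamiltonianFlow.eventually_isLocalCurve (hH₁ : IsSmoothFun H₁) (hH₂ : IsSmoothFun H₂)
    (hcomm : PoissonCommute H₁ H₂) (hF₂ : IsHamiltonianFlow H₂ F₂) (hΓ : IsHamiltonianCurve H₁ Γ)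
    (s₁ : ℝ) : ∀ᶠ p in 𝓝 ((0 : ℝ), s₁), IsLocalCurve H₁ (fun s => F₂ p.1 (Γ s)) p.2 := by
  obtain ⟨φ, hφ, hΓφ⟩ := hΓ.isLocalCurve s₁
  obtain ⟨A, W, δ, hW, hyW, hδ, hA0, hA, hAc⟩ := exists_local_flow_of_comm (φ.open_target.prod isOpen_univ)
    (hH₁.contDiffOn_hamField hφ) (hH₂.contDiffOn_hamField hφ)
    (fun y hy => fderiv_field_comm (φ.open_target.prod isOpen_univ) (hH₁ φ hφ) (hH₂ φ hφ)
      symplecticGradient_antisymm (fun y hy => hcomm.fderiv_hamField hφ hy.1) hy)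
    (y₀ := coords φ (Γ s₁)) ⟨φ.map_source hΓφ.self_of_nhds.1, trivial⟩
  -- The given flow is only known to solve the equations for each initial point; uniqueness
  -- identifies it with the local flow A, whose behaviour under change of the initial point is
  -- known.
  have hflow : ∀ z : Cotan n M, z.1 ∈ φ.source → coords φ z ∈ W → ∀ t ∈ Ioo (-δ) δ,
      F₂ t z = ofCoords φ (A (coords φ z) t) := by
    intro z hz hzW
    refine (hF₂ z).2.eqOn hH₂ isPreconnected_Ioo (t₀ := 0) (fun t ht => ⟨φ, hφ, ?_⟩)
      ⟨by linarith, hδ⟩ ?_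
    · have hco : ∀ s ∈ Ioo (-δ) δ,
          coords φ (ofCoords φ (A (coords φ z) s)) = A (coords φ z) s :=
        fun s hs => coords_ofCoords hφ (hA _ hzW s hs).2.1
      filter_upwards [isOpen_Ioo.mem_nhds ht] with s hs
      refine ⟨φ.map_target (hA _ hzW s hs).2.1, ?_⟩
      rw [hco s hs]
      refine (hA _ hzW s hs).1.congr_of_eventuallyEq ?_
      filter_upwards [isOpen_Ioo.mem_nhds hs] with s' hs' using hco s' hs'
    · rw [(hF₂ z).1, hA0 _ hzW, ofCoords_coords hφ hz]
  have hQ := hΓφ.and (hΓφ.self_of_nhds.2.continuousAt.eventually (hW.mem_nhds hyW))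
  have hI : ∀ᶠ t in 𝓝 (0 : ℝ), t ∈ Ioo (-δ) δ := Ioo_mem_nhds (by linarith) hδ
  rw [nhds_prod_eq]
  filter_upwards [hI.prod_mk hQ.eventually_nhds] with ⟨t, s₂⟩ ⟨ht, hs₂⟩
  refine ⟨φ, hφ, ?_⟩
  have hco : ∀ s, (Γ s).1 ∈ φ.source → coords φ (Γ s) ∈ W →
      coords φ (F₂ t (Γ s)) = A (coords φ (Γ s)) t := fun s hs hsW => by
    rw [hflow _ hs hsW t ht, coords_ofCoords hφ (hA _ hsW t ht).2.1]
  filter_upwards [hs₂.eventually_nhds] with s hs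
  have hs0 := hs.self_of_nhds
  refine ⟨?_, ?_⟩
  · rw [hflow _ hs0.1.1 hs0.2 t ht]
    exact φ.map_target (hA _ hs0.2 t ht).2.1
  · change HasDerivAt (fun s => coords φ (F₂ t (Γ s))) (hamField φ H₁ (coords φ (F₂ t (Γ s)))) s
    rw [hco s hs0.1.1 hs0.2]
    exact (hAc (fun s => coords φ (Γ s)) s hs0.2 hs0.1.2 t ht).congr_of_eventuallyEq
      (hs.mono fun s' hs' => hco s' hs'.1.1 hs'.2)

/-- By compactness of the interval between 0 and s, one short time t works along the whole
trajectory piece. Its image under F₂ᵗ then solves the equations of H₁, and uniqueness identifies it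
with the trajectory through F₂ᵗz. -/
theorem IsHamiltonianFlow.eventually_comm (hH₁ : IsSmoothFun H₁) (hH₂ : IsSmoothFun H₂)
    (hcomm : PoissonCommute H₁ H₂) (hF₁ : IsHamiltonianFlow H₁ F₁) (hF₂ : IsHamiltonianFlow H₂ F₂)
    (s : ℝ) (z : Cotan n M) : ∀ᶠ t in 𝓝 (0 : ℝ), F₁ s (F₂ t z) = F₂ t (F₁ s z) := by
  have h := (isCompact_uIcc (a := 0) (b := s)).eventually_forall_of_forall_eventually
    (P := fun t s => IsLocalCurve H₁ (fun s => F₂ t (F₁ s z)) s)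
    fun s₁ _ => hF₂.eventually_isLocalCurve hH₁ hH₂ hcomm (hF₁ z).2 s₁
  filter_upwards [h] with t ht
  exact (hF₁ (F₂ t z)).2.eqOn hH₁ isPreconnected_uIcc ht left_mem_uIcc
    (by rw [(hF₁ _).1, (hF₁ z).1]) right_mem_uIcc

/-- The Hamiltonian flows of Poisson commuting functions commute. -/
theorem IsHamiltonianFlow.comm (hH₁ : IsSmoothFun H₁) (hH₂ : IsSmoothFun H₂)
    (hcomm : PoissonCommute H₁ H₂) (hF₁ : IsHamiltonianFlow H₁ F₁) (hF₂ : IsHamiltonianFlow H₂ F₂)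
    (s t : ℝ) (z : Cotan n M) : F₁ s (F₂ t z) = F₂ t (F₁ s z) := by
  -- The truth value of the identity is locally constant in t: near t₁ the short-time result at F₂
  -- applied to z reduces time t to time t₁, by the group law and injectivity of the flow. At t = 0
  -- the identity is trivial.
  have hconst : IsLocallyConstant fun t => F₁ s (F₂ t z) = F₂ t (F₁ s z) := by
    rw [IsLocallyConstant.iff_eventually_eq]
    intro t₁
    have hlim : Filter.Tendsto (fun t => t - t₁) (𝓝 t₁) (𝓝 0) := by
      have h : ContinuousAt (fun t : ℝ => t - t₁) t₁ := by fun_prop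
      simpa using h.tendsto
    filter_upwards [hlim.eventually
      (hF₁.eventually_comm hH₁ hH₂ hcomm hF₂ s (F₂ t₁ z))] with t ht
    rw [← hF₂.map_add hH₂, sub_add_cancel] at ht
    have h1 : F₂ t (F₁ s z) = F₂ (t - t₁) (F₂ t₁ (F₁ s z)) := by
      rw [← hF₂.map_add hH₂, sub_add_cancel]
    rw [ht, h1]
    exact propext (hF₂.injective hH₂ _).eq_iff
  have h := hconst.apply_eq_of_preconnectedSpace t 0
  rw [h, (hF₂ z).1, (hF₂ (F₁ s z)).1]

end CommutingActions

open CommutingActions in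
theorem theorem1 (n : ℕ) (M : Type*) [TopologicalSpace M] [ChartedSpace (Coord n) M]
    [IsManifold (𝓡 n) ∞ M] [CompactSpace M] [T2Space M]
    (L₁ L₂ : Tan n M → ℝ)
    (hL₁ : ContMDiff (𝓡 n).tangent 𝓘(ℝ, ℝ) ∞ L₁) (hL₂ : ContMDiff (𝓡 n).tangent 𝓘(ℝ, ℝ) ∞ L₂)
    (hnd₁ : Nondegenerate L₁) (hnd₂ : Nondegenerate L₂)
    (hleg₁ : ∀ q, Function.Surjective (legendre L₁ q))
    (hleg₂ : ∀ q, Function.Surjective (legendre L₂ q))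
    (hmin₁ : HasMinimizers L₁) (hmin₂ : HasMinimizers L₂)
    (hcomm : ActionsCommute L₁ L₂) :
    IsSmoothFun (hamiltonian L₁) ∧ IsSmoothFun (hamiltonian L₂) ∧
      (∀ F₁ F₂ : ℝ → Cotan n M → Cotan n M,
        IsHamiltonianFlow (hamiltonian L₁) F₁ → IsHamiltonianFlow (hamiltonian L₂) F₂ →
          ∀ (s t : ℝ) (z : Cotan n M), F₁ s (F₂ t z) = F₂ t (F₁ s z)) ∧
      PoissonCommute (hamiltonian L₁) (hamiltonian L₂) := by
  have hc₁ := fibreConvex_of_hasMinimizers hL₁ hnd₁ hmin₁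
  have hc₂ := fibreConvex_of_hasMinimizers hL₂ hnd₂ hmin₂
  have hs₁ := isSmoothFun_hamiltonian hL₁ hc₁ hleg₁
  have hs₂ := isSmoothFun_hamiltonian hL₂ hc₂ hleg₂
  have hpc := poissonCommute_of_actionsCommute hL₁ hL₂ hc₁ hc₂ hleg₁ hleg₂ hcomm
  exact ⟨hs₁, hs₂, fun F₁ F₂ hF₁ hF₂ s t z => hF₁.comm hs₁ hs₂ hpc hF₂ s t z, hpc⟩
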